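/- **Setting.** Let $n_p\in\mathbb N$, $A_p\in\mathbb R^{n_p\times n_p}$, $B_p\in\mathbb R^{n_p\times 1}$, $C_p\in\mathbb R^{1\times n_p}$, $k_p,k_i,p_r\in\mathbb R$ (in particular $p_r\in[0,1]$), $h>0$, $n=n_p+1$, and $$\Lambda=\begin{bmatrix}A_p&B_p\\0&0\end{bmatrix},\quad \Lambda_d=\begin{bmatrix}-k_pB_pC_p&0\\-k_iC_p&0\end{bmatrix},\quad K=\begin{bmatrix}0&0\\0&-p_r\end{bmatrix}.$$ A sequence of reset instants $(t_k)_{k\ge 0}$ is called admissible if it is strictly increasing, $t_0=0$, $t_{k+1}-t_k\in[\mathcal T_m,\mathcal T_M]$ and $t_k\to\infty$. The sampled-data system is $$\dot X(t)=\Lambda X(t)+\Lambda_dX(t-h)+\Lambda K X(t_k),\quad t\in(t_k,t_{k+1}],\qquad X=\phi_X\ \text{on }[-h,0].\tag{1}$$ The PI+RI reset control system with resetting set $\mathcal S\subset\mathbb R\times\mathbb R^{n_p+2}$ is $$\dot{\mathbf x}(t)=A\mathbf x(t)+A_d\mathbf x(t-h)\ \text{ if }(t,\mathbf x(t))\notin\mathcal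 S,\quad \mathbf x(t^+)=A_R\mathbf x(t)\ \text{ if }(t,\mathbf x(t))\in\mathcal S,\quad \mathbf x=\phi\text{ on }[-h,0],\tag{2}$$ $$A=\begin{bmatrix}A_p&B_p[\,1-p_r\ \ p_r\,]\\0&0\end{bmatrix},\quad A_d=\begin{bmatrix}-k_pB_pC_p&0\\-k_i\left[\begin{smallmatrix}1\\1\end{smallmatrix}\right]C_p&0\end{bmatrix},\quad A_R=\operatorname{diag}(I_{n_p},1,0);$$ its executions are left-continuous on $(0,\infty)$, and those considered have as positive reset instants exactly $t_1<t_2<\dots$ for some admissible sequence. Initial functions are absolutely continuous on $[-h,0]$ with square integrable derivative, and $\|\phi\|_W=\max_{[-h,0]}\|\phi\|+(\int_{-h}^0\|\dot\phi\|^2)^{1/2}$. System (1) is exponentially stable with decay rate $\alpha$ if for every $\epsilon>0$ there is $\delta>0$ such that, for all admissible $(t_k)$ and all solutions, $\|\phi_X\|_W<\delta$ implies $\|X(t)\|<\epsilon e^{-\alpha t}$ for all $t\ge0$; likewise for (2) with $\phi,\mathbf x$. **Proposition.** Let $\alpha>0$, $0\le\mathcal T_m\le\mathcal T_M$, $N\ge0$,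 $M\ge1$, and let $\mathcal T_m=\mathcal T_0\le\mathcal T_1\le\dots\le\mathcal T_M$ split $[\mathcal T_m,\mathcal T_M]$ into $M$ sub-intervals. Suppose there exist a symmetric $P_N\in\mathbb R^{(N+1)n\times(N+1)n}$, symmetric positive definite $S,R,Q_i,X_i,U_i\in\mathbb R^{n\times n}$, and matrices $Z_i\in\mathbb R^{n\times n}$, $Y_i\in\mathbb R^{(N+3)n\times n}$ $(1\le i\le M)$ such that $$P_N+\tfrac{e^{-2\alpha h}}{h}\operatorname{diag}(0_n,S,3S,\dots,(2N-1)S)>0$$ and, for all $i\in\{1,\dots,M\}$, $$h_1(0)\Pi_{1,i}+h_2(0,\mathcal T)\Pi_{2,i}+h_4(0,\mathcal T_i)N_2^\top X_iN_2<0\quad\text{for }\mathcal T=\mathcal T_{i-1}\text{ and }\mathcal T=\mathcal T_i,$$ $$\begin{bmatrix}h_1(\mathcal T)\Pi_{1,i}+h_4(\mathcal T,\mathcal T_i)N_2^\top X_iN_2&h_3(\mathcal T,\mathcal T_i)Y_i\\ \star&-h_3(\mathcal T,\mathcal T_i)U_i\end{bmatrix}<0\quad\text{for }\mathcal T=\mathcal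 T_{i-1}\text{ and }\mathcal T=\mathcal T_i,$$ where $h_1(\tau)=e^{2\alpha\tau}$, $h_2(\tau,T)=\frac{e^{2\alpha T}-e^{2\alpha\tau}}{2\alpha}$, $h_3(\tau,T)=e^{2\alpha T}\frac{e^{2\alpha\tau}-1}{2\alpha}$, $h_4(\tau,T)=\big((e^{\alpha T}-4)e^{\alpha T}+1\big)e^{2\alpha\tau}+2e^{2\alpha T}$, and, with $\mathrm{He}(A)=A+A^\top$, $$\Pi_{1,i}=\mathrm{He}(G^\top P_NH)+2\alpha G^\top P_NG+\Sigma_N+h^2F^\top RF-\Gamma_N^\top R_N\Gamma_N-N_{12}^\top Q_iN_{12}-\mathrm{He}(N_{12}^\top Z_iN_2)+\mathrm{He}(Y_iN_{12}),$$ $$\Pi_{2,i}=F^\top U_iF+\mathrm{He}(F^\top Q_iN_{12})+\mathrm{He}(F^\top Z_iN_2),$$ $N_1=[I_n\ 0_{n,n(N+2)}]$, $N_2=[0_{n,n(N+2)}\ I_n]$, $N_{12}=N_1-N_2$, $F=[\Lambda\ \ \Lambda_d\ \ 0_{n,nN}\ \ \Lambda K]$, $R_N=e^{-2\alpha h}\operatorname{diag}(R,3R,\dots,(2N+1)R)$,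 $\Sigma_N=\operatorname{diag}(S,-e^{-2\alpha h}S,0_{(N+1)n})$, $$G=\begin{bmatrix}I_n&0&0_{n,nN}&0\\0&0&hI_{nN}&0\end{bmatrix},\quad H=\begin{bmatrix}F\\\Gamma(0)\\\vdots\\\Gamma(N-1)\end{bmatrix},\quad \Gamma_N=\begin{bmatrix}\Gamma(0)\\\vdots\\\Gamma(N)\end{bmatrix},$$ $\Gamma(k)=[I\ \ (-1)^{k+1}I\ \ \gamma_k^0I\ \cdots\ \gamma_k^{N-1}I\ \ 0_n]$, with $\gamma_k^i=-(2i+1)(1-(-1)^{k+i})$ for $i\le k$ and $\gamma_k^i=0$ for $i>k$. Then the sampled-data system (1) is exponentially stable with decay rate $\alpha$, and consequently, for every resetting set $\mathcal S$, the reset control system (2) is exponentially stable with decay rate $\alpha$. -/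

import Mathlib

open MeasureTheory Filter Topology

noncomputable section

namespace ResetPIRI

/-! ### Reset instants, the space `W[-h,0]` -/

/-- `t₀ = 0`, strictly increasing, `t_{k+1} - t_k ∈ [Tm, TM]`, `t_k → ∞`. -/
structure IsResetSequence (Tm TM : ℝ) (t : ℕ → ℝ) : Prop where
  zero : t 0 = 0
  strictMono : StrictMono t
  dwell : ∀ k, t (k + 1) - t k ∈ Set.Icc Tm TM
  tendsto : Tendsto t atTop atTop

section W

variable {E : Type*} [NormedAddCommGroup E] [NormedSpace ℝ E]

/-- `φ ∈ W[-h,0]`: absolutely continuous on `[-h,0]` with square integrable derivative.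
Only the restriction of `φ` to `[-h,0]` matters. -/
def MemW (h : ℝ) (φ : ℝ → E) : Prop :=
  AbsolutelyContinuousOnInterval φ (-h) 0 ∧
    MemLp (deriv φ) 2 (volume.restrict (Set.Icc (-h) 0))

/-- `‖φ‖_W = max_{[-h,0]} ‖φ‖ + (∫_{-h}^0 ‖φ'‖²)^{1/2}`. -/
def normW (h : ℝ) (φ : ℝ → E) : ℝ :=
  (⨆ θ : Set.Icc (-h) (0 : ℝ), ‖φ θ‖) + Real.sqrt (∫ θ in (-h)..0, ‖deriv φ θ‖ ^ 2)

end W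

/-! ### The sampled-data system and the reset system -/

section Systems

variable {ν : Type*} [Fintype ν] [DecidableEq ν]

/-- `X` solves `X'(s) = Λ X(s) + Λd X(s-h) + Λ u(s)`, `u(s) = K X(t_k)` for `s ∈ (t_k, t_{k+1}]`,
with `X = φ` on `[-h,0]`. At `s = t_{k+1}` the derivative is the left one, as `u` jumps there. -/
structure IsSampledSolution (Λ Λd K : Matrix ν ν ℝ) (h : ℝ) (t : ℕ → ℝ)
    (φ X : ℝ → EuclideanSpace ℝ ν) : Prop where
  init : ∀ s ∈ Set.Icc (-h) 0, X s = φ s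
  continuousOn : ContinuousOn X (Set.Ici (-h))
  flow : ∀ k, ∀ s ∈ Set.Ioc (t k) (t (k + 1)),
    HasDerivWithinAt X
      (Λ.toEuclideanLin (X s) + Λd.toEuclideanLin (X (s - h))
        + Λ.toEuclideanLin (K.toEuclideanLin (X (t k))))
      (Set.Ioc (t k) (t (k + 1))) s

/-- Exponential stability with decay rate `α` of the sampled-data system, for all reset instants
with dwell times in `[Tm, TM]` (`δ` depends on `ε` only). -/
def SampledExpStable (Λ Λd K : Matrix ν ν ℝ) (h Tm TM α : ℝ) : Prop :=
  ∀ ε > 0, ∃ δ > 0, ∀ (t : ℕ → ℝ) (φ X : ℝ → EuclideanSpace ℝ ν),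
    IsResetSequence Tm TM t → MemW h φ → IsSampledSolution Λ Λd K h t φ X →
    normW h φ < δ → ∀ s : ℝ, 0 ≤ s → ‖X s‖ < ε * Real.exp (-α * s)

/-- `x` is an execution, with reset instants `t₁ < t₂ < …`, of
`x'(s) = A x(s) + Ad x(s-h)` if `(s, x(s)) ∉ S`, `x(s⁺) = AR x(s)` if `(s, x(s)) ∈ S`,
`x = φ` on `[-h,0]`. Executions are left-continuous: `x(s)` is the value before the reset. -/
structure IsResetSolution (A Ad AR : Matrix ν ν ℝ) (h : ℝ) (S : Set (ℝ × EuclideanSpace ℝ ν))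
    (t : ℕ → ℝ) (φ x : ℝ → EuclideanSpace ℝ ν) : Prop where
  init : ∀ s ∈ Set.Icc (-h) 0, x s = φ s
  instants : ∀ s : ℝ, 0 < s → ((s, x s) ∈ S ↔ ∃ k : ℕ, t (k + 1) = s)
  left_cont : ∀ s : ℝ, 0 < s → ContinuousWithinAt x (Set.Iic s) s
  flow : ∀ s : ℝ, 0 < s → (s, x s) ∉ S →
    HasDerivAt x (A.toEuclideanLin (x s) + Ad.toEuclideanLin (x (s - h))) s
  start : (0, x 0) ∉ S → ContinuousWithinAt x (Set.Ici 0) 0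
  jump : ∀ s : ℝ, 0 ≤ s → (s, x s) ∈ S →
    Tendsto x (𝓝[>] s) (𝓝 (AR.toEuclideanLin (x s)))

/-- Exponential stability with decay rate `α` of the reset system with resetting set `S`, whose
executions have reset instants with dwell times in `[Tm, TM]`. -/
def ResetExpStable (A Ad AR : Matrix ν ν ℝ) (h : ℝ) (S : Set (ℝ × EuclideanSpace ℝ ν))
    (Tm TM α : ℝ) : Prop :=
  ∀ ε > 0, ∃ δ > 0, ∀ (t : ℕ → ℝ) (φ x : ℝ → EuclideanSpace ℝ ν),
    IsResetSequence Tm TM t → MemW h φ → IsResetSolution A Ad AR h S t φ x →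
    normW h φ < δ → ∀ s : ℝ, 0 ≤ s → ‖x s‖ < ε * Real.exp (-α * s)

end Systems

/-! ### The closed-loop matrices -/

section ClosedLoop

variable {np : ℕ} (Ap : Matrix (Fin np) (Fin np) ℝ) (Bp : Matrix (Fin np) (Fin 1) ℝ)
  (Cp : Matrix (Fin 1) (Fin np) ℝ) (kp ki pr : ℝ)

/-- Index set of the state `(x_p, x_s)` of the sampled-data system. -/
abbrev SIdx (np : ℕ) : Type := Fin np ⊕ Fin 1

/-- Index set of the state `(x_p, (x_i, x_ri))` of the reset system. -/
abbrev RIdx (np : ℕ) : Type := Fin np ⊕ Fin 2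

def Lam : Matrix (SIdx np) (SIdx np) ℝ := Matrix.fromBlocks Ap Bp 0 0

def LamD : Matrix (SIdx np) (SIdx np) ℝ :=
  Matrix.fromBlocks (-(kp • (Bp * Cp))) 0 (-(ki • Cp)) 0

def gainK (np : ℕ) (pr : ℝ) : Matrix (SIdx np) (SIdx np) ℝ :=
  Matrix.fromBlocks 0 0 0 !![-pr]

def Br : Matrix (Fin 2) (Fin 1) ℝ := ki • !![1; 1]

def Cr : Matrix (Fin 1) (Fin 2) ℝ := !![1 - pr, pr]

def clA : Matrix (RIdx np) (RIdx np) ℝ := Matrix.fromBlocks Ap (Bp * Cr pr) 0 0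

def clAd : Matrix (RIdx np) (RIdx np) ℝ :=
  Matrix.fromBlocks (-(kp • (Bp * Cp))) 0 (-(Br ki * Cp)) 0

def clAR (np : ℕ) : Matrix (RIdx np) (RIdx np) ℝ :=
  Matrix.fromBlocks 1 0 0 !![1, 0; 0, 0]

end ClosedLoop

/-! ### The weights and matrices of the LMIs -/

def h1 (α τ : ℝ) : ℝ := Real.exp (2 * α * τ)

def h2 (α τ T : ℝ) : ℝ := (Real.exp (2 * α * T) - Real.exp (2 * α * τ)) / (2 * α)

def h3 (α τ T : ℝ) : ℝ := Real.exp (2 * α * T) * ((Real.exp (2 * α * τ) - 1) / (2 * α))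

def h4 (α τ T : ℝ) : ℝ :=
  ((Real.exp (α * T) - 4) * Real.exp (α * T) + 1) * Real.exp (2 * α * τ)
    + 2 * Real.exp (2 * α * T)

section LMI

variable {ν : Type*} [Fintype ν] [DecidableEq ν]

/-- Index set of the augmented state `(χ(0), ∫ L₀ χ, …, ∫ L_{N-1} χ)`, of size `(N+1)n`. -/
abbrev AugIdx (ν : Type*) (N : ℕ) : Type _ := ν ⊕ (ν × Fin N)

/-- Index set of the block columns `[n | n | nN | n]`, of size `(N+3)n`. -/
abbrev XiIdx (ν : Type*) (N : ℕ) : Type _ := ν ⊕ (ν ⊕ ((ν × Fin N) ⊕ ν))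

/-- The row of blocks `[A B C D]` with block widths `n, n, nN, n`. -/
def rowBlocks {m : Type*} {N : ℕ} (A B : Matrix m ν ℝ) (C : Matrix m (ν × Fin N) ℝ)
    (D : Matrix m ν ℝ) : Matrix m (XiIdx ν N) ℝ :=
  Matrix.fromCols A (Matrix.fromCols B (Matrix.fromCols C D))

def He {m : Type*} (A : Matrix m m ℝ) : Matrix m m ℝ := A + A.transpose

def NegDef {m : Type*} (A : Matrix m m ℝ) : Prop := (-A).PosDef

def gammaCoeff (k i : ℕ) : ℝ :=
  if i ≤ k then -(2 * (i : ℝ) + 1) * (1 - (-1) ^ (k + i)) else 0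

/-- `Γ(k) = [I, (-1)^{k+1} I, γ_k^0 I, …, γ_k^{N-1} I, 0]`. -/
def Gam (ν : Type*) [DecidableEq ν] (N k : ℕ) : Matrix ν (XiIdx ν N) ℝ :=
  rowBlocks 1 ((-1 : ℝ) ^ (k + 1) • 1)
    (Matrix.of fun a p => if a = p.1 then gammaCoeff k p.2 else 0) 0

/-- The blocks `Γ(0), …, Γ(m-1)` stacked. -/
def GamStack (ν : Type*) [DecidableEq ν] (N m : ℕ) : Matrix (ν × Fin m) (XiIdx ν N) ℝ :=
  Matrix.of fun p j => Gam ν N p.2 p.1 j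

def matF (Λ Λd K : Matrix ν ν ℝ) (N : ℕ) : Matrix ν (XiIdx ν N) ℝ :=
  rowBlocks Λ Λd 0 (Λ * K)

def matG (ν : Type*) [DecidableEq ν] (N : ℕ) (h : ℝ) : Matrix (AugIdx ν N) (XiIdx ν N) ℝ :=
  Matrix.fromRows (rowBlocks 1 0 0 0) (rowBlocks 0 0 (h • 1) 0)

def matH (Λ Λd K : Matrix ν ν ℝ) (N : ℕ) : Matrix (AugIdx ν N) (XiIdx ν N) ℝ :=
  Matrix.fromRows (matF Λ Λd K N) (GamStack ν N N)

def N1 (ν : Type*) [DecidableEq ν] (N : ℕ) : Matrix ν (XiIdx ν N) ℝ := rowBlocks 1 0 0 0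

def N2 (ν : Type*) [DecidableEq ν] (N : ℕ) : Matrix ν (XiIdx ν N) ℝ := rowBlocks 0 0 0 1

def N12 (ν : Type*) [DecidableEq ν] (N : ℕ) : Matrix ν (XiIdx ν N) ℝ := N1 ν N - N2 ν N

/-- `diag(A, 3A, …, (2m-1)A)`. -/
def oddDiag (A : Matrix ν ν ℝ) (m : ℕ) : Matrix (ν × Fin m) (ν × Fin m) ℝ :=
  Matrix.blockDiagonal fun k : Fin m => (2 * (k : ℝ) + 1) • A

def matRN (R : Matrix ν ν ℝ) (N : ℕ) (α h : ℝ) :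
    Matrix (ν × Fin (N + 1)) (ν × Fin (N + 1)) ℝ :=
  Real.exp (-2 * α * h) • oddDiag R (N + 1)

/-- `diag(S, -e^{-2αh} S, 0_{(N+1)n})`. -/
def matSigma (S : Matrix ν ν ℝ) (N : ℕ) (α h : ℝ) : Matrix (XiIdx ν N) (XiIdx ν N) ℝ :=
  Matrix.fromBlocks S 0 0 (Matrix.fromBlocks (-(Real.exp (-2 * α * h) • S)) 0 0 0)

open Matrix in
def Pi1 (Λ Λd K : Matrix ν ν ℝ) (N : ℕ) (α h : ℝ)
    (P : Matrix (AugIdx ν N) (AugIdx ν N) ℝ) (S R Q Z : Matrix ν ν ℝ)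
    (Y : Matrix (XiIdx ν N) ν ℝ) : Matrix (XiIdx ν N) (XiIdx ν N) ℝ :=
  He ((matG ν N h)ᵀ * P * matH Λ Λd K N)
    + (2 * α) • ((matG ν N h)ᵀ * P * matG ν N h)
    + matSigma S N α h
    + h ^ 2 • ((matF Λ Λd K N)ᵀ * R * matF Λ Λd K N)
    - (GamStack ν N (N + 1))ᵀ * matRN R N α h * GamStack ν N (N + 1)
    - (N12 ν N)ᵀ * Q * N12 ν N
    - He ((N12 ν N)ᵀ * Z * N2 ν N)
    + He (Y * N12 ν N)

open Matrix in
def Pi2 (Λ Λd K : Matrix ν ν ℝ) (N : ℕ) (Q U Z : Matrix ν ν ℝ) :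
    Matrix (XiIdx ν N) (XiIdx ν N) ℝ :=
  (matF Λ Λd K N)ᵀ * U * matF Λ Λd K N
    + He ((matF Λ Λd K N)ᵀ * Q * N12 ν N)
    + He ((matF Λ Λd K N)ᵀ * Z * N2 ν N)

open Matrix in
/-- Feasibility of the LMIs, for the partition `𝒯₀ ≤ … ≤ 𝒯_M` of the interval of dwell times.
The index `i : Fin M` stands for the sub-interval from `𝒯 i.castSucc` to `𝒯 i.succ`. -/
def LMIFeasible (Λ Λd K : Matrix ν ν ℝ) (N M : ℕ) (α h : ℝ) (𝒯 : Fin (M + 1) → ℝ) : Prop :=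
  ∃ (P : Matrix (AugIdx ν N) (AugIdx ν N) ℝ) (S R : Matrix ν ν ℝ)
    (Q X U Z : Fin M → Matrix ν ν ℝ) (Y : Fin M → Matrix (XiIdx ν N) ν ℝ),
    P.IsSymm ∧ S.PosDef ∧ R.PosDef ∧
    (∀ i, (Q i).PosDef ∧ (X i).PosDef ∧ (U i).PosDef) ∧
    (P + (Real.exp (-2 * α * h) / h) • Matrix.fromBlocks 0 0 0 (oddDiag S N)).PosDef ∧
    ∀ i : Fin M,
      let T₀ := 𝒯 i.castSucc
      let T₁ := 𝒯 i.succ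
      let Pa := Pi1 Λ Λd K N α h P S R (Q i) (Z i) (Y i)
      let Pb := Pi2 Λ Λd K N (Q i) (U i) (Z i)
      let Xa := (N2 ν N)ᵀ * X i * N2 ν N
      NegDef (h1 α 0 • Pa + h2 α 0 T₀ • Pb + h4 α 0 T₁ • Xa) ∧
      NegDef (h1 α 0 • Pa + h2 α 0 T₁ • Pb + h4 α 0 T₁ • Xa) ∧
      NegDef (Matrix.fromBlocks
        (h1 α T₀ • Pa + h4 α T₀ T₁ • Xa) (h3 α T₀ T₁ • Y i)
        (h3 α T₀ T₁ • Y i)ᵀ (-(h3 α T₀ T₁ • U i))) ∧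
      NegDef (Matrix.fromBlocks
        (h1 α T₁ • Pa + h4 α T₁ T₁ • Xa) (h3 α T₁ T₁ • Y i)
        (h3 α T₁ T₁ • Y i)ᵀ (-(h3 α T₁ T₁ • U i)))

end LMI

end ResetPIRI

end

/-! The sampled-data system is treated by a Lyapunov–Krasovskii argument in which every term carries
the weight e^{2αt}, so that boundedness of the functional is already decay at rate α. The functional
`lyap` is the sum of a quadratic form P in X(t) and its first N Legendre moments over the delay
interval, an S-integral over that interval, and the double integral h∫_{t-h}^t∫_s^t e^{2αr}
X'(r)ᵀRX'(r) dr ds, written through the primitive `energy`. Bessel's inequality enters twice.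
Applied to X, it trades the S-integral for the block diag(S,3S,…) that makes P positive
(`exists_mul_sum_sq_le_lyap`). Applied to X', it turns the dissipation of R into the term
−Γ_NᵀR_NΓ_N (`IsTrajectory.exists_hasDerivAt_lyap`). The rows Γ(k) appear because γ_k^i are the
coefficients of the derivative of a Legendre polynomial in terms of the lower ones
(`derivative_legendreUnit`).

The sampled input is absorbed by `looped`, a functional that is zero at the start of each sampling
interval and nonnegative at its end. If the sum of the two functionals decreases on the interval,
then `lyap` decreases from t_k to t_{k+1}; inside the interval only a lower bound of `looped` by
−const·|X(t_k)|² is needed. The derivative of the sum is estimated by an expression affine in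
e^{2ατ}, where τ is the time since t_k, whose values at τ = 0 and τ = T are affine in e^{2αT}. The
LMIs give its sign at the vertices (`weighted_sum_nonpos`). The integral of X'ᵀUX' is removed by
completing a square with Y (`neg_integral_bil_le`, `bil_schur_block`), and the X_i-term has the
right sign at the end of the interval by `h4Prim_nonneg`. Together these give `exists_decay`.

For the reset system, x_ri − x_i is constant between resets and equals −x_i(t_k) after the reset at
t_k. Hence (x_p, x_i) is continuous and solves the sampled-data equation from t_1 on. On the first
interval the offset is arbitrary, determined by the initial data and by a possible reset at 0. There
`exists_first_interval_bound` gives a Grönwall-type estimate, and the decay argument is restarted at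
t_1 (`exists_decay_after_first`). Finally x_ri is recovered from x_i and the offset. -/

noncomputable section

namespace ResetPIRI

section Legendre

open Polynomial

/-! ### Shifted Legendre polynomials -/

/-- The shifted Legendre polynomial on `[0,1]`, with real coefficients. -/
def legendreUnit (k : ℕ) : ℝ[X] := (shiftedLegendre k).map (Int.castRingHom ℝ)

lemma legendreUnit_zero : legendreUnit 0 = 1 := by
  simp [legendreUnit, shiftedLegendre]

lemma legendreUnit_one : legendreUnit 1 = 1 - C 2 * X := by
  simp [legendreUnit, shiftedLegendre, Finset.sum_range_succ, show (C (2 : ℝ)) = 2 from rfl]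
  ring

lemma legendreUnit_eval_zero (k : ℕ) : (legendreUnit k).eval 0 = 1 := by
  rw [← coeff_zero_eq_eval_zero, legendreUnit, coeff_map, coeff_shiftedLegendre]
  simp

lemma legendreUnit_eval_one_sub (k : ℕ) (x : ℝ) :
    (legendreUnit k).eval (1 - x) = (-1) ^ k * (legendreUnit k).eval x := by
  have := shiftedLegendre_eval_symm k (1 - x)
  simpa [legendreUnit, eval_map, aeval_def] using this

lemma legendreUnit_eval_one (k : ℕ) : (legendreUnit k).eval 1 = (-1) ^ k := by
  have := legendreUnit_eval_one_sub k 0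
  simpa [legendreUnit_eval_zero] using this

lemma factorial_mul_legendreUnit (n : ℕ) :
    (C (n.factorial : ℝ)) * legendreUnit n = derivative^[n] ((X * (1 - X)) ^ n) := by
  have := congrArg (Polynomial.map (Int.castRingHom ℝ)) (factorial_mul_shiftedLegendre_eq n)
  rw [Polynomial.map_mul, ← Polynomial.iterate_derivative_map] at this
  simpa [legendreUnit, mul_pow] using this

/-- By Rodrigues' formula it suffices to differentiate powers of w = X(1−X). Since (1−2X)² = 1 − 4w,
the second derivative of w^{n+2} is a combination of w^n and w^{n+1}; differentiate it n+1 more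
times. -/
lemma derivative_legendreUnit_add_two (n : ℕ) :
    derivative (legendreUnit (n + 2)) =
      derivative (legendreUnit n) - C (2 * (2 * (n : ℝ) + 3)) * legendreUnit (n + 1) := by
  have e2 : derivative^[2] ((X * (1 - X) : ℝ[X]) ^ (n + 2)) =
      C (((n : ℝ) + 2) * (n + 1)) * (X * (1 - X)) ^ n
        - C (((n : ℝ) + 2) * (4 * n + 6)) * (X * (1 - X)) ^ (n + 1) := by
    simp [Function.iterate_succ, derivative_pow, derivative_mul, show (C (2 : ℝ)) = 2 from rfl,
      show (C (4 : ℝ)) = 4 from rfl, show (C (6 : ℝ)) = 6 from rfl]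
    ring
  have hn2 : C ((n + 2).factorial : ℝ) * derivative (legendreUnit (n + 2)) =
      C ((n + 2).factorial : ℝ) * (derivative (legendreUnit n)
        - C (2 * (2 * (n : ℝ) + 3)) * legendreUnit (n + 1)) := by
    rw [← derivative_C_mul, factorial_mul_legendreUnit, ← Function.iterate_succ_apply' derivative,
      show (n + 2).succ = (n + 1) + 2 by rfl, Function.iterate_add_apply, e2,
      iterate_map_sub, iterate_derivative_C_mul, iterate_derivative_C_mul,
      ← factorial_mul_legendreUnit, Function.iterate_succ_apply', ← factorial_mul_legendreUnit,
      derivative_C_mul]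
    simp only [Nat.factorial_succ]
    push_cast
    simp only [map_mul, map_add, map_natCast, map_ofNat, map_one]
    ring
  have h0 : C ((n + 2).factorial : ℝ) ≠ 0 := by
    simpa using (Nat.factorial_pos (n + 2)).ne'
  exact mul_left_cancel₀ h0 hn2

lemma gammaCoeff_add_two {k i : ℕ} (hi : i < k) : gammaCoeff (k + 2) i = gammaCoeff k i := by
  have h1 : i ≤ k + 2 := by omega
  have h2 : i ≤ k := by omega
  simp only [gammaCoeff, h1, h2, if_true]
  rw [show k + 2 + i = (k + i) + 2 by ring, pow_add]; simp

lemma gammaCoeff_self (k : ℕ) : gammaCoeff k k = 0 := by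
  simp [gammaCoeff, ← two_mul]

lemma gammaCoeff_succ_self (k : ℕ) : gammaCoeff (k + 1) k = -(2 * (2 * (k : ℝ) + 1)) := by
  have : (-1 : ℝ) ^ (k + 1 + k) = -1 := Odd.neg_one_pow ⟨k, by ring⟩
  simp [gammaCoeff, this]; ring

/-- This is where the coefficients of Γ(k) come from. In the two-step recursion the sum for k+2
gains only the term i = k+1, because the term i = k is killed by parity. -/
lemma derivative_legendreUnit (k : ℕ) :
    derivative (legendreUnit k) =
      ∑ i ∈ Finset.range k, C (gammaCoeff k i) * legendreUnit i := by
  induction k using Nat.twoStepInduction with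
  | zero => simp [legendreUnit_zero]
  | one => simp [legendreUnit_one, legendreUnit_zero, gammaCoeff]; norm_num; rfl
  | more k ih _ =>
    rw [derivative_legendreUnit_add_two, ih, Finset.sum_range_succ, Finset.sum_range_succ,
      show k + 2 = (k + 1) + 1 by rfl, gammaCoeff_succ_self (k + 1)]
    have h1 : gammaCoeff (k + 1 + 1) k = 0 := by
      simp [gammaCoeff, show k + 1 + 1 + k = 2 * (k + 1) by ring]
    have h2 : ∑ i ∈ Finset.range k, C (gammaCoeff (k + 1 + 1) i) * legendreUnit i
        = ∑ i ∈ Finset.range k, C (gammaCoeff k i) * legendreUnit i :=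
      Finset.sum_congr rfl fun i hi => by rw [gammaCoeff_add_two (Finset.mem_range.1 hi)]
    rw [h1, h2]
    push_cast
    simp only [map_neg, map_mul, map_add, map_zero, map_one, map_ofNat, map_natCast]
    ring

/-- The inner product of `L²(0,1)` on polynomials. -/
def unitInner (p q : ℝ[X]) : ℝ := ∫ x in (0 : ℝ)..1, p.eval x * q.eval x

lemma unitInner_comm (p q : ℝ[X]) : unitInner p q = unitInner q p := by
  simp [unitInner, mul_comm]

lemma intervalIntegrable_eval_mul_eval (p q : ℝ[X]) (a b : ℝ) :
    IntervalIntegrable (fun x => p.eval x * q.eval x) volume a b :=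
  (p.continuous.mul q.continuous).intervalIntegrable _ _

lemma unitInner_C_mul_left (c : ℝ) (p q : ℝ[X]) : unitInner (C c * p) q = c * unitInner p q := by
  simp [unitInner, mul_assoc]

lemma unitInner_sub_left (p p' q : ℝ[X]) :
    unitInner (p - p') q = unitInner p q - unitInner p' q := by
  rw [unitInner, unitInner, unitInner, ← intervalIntegral.integral_sub
    (intervalIntegrable_eval_mul_eval ..) (intervalIntegrable_eval_mul_eval ..)]
  simp [sub_mul]

lemma unitInner_sum_left {ι : Type*} (s : Finset ι) (p : ι → ℝ[X]) (q : ℝ[X]) :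
    unitInner (∑ i ∈ s, p i) q = ∑ i ∈ s, unitInner (p i) q := by
  simp only [unitInner]
  rw [← intervalIntegral.integral_finsetSum fun i _ => intervalIntegrable_eval_mul_eval ..]
  simp [eval_finsetSum, Finset.sum_mul]

lemma unitInner_derivative_add (p q : ℝ[X]) :
    unitInner (derivative p) q + unitInner p (derivative q) =
      p.eval 1 * q.eval 1 - p.eval 0 * q.eval 0 := by
  have := intervalIntegral.integral_deriv_mul_eq_sub (a := 0) (b := 1)
    (u := fun x => p.eval x) (v := fun x => q.eval x)
    (u' := fun x => (derivative p).eval x) (v' := fun x => (derivative q).eval x)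
    (fun x _ => p.hasDerivAt x) (fun x _ => q.hasDerivAt x)
    ((derivative p).continuous.intervalIntegrable _ _)
    ((derivative q).continuous.intervalIntegrable _ _)
  rw [← this, unitInner, unitInner, ← intervalIntegral.integral_add
    (intervalIntegrable_eval_mul_eval ..) (intervalIntegrable_eval_mul_eval ..)]

/-- Polynomials of consecutive degrees have opposite parity under x ↦ 1−x, so their product is odd
about 1/2. -/
lemma unitInner_legendreUnit_succ_self (k : ℕ) :
    unitInner (legendreUnit (k + 1)) (legendreUnit k) = 0 := by
  have h := intervalIntegral.integral_comp_sub_left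
    (fun x => (legendreUnit (k + 1)).eval x * (legendreUnit k).eval x) (a := 0) (b := 1) 1
  simp only [sub_self, sub_zero, legendreUnit_eval_one_sub] at h
  have h2 : ∀ x : ℝ, (-1) ^ (k + 1) * (legendreUnit (k + 1)).eval x *
      ((-1) ^ k * (legendreUnit k).eval x) =
      -((legendreUnit (k + 1)).eval x * (legendreUnit k).eval x) := by
    intro x
    have : (-1 : ℝ) ^ (k + 1) * (-1) ^ k = -1 := by
      rw [← pow_add]; exact Odd.neg_one_pow ⟨k, by ring⟩
    linear_combination ((legendreUnit (k + 1)).eval x * (legendreUnit k).eval x) * this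
  simp only [h2, intervalIntegral.integral_neg] at h
  rw [unitInner]; linarith

/-- Rodrigues' formula again, now with one derivative of w^{n+1} and Leibniz' rule for the iterated
derivative of w^n·X. It serves to compute the norm of the polynomials. -/
lemma derivative_legendreUnit_succ (n : ℕ) :
    derivative (legendreUnit (n + 1)) =
      (1 - C 2 * X) * derivative (legendreUnit n) - C (2 * ((n : ℝ) + 1)) * legendreUnit n := by
  have e1 : derivative ((X * (1 - X) : ℝ[X]) ^ (n + 1)) =
      C ((n : ℝ) + 1) * ((X * (1 - X)) ^ n - C 2 * ((X * (1 - X)) ^ n * X)) := by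
    simp [derivative_pow, derivative_mul, show (C (2 : ℝ)) = 2 from rfl]
    ring
  have hn : C ((n + 1).factorial : ℝ) * derivative (legendreUnit (n + 1)) =
      C ((n + 1).factorial : ℝ) * ((1 - C 2 * X) * derivative (legendreUnit n)
        - C (2 * ((n : ℝ) + 1)) * legendreUnit n) := by
    rw [← derivative_C_mul, factorial_mul_legendreUnit, ← Function.iterate_succ_apply' derivative,
      show (n + 1).succ = (n + 1) + 1 by rfl, Function.iterate_add_apply, Function.iterate_one, e1,
      iterate_derivative_C_mul, iterate_map_sub, iterate_derivative_C_mul,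
      iterate_derivative_mul_X, Function.iterate_succ_apply', Nat.add_sub_cancel,
      ← factorial_mul_legendreUnit, derivative_C_mul]
    simp only [Nat.factorial_succ]
    push_cast
    simp only [map_mul, map_add, map_natCast, map_one, nsmul_eq_mul, show (C (2 : ℝ)) = 2 from rfl]
    push_cast
    ring
  have h0 : C ((n + 1).factorial : ℝ) ≠ 0 := by
    simpa using (Nat.factorial_pos (n + 1)).ne'
  exact mul_left_cancel₀ h0 hn

/-- Orthogonality of the shifted Legendre polynomials. -/
lemma unitInner_legendreUnit_aux (k : ℕ) :
    (∀ j < k, unitInner (legendreUnit k) (legendreUnit j) = 0) ∧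
      unitInner (legendreUnit k) (legendreUnit k) = 1 / (2 * (k : ℝ) + 1) := by
  induction k using Nat.strong_induction_on with
  | _ k ih =>
  -- Integrate by parts: the boundary term (−1)^{m+j} − 1 cancels against the only surviving term
  -- γ_m^j/(2j+1) of the expansion of the derivative of degree m.
  have key : ∀ m, (∀ i < m, ∀ j < m, i ≠ j → unitInner (legendreUnit i) (legendreUnit j) = 0) →
      (∀ i < m, unitInner (legendreUnit i) (legendreUnit i) = 1 / (2 * (i : ℝ) + 1)) →
      ∀ j < m, unitInner (legendreUnit m) (derivative (legendreUnit j)) = 0 := by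
    intro m h1 h2 j hj
    have h3 := unitInner_derivative_add (legendreUnit m) (legendreUnit j)
    rw [derivative_legendreUnit m, unitInner_sum_left,
      Finset.sum_eq_single_of_mem j (Finset.mem_range.2 hj), unitInner_C_mul_left, h2 j hj] at h3
    · simp only [legendreUnit_eval_zero, legendreUnit_eval_one, gammaCoeff, hj.le, if_true,
        ← pow_add] at h3
      have : (2 * (j : ℝ) + 1) ≠ 0 := by positivity
      field_simp at h3
      linarith
    · intro i hi hij
      rw [unitInner_C_mul_left, h1 i (Finset.mem_range.1 hi) j hj hij, mul_zero]
  have orth : ∀ i < k, ∀ j < k, i ≠ j → unitInner (legendreUnit i) (legendreUnit j) = 0 := by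
    intro i hi j hj hij
    rcases lt_or_gt_of_ne hij with h | h
    · rw [unitInner_comm]; exact (ih j hj).1 i h
    · exact (ih i hi).1 j h
  have keyk := key k orth fun i hi => (ih i hi).2
  have hlt : ∀ j < k, unitInner (legendreUnit k) (legendreUnit j) = 0 := by
    intro j hj
    rcases Nat.lt_or_ge (j + 1) k with h | h
    -- For j+1 < k the polynomial of degree j is a combination of derivatives of polynomials of
    -- degree below k, to which `keyk` applies.
    · have e : C (2 * (2 * (j : ℝ) + 1)) * legendreUnit j =
          (if j = 0 then 0 else derivative (legendreUnit (j - 1)))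
            - derivative (legendreUnit (j + 1)) := by
        rcases j with _ | j
        · simp [legendreUnit_zero, legendreUnit_one]
        · rw [derivative_legendreUnit_add_two]
          push_cast
          simp only [map_mul, map_add, map_natCast, map_one, show (C (2 : ℝ)) = 2 from rfl,
            show (C (3 : ℝ)) = 3 from rfl]
          ring
      have e2 : unitInner (C (2 * (2 * (j : ℝ) + 1)) * legendreUnit j) (legendreUnit k) = 0 := by
        rw [e, unitInner_sub_left, unitInner_comm _ (legendreUnit k),
          unitInner_comm _ (legendreUnit k), keyk (j + 1) h]
        split_ifs with hj0
        · simp [unitInner]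
        · rw [keyk (j - 1) (by omega)]; simp
      rw [unitInner_C_mul_left] at e2
      rw [unitInner_comm]
      have : (2 * (2 * (j : ℝ) + 1)) ≠ 0 := by positivity
      exact (mul_eq_zero.1 e2).resolve_left this
    -- The remaining case j = k−1 is out of reach of `keyk` and is settled by parity.
    · obtain rfl : k = j + 1 := by omega
      exact unitInner_legendreUnit_succ_self j
  refine ⟨hlt, ?_⟩
  -- With p the polynomial of degree k, `h1` and an integration by parts in `h2` give two linear
  -- relations between ⟨p,p⟩ and ⟨(1−2X)p',p⟩; eliminating the latter yields the norm.
  have h1 : unitInner (derivative (legendreUnit (k + 1))) (legendreUnit k) =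
      -(2 * (2 * (k : ℝ) + 1)) * unitInner (legendreUnit k) (legendreUnit k) := by
    rw [derivative_legendreUnit (k + 1), unitInner_sum_left, Finset.sum_range_succ,
      Finset.sum_eq_zero, unitInner_C_mul_left, gammaCoeff_succ_self, zero_add]
    intro i hi
    rw [unitInner_C_mul_left, unitInner_comm, hlt i (Finset.mem_range.1 hi), mul_zero]
  rw [derivative_legendreUnit_succ, unitInner_sub_left, unitInner_C_mul_left] at h1
  have h2 := unitInner_derivative_add (legendreUnit k) ((1 - C 2 * X) * legendreUnit k)
  have h3 : derivative ((1 - C 2 * X) * legendreUnit k) =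
      (1 - C 2 * X) * derivative (legendreUnit k) - C 2 * legendreUnit k := by
    simp [derivative_mul]; ring
  have h4 : unitInner (derivative (legendreUnit k)) ((1 - C 2 * X) * legendreUnit k) =
      unitInner ((1 - C 2 * X) * derivative (legendreUnit k)) (legendreUnit k) := by
    simp only [unitInner, eval_mul]
    congr 1; ext x; ring
  rw [h3, unitInner_comm (legendreUnit k), unitInner_sub_left, unitInner_C_mul_left, h4] at h2
  simp only [legendreUnit_eval_zero, legendreUnit_eval_one, eval_mul, eval_sub, eval_one, eval_C,
    eval_X] at h2
  have h5 : (-1 : ℝ) ^ k * (-1) ^ k = 1 := by rw [← mul_pow]; simp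
  have : (2 * (k : ℝ) + 1) ≠ 0 := by positivity
  rw [eq_div_iff this]
  linear_combination h1 - (1 / 2 : ℝ) * h2 + (1 / 2 : ℝ) * h5

lemma unitInner_legendreUnit (i j : ℕ) :
    unitInner (legendreUnit i) (legendreUnit j) = if i = j then 1 / (2 * (i : ℝ) + 1) else 0 := by
  split_ifs with h
  · subst h; exact (unitInner_legendreUnit_aux i).2
  · rcases lt_or_gt_of_ne h with h | h
    · rw [unitInner_comm]; exact (unitInner_legendreUnit_aux j).1 i h
    · exact (unitInner_legendreUnit_aux i).1 j h

/-! ### Legendre polynomials on `[-h, 0]` -/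

/-- The Legendre polynomial of the interval `[-h,0]`, with value `1` at `0`. -/
def legendreDelay (h : ℝ) (k : ℕ) : ℝ[X] := (legendreUnit k).comp (C (-1 / h) * X)

lemma legendreDelay_eval (h : ℝ) (k : ℕ) (θ : ℝ) :
    (legendreDelay h k).eval θ = (legendreUnit k).eval (-1 / h * θ) := by
  simp [legendreDelay]

lemma legendreDelay_eval_zero (h : ℝ) (k : ℕ) : (legendreDelay h k).eval 0 = 1 := by
  simp [legendreDelay_eval, legendreUnit_eval_zero]

lemma legendreDelay_eval_neg {h : ℝ} (hh : h ≠ 0) (k : ℕ) :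
    (legendreDelay h k).eval (-h) = (-1) ^ k := by
  rw [legendreDelay_eval, show -1 / h * -h = 1 by field_simp, legendreUnit_eval_one]

lemma derivative_legendreDelay (h : ℝ) (k : ℕ) :
    derivative (legendreDelay h k) =
      -∑ i ∈ Finset.range k, C (gammaCoeff k i / h) * legendreDelay h i := by
  rw [legendreDelay, derivative_comp, derivative_legendreUnit, Polynomial.sum_comp,
    Finset.mul_sum, ← Finset.sum_neg_distrib]
  refine Finset.sum_congr rfl fun i _ => ?_
  have : C (gammaCoeff k i / h) = -(C (-1 / h) * C (gammaCoeff k i)) := by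
    rw [← C_mul, ← C_neg]; congr 1; ring
  rw [this]
  simp [legendreDelay]
  ring

lemma integral_legendreDelay_mul {h : ℝ} (hh : 0 < h) (i j : ℕ) :
    ∫ θ in (-h)..0, (legendreDelay h i).eval θ * (legendreDelay h j).eval θ =
      if i = j then h / (2 * (i : ℝ) + 1) else 0 := by
  have hc : (-1 / h) ≠ 0 := div_ne_zero (by norm_num) hh.ne'
  have := intervalIntegral.integral_comp_mul_left (a := -h) (b := 0)
    (fun x => (legendreUnit i).eval x * (legendreUnit j).eval x) hc
  simp only [legendreDelay_eval]
  rw [this, show -1 / h * -h = 1 by field_simp, mul_zero, intervalIntegral.integral_symm]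
  have h2 := unitInner_legendreUnit i j
  rw [unitInner] at h2
  rw [h2]
  split_ifs
  · simp; field_simp
  · simp

/-! ### Functions with a locally square integrable derivative -/

instance (a b : ℝ) : IsFiniteMeasure (volume.restrict (Set.uIoc a b)) := by
  rw [Set.uIoc]; infer_instance

/-- `f` is a primitive of the locally square integrable function `g`. -/
structure HasL2Deriv (f g : ℝ → ℝ) : Prop where
  memLp : ∀ a b, MemLp g 2 (volume.restrict (Set.uIoc a b))
  ftc : ∀ a b, f b - f a = ∫ s in a..b, g s

namespace HasL2Deriv

variable {f g f' g' : ℝ → ℝ}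

lemma intervalIntegrable (H : HasL2Deriv f g) (a b : ℝ) : IntervalIntegrable g volume a b := by
  rw [intervalIntegrable_iff]
  exact (H.memLp a b).integrable (by norm_num)

lemma intervalIntegrable_mul (H : HasL2Deriv f g) (H' : HasL2Deriv f' g') (a b : ℝ) :
    IntervalIntegrable (fun s => g s * g' s) volume a b := by
  rw [intervalIntegrable_iff]
  exact (H.memLp a b).integrable_mul (H'.memLp a b)

lemma eq_add_integral (H : HasL2Deriv f g) (a t : ℝ) : f t = f a + ∫ s in a..t, g s := by
  rw [← H.ftc]; ring

lemma continuous (H : HasL2Deriv f g) : Continuous f := by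
  have : f = fun t => f 0 + ∫ s in (0 : ℝ)..t, g s := funext fun t => H.eq_add_integral 0 t
  rw [this]
  exact continuous_const.add
    (intervalIntegral.continuous_primitive (fun a b => H.intervalIntegrable a b) 0)

lemma comp_add_left (H : HasL2Deriv f g) (t : ℝ) :
    HasL2Deriv (fun s => f (t + s)) (fun s => g (t + s)) where
  memLp a b := by
    have h1 := H.memLp (t + a) (t + b)
    have h2 : MeasurePreserving (fun s : ℝ => t + s) (volume.restrict (Set.uIoc a b))
        (volume.restrict (Set.uIoc (t + a) (t + b))) := by
      have := (measurePreserving_add_left (volume : Measure ℝ) t).restrict_preimage_emb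
        (measurableEmbedding_addLeft t) (Set.uIoc (t + a) (t + b))
      have e : (fun s : ℝ => t + s) ⁻¹' Set.uIoc (t + a) (t + b) = Set.uIoc a b := by
        ext s
        simp only [Set.mem_preimage, Set.uIoc, Set.mem_Ioc, min_add_add_left, max_add_add_left,
          add_lt_add_iff_left, add_le_add_iff_left]
      rwa [e] at this
    exact h1.comp_measurePreserving h2
  ftc a b := by
    rw [H.ftc, intervalIntegral.integral_comp_add_left]

/-- Integration by parts for absolutely continuous functions. By Lebesgue differentiation `g` agrees
almost everywhere with the derivative of `f`. -/
lemma integral_eval_mul (H : HasL2Deriv f g) (p : ℝ[X]) (a b : ℝ) :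
    ∫ s in a..b, p.eval s * g s =
      p.eval b * f b - p.eval a * f a - ∫ s in a..b, (derivative p).eval s * f s := by
  have hac : AbsolutelyContinuousOnInterval f a b := by
    have h1 := (H.intervalIntegrable a b).absolutelyContinuousOnInterval_intervalIntegral
      (c := a) (by simp)
    have h2 : AbsolutelyContinuousOnInterval (fun _ : ℝ => f a) a b :=
      (LipschitzWith.const (f a)).lipschitzOnWith.absolutelyContinuousOnInterval
    have e : f = (fun _ : ℝ => f a) + fun t => ∫ s in a..t, g s :=
      funext fun t => H.eq_add_integral a t
    rw [e]
    exact h2.add h1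
  have hp : AbsolutelyContinuousOnInterval (fun s => p.eval s) a b :=
    (by simpa [coe_aeval_eq_eval] using! p.contDiff_aeval (𝕜 := ℝ) 1 :
      ContDiff ℝ 1 fun s : ℝ => p.eval s).contDiffOn.absolutelyContinuousOnInterval
  have h := hp.integral_mul_deriv_eq_deriv_mul hac
  simp only [Polynomial.deriv] at h
  rw [← h]
  refine intervalIntegral.integral_congr_ae ?_
  have := (H.intervalIntegrable a b).ae_hasDerivAt_integral
  filter_upwards [this] with s hs hsI
  have hs' := hs (Set.uIoc_subset_uIcc hsI) a (by simp)
  have e : f = fun t => f a + ∫ s in a..t, g s := funext fun t => H.eq_add_integral a t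
  have : HasDerivAt f (g s) s := by
    rw [e]; simpa using hs'.const_add (f a)
  rw [this.deriv]

end HasL2Deriv

/-- As f is only continuous, one cannot differentiate under the integral sign. Integrating by parts
against a primitive F of f leaves boundary terms, which are differentiable, and an integral of p'F,
where p' has smaller degree. This gives an induction on the degree, with f universally quantified so
that it can be replaced by F. -/
lemma hasDerivAt_integral_eval_mul_shift (h : ℝ) (n : ℕ) :
    ∀ (p : ℝ[X]), p.natDegree ≤ n → ∀ (f : ℝ → ℝ), Continuous f → ∀ t : ℝ,
    HasDerivAt (fun t => ∫ θ in (-h)..0, p.eval θ * f (t + θ))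
      (p.eval 0 * f t - p.eval (-h) * f (t - h)
        - ∫ θ in (-h)..0, (derivative p).eval θ * f (t + θ)) t := by
  have parts : ∀ (p : ℝ[X]) (F f : ℝ → ℝ), Continuous f → (∀ t, HasDerivAt F (f t) t) → ∀ t,
      ∫ θ in (-h)..0, p.eval θ * f (t + θ) = p.eval 0 * F t - p.eval (-h) * F (t - h)
        - ∫ θ in (-h)..0, (derivative p).eval θ * F (t + θ) := by
    intro p F f hf hF t
    have := intervalIntegral.integral_mul_deriv_eq_deriv_mul (a := -h) (b := 0)
      (u := fun x => p.eval x) (v := fun x => F (t + x))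
      (u' := fun x => (derivative p).eval x) (v' := fun x => f (t + x))
      (fun x _ => p.hasDerivAt x) (fun x _ => (hF (t + x)).comp_const_add t x)
      ((derivative p).continuous.intervalIntegrable _ _)
      ((hf.comp (continuous_const.add continuous_id)).intervalIntegrable _ _)
    simpa [← sub_eq_add_neg] using this
  have prim : ∀ f : ℝ → ℝ, Continuous f → ∀ t, HasDerivAt (fun t => ∫ s in (0 : ℝ)..t, f s) (f t) t :=
    fun f hf t => intervalIntegral.integral_hasDerivAt_right (hf.intervalIntegrable _ _)
      (hf.stronglyMeasurableAtFilter _ _) hf.continuousAt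
  have shift : ∀ (F f : ℝ → ℝ), (∀ t, HasDerivAt F (f t) t) → ∀ t,
      HasDerivAt (fun t => F (t - h)) (f (t - h)) t := fun F f hF t =>
    (hF (t - h)).comp_sub_const t h
  induction n with
  | zero =>
    intro p hp f hf t
    obtain ⟨c, rfl⟩ : ∃ c, p = C c := ⟨_, eq_C_of_natDegree_le_zero hp⟩
    have e := funext (parts (C c) _ f hf (prim f hf))
    rw [e]
    simpa using! ((prim f hf t).const_mul c).sub ((shift _ _ (prim f hf) t).const_mul c)
  | succ n ih =>
    intro p hp f hf t
    have e := funext (parts p _ f hf (prim f hf))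
    rw [e]
    have hFc : Continuous (fun t => ∫ s in (0 : ℝ)..t, f s) :=
      continuous_iff_continuousAt.2 fun t => (prim f hf t).continuousAt
    have h3 := ih (derivative p) ((natDegree_derivative_le p).trans (by omega)) _ hFc t
    rw [← parts (derivative p) _ f hf (prim f hf) t] at h3
    exact (((prim f hf t).const_mul _).sub ((shift _ _ (prim f hf) t).const_mul _)).sub h3

/-! ### Legendre moments on the delay interval -/

/-- The moment `∫_{-h}^0 L_k(θ) f(t+θ) dθ`. -/
def moment (h : ℝ) (k : ℕ) (f : ℝ → ℝ) (t : ℝ) : ℝ :=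
  ∫ θ in (-h)..0, (legendreDelay h k).eval θ * f (t + θ)

lemma integral_derivative_legendreDelay_mul (h : ℝ) (k : ℕ) {f : ℝ → ℝ} (hf : Continuous f)
    (t : ℝ) : ∫ θ in (-h)..0, (derivative (legendreDelay h k)).eval θ * f (t + θ) =
      -∑ i ∈ Finset.range k, gammaCoeff k i / h * moment h i f t := by
  simp only [moment]
  simp_rw [← intervalIntegral.integral_const_mul]
  rw [← intervalIntegral.integral_finsetSum, ← intervalIntegral.integral_neg]
  · simp [derivative_legendreDelay, eval_finsetSum, Finset.sum_mul, mul_assoc]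
  · intro i _
    exact ((continuous_const.mul ((legendreDelay h i).continuous.mul
      (hf.comp (continuous_const.add continuous_id))))).intervalIntegrable _ _

lemma hasDerivAt_moment {h : ℝ} (hh : h ≠ 0) (k : ℕ) {f : ℝ → ℝ} (hf : Continuous f) (t : ℝ) :
    HasDerivAt (moment h k f) (f t + (-1) ^ (k + 1) * f (t - h)
      + ∑ i ∈ Finset.range k, gammaCoeff k i / h * moment h i f t) t := by
  have := hasDerivAt_integral_eval_mul_shift h _ (legendreDelay h k) le_rfl f hf t
  rw [integral_derivative_legendreDelay_mul h k hf, legendreDelay_eval_zero,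
    legendreDelay_eval_neg hh] at this
  refine this.congr_deriv ?_
  ring

lemma continuous_moment {h : ℝ} (hh : h ≠ 0) (k : ℕ) {f : ℝ → ℝ} (hf : Continuous f) :
    Continuous (moment h k f) :=
  continuous_iff_continuousAt.2 fun t => (hasDerivAt_moment hh k hf t).continuousAt

/-- The right-hand side is also the time derivative found in `hasDerivAt_moment`. So Γ(k)ξ plays two
roles: it is the derivative of a moment of X, which is needed in `matH`, and a moment of X', which
is needed for Bessel's inequality. -/
lemma moment_deriv {h : ℝ} (hh : h ≠ 0) (k : ℕ) {f g : ℝ → ℝ} (H : HasL2Deriv f g) (t : ℝ) :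
    moment h k g t = f t + (-1) ^ (k + 1) * f (t - h)
      + ∑ i ∈ Finset.range k, gammaCoeff k i / h * moment h i f t := by
  have := (H.comp_add_left t).integral_eval_mul (legendreDelay h k) (-h) 0
  rw [integral_derivative_legendreDelay_mul h k H.continuous, legendreDelay_eval_zero,
    legendreDelay_eval_neg hh] at this
  rw [moment, this, ← sub_eq_add_neg, add_zero]
  ring

lemma abs_moment_le {h : ℝ} (hh : 0 < h) (k : ℕ) : ∃ C, 0 ≤ C ∧ ∀ (f : ℝ → ℝ) (t B : ℝ),
    (∀ θ ∈ Set.Icc (-h) 0, |f (t + θ)| ≤ B) → |moment h k f t| ≤ C * B := by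
  obtain ⟨C, hC⟩ := isCompact_Icc.exists_bound_of_continuousOn (s := Set.Icc (-h) 0)
    (legendreDelay h k).continuous.continuousOn
  have hC0 : 0 ≤ C := (norm_nonneg _).trans (hC 0 ⟨by linarith, le_rfl⟩)
  refine ⟨C * h, by positivity, fun f t B hB => ?_⟩
  have := intervalIntegral.norm_integral_le_of_norm_le_const (a := -h) (b := 0) (C := C * B)
    (f := fun θ => (legendreDelay h k).eval θ * f (t + θ)) ?_
  · rw [moment, ← Real.norm_eq_abs]
    refine this.trans (le_of_eq ?_)
    rw [zero_sub, neg_neg, abs_of_pos hh]; ring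
  · intro θ hθ
    rw [Set.uIoc_of_le (by linarith)] at hθ
    have hθ' : θ ∈ Set.Icc (-h) 0 := Set.Ioc_subset_Icc_self hθ
    rw [norm_mul]
    exact mul_le_mul (hC θ hθ') (hB θ hθ') (norm_nonneg _) hC0

/-- Bessel's inequality for the Legendre polynomials of `[-h,0]`. -/
lemma sum_moment_sq_le {h : ℝ} (hh : 0 < h) (m : ℕ) (g : ℝ → ℝ) (t : ℝ)
    (hg : MemLp (fun θ => g (t + θ)) 2 (volume.restrict (Set.uIoc (-h) 0))) :
    ∑ k ∈ Finset.range m, (2 * (k : ℝ) + 1) * moment h k g t ^ 2 ≤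
      h * ∫ θ in (-h)..0, g (t + θ) ^ 2 := by
  have hg1 : IntervalIntegrable (fun θ => g (t + θ)) volume (-h) 0 := by
    rw [intervalIntegrable_iff]; exact hg.integrable (by norm_num)
  have hg2 : IntervalIntegrable (fun θ => g (t + θ) ^ 2) volume (-h) 0 := by
    rw [intervalIntegrable_iff]; exact hg.integrable_sq
  -- The Fourier coefficients: the moment divided by the squared norm h/(2k+1). Thus `q` is the
  -- orthogonal projection of g(t+·), and the claim is that the squared distance to it is
  -- nonnegative.
  set c : ℕ → ℝ := fun k => (2 * (k : ℝ) + 1) / h * moment h k g t with hc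
  set q : ℝ[X] := ∑ k ∈ Finset.range m, C (c k) * legendreDelay h k with hq
  have i1 : IntervalIntegrable (fun θ => q.eval θ * g (t + θ)) volume (-h) 0 :=
    hg1.continuousOn_mul q.continuous.continuousOn
  have i2 : IntervalIntegrable (fun θ => q.eval θ * q.eval θ) volume (-h) 0 :=
    intervalIntegrable_eval_mul_eval ..
  have e1 : ∫ θ in (-h)..0, q.eval θ * g (t + θ) = ∑ k ∈ Finset.range m, c k * moment h k g t := by
    simp only [moment]
    simp_rw [← intervalIntegral.integral_const_mul]
    rw [← intervalIntegral.integral_finsetSum]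
    · simp [hq, eval_finsetSum, Finset.sum_mul, mul_assoc]
    · intro i _
      exact (hg1.continuousOn_mul (legendreDelay h i).continuous.continuousOn).const_mul _
  have e3 : ∀ k ∈ Finset.range m, ∫ θ in (-h)..0, q.eval θ * (legendreDelay h k).eval θ =
      c k * (h / (2 * (k : ℝ) + 1)) := by
    intro k hk
    have : ∀ θ, q.eval θ * (legendreDelay h k).eval θ = ∑ i ∈ Finset.range m,
        c i * ((legendreDelay h i).eval θ * (legendreDelay h k).eval θ) := by
      intro θ; simp [hq, eval_finsetSum, Finset.sum_mul, mul_assoc]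
    simp_rw [this]
    rw [intervalIntegral.integral_finsetSum]
    · simp_rw [intervalIntegral.integral_const_mul, integral_legendreDelay_mul hh]
      rw [Finset.sum_eq_single_of_mem k hk]
      · simp
      · intro i _ hi; simp [hi]
    · intro i _
      exact (intervalIntegrable_eval_mul_eval ..).const_mul _
  have e2 : ∫ θ in (-h)..0, q.eval θ * q.eval θ = ∑ k ∈ Finset.range m, c k * moment h k g t := by
    have : ∀ θ, q.eval θ * q.eval θ = ∑ i ∈ Finset.range m,
        c i * (q.eval θ * (legendreDelay h i).eval θ) := by
      intro θ
      nth_rw 2 [hq]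
      simp [eval_finsetSum, Finset.mul_sum]
      exact Finset.sum_congr rfl fun i _ => by ring
    simp_rw [this]
    rw [intervalIntegral.integral_finsetSum]
    · refine Finset.sum_congr rfl fun k hk => ?_
      rw [intervalIntegral.integral_const_mul, e3 k hk, hc]
      have : (2 * (k : ℝ) + 1) ≠ 0 := by positivity
      field_simp
    · intro i _
      exact (intervalIntegrable_eval_mul_eval ..).const_mul _
  have pos : 0 ≤ ∫ θ in (-h)..0, (g (t + θ) - q.eval θ) ^ 2 :=
    intervalIntegral.integral_nonneg (by linarith) fun θ _ => sq_nonneg _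
  have e4 : ∫ θ in (-h)..0, (g (t + θ) - q.eval θ) ^ 2 =
      (∫ θ in (-h)..0, g (t + θ) ^ 2) - ∑ k ∈ Finset.range m, c k * moment h k g t := by
    have : ∀ θ, (g (t + θ) - q.eval θ) ^ 2 =
        g (t + θ) ^ 2 - 2 * (q.eval θ * g (t + θ)) + q.eval θ * q.eval θ := fun θ => by ring
    simp_rw [this]
    rw [intervalIntegral.integral_add (hg2.sub (i1.const_mul 2)) i2,
      intervalIntegral.integral_sub hg2 (i1.const_mul 2), intervalIntegral.integral_const_mul,
      e1, e2]
    ring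
  rw [e4] at pos
  have e5 : ∑ k ∈ Finset.range m, (2 * (k : ℝ) + 1) * moment h k g t ^ 2 =
      h * ∑ k ∈ Finset.range m, c k * moment h k g t := by
    rw [Finset.mul_sum]
    refine Finset.sum_congr rfl fun k _ => ?_
    rw [hc]; field_simp
  rw [e5]
  exact mul_le_mul_of_nonneg_left (by linarith) hh.le

end Legendre

open Matrix

set_option linter.unusedSectionVars false

/-! ### Bilinear forms of matrices -/

/-- The bilinear form `xᵀ M y`. -/
def bil {m n : Type*} [Fintype m] [Fintype n] (M : Matrix m n ℝ) (x : m → ℝ) (y : n → ℝ) : ℝ :=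
  x ⬝ᵥ M *ᵥ y

section Bil

variable {m n k l : Type*} [Fintype m] [Fintype n] [Fintype k] [Fintype l]

lemma bil_eq_sum (M : Matrix m n ℝ) (x : m → ℝ) (y : n → ℝ) :
    bil M x y = ∑ i, ∑ j, M i j * (x i * y j) := by
  simp only [bil, dotProduct, mulVec, Finset.mul_sum]
  exact Finset.sum_congr rfl fun i _ => Finset.sum_congr rfl fun j _ => by ring

lemma bil_add (M M' : Matrix m n ℝ) (x : m → ℝ) (y : n → ℝ) :
    bil (M + M') x y = bil M x y + bil M' x y := by
  simp [bil, add_mulVec, dotProduct_add]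

lemma bil_sub (M M' : Matrix m n ℝ) (x : m → ℝ) (y : n → ℝ) :
    bil (M - M') x y = bil M x y - bil M' x y := by
  simp [bil, sub_mulVec, dotProduct_sub]

lemma bil_neg (M : Matrix m n ℝ) (x : m → ℝ) (y : n → ℝ) : bil (-M) x y = -bil M x y := by
  simp [bil, neg_mulVec]

lemma bil_smul (c : ℝ) (M : Matrix m n ℝ) (x : m → ℝ) (y : n → ℝ) :
    bil (c • M) x y = c * bil M x y := by
  simp [bil, smul_mulVec]

lemma bil_add_left (M : Matrix m n ℝ) (x x' : m → ℝ) (y : n → ℝ) :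
    bil M (x + x') y = bil M x y + bil M x' y := by
  simp [bil]

lemma bil_add_right (M : Matrix m n ℝ) (x : m → ℝ) (y y' : n → ℝ) :
    bil M x (y + y') = bil M x y + bil M x y' := by
  simp [bil, mulVec_add]

lemma bil_transpose (M : Matrix m n ℝ) (x : m → ℝ) (y : n → ℝ) :
    bil Mᵀ y x = bil M x y := by
  rw [bil, bil, dotProduct_comm, mulVec_transpose, ← dotProduct_mulVec]

lemma bil_comm_of_isSymm {M : Matrix m m ℝ} (hM : M.IsSymm) (x y : m → ℝ) :
    bil M x y = bil M y x := by
  rw [← bil_transpose, hM.eq]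

lemma bil_transpose_mul_mul (A : Matrix k m ℝ) (P : Matrix k l ℝ) (B : Matrix l n ℝ)
    (x : m → ℝ) (y : n → ℝ) : bil (Aᵀ * P * B) x y = bil P (A *ᵥ x) (B *ᵥ y) := by
  rw [bil, bil, Matrix.mul_assoc, ← mulVec_mulVec, dotProduct_mulVec, vecMul_transpose,
    ← mulVec_mulVec]

lemma bil_mul (A : Matrix m k ℝ) (B : Matrix k n ℝ) (x : m → ℝ) (y : n → ℝ) :
    bil (A * B) x y = bil A x (B *ᵥ y) := by
  rw [bil, bil, ← mulVec_mulVec]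

lemma bil_He (M : Matrix m m ℝ) (x : m → ℝ) : bil (He M) x x = 2 * bil M x x := by
  rw [He, bil_add, bil_transpose]; ring

lemma bil_fromBlocks (A : Matrix m m ℝ) (B : Matrix m n ℝ) (C : Matrix n m ℝ) (D : Matrix n n ℝ)
    (x : m → ℝ) (y : n → ℝ) : bil (fromBlocks A B C D) (Sum.elim x y) (Sum.elim x y) =
      bil A x x + bil B x y + bil C y x + bil D y y := by
  rw [bil, fromBlocks_mulVec]
  simp [bil, sumElim_dotProduct_sumElim]
  ring

lemma bil_nonneg {M : Matrix m m ℝ} (hM : M.PosSemidef) (x : m → ℝ) : 0 ≤ bil M x x := by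
  simpa [bil] using! hM.dotProduct_mulVec_nonneg x

lemma NegDef.bil_nonpos {M : Matrix m m ℝ} (hM : NegDef M) (x : m → ℝ) : bil M x x ≤ 0 := by
  have := bil_nonneg (Matrix.PosDef.posSemidef hM) x
  rw [bil_neg] at this
  linarith

lemma isSymm_of_posDef {M : Matrix m m ℝ} (hM : M.PosDef) : M.IsSymm := by
  have := hM.isHermitian
  rwa [IsHermitian, conjTranspose_eq_transpose_of_trivial] at this

/-- From a factorization M = BᵀB. It reduces vector inequalities weighted by M to scalar ones for
the coordinates of Bx. -/
lemma exists_bil_eq_sum_sq {M : Matrix m m ℝ} (hM : M.PosSemidef) :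
    ∃ B : Matrix m m ℝ, ∀ x, bil M x x = ∑ i, (B *ᵥ x) i ^ 2 := by
  classical
  open scoped MatrixOrder in
  obtain ⟨B, rfl⟩ := CStarAlgebra.nonneg_iff_eq_star_mul_self.mp hM.nonneg
  refine ⟨B, fun x => ?_⟩
  rw [bil, ← mulVec_mulVec, dotProduct_mulVec, star_eq_conjTranspose,
    conjTranspose_eq_transpose_of_trivial, vecMul_transpose, dotProduct]
  exact Finset.sum_congr rfl fun i _ => by ring

/-- A positive definite form is bounded below by a multiple of the sum of squares. -/
lemma exists_pos_mul_sum_sq_le {M : Matrix m m ℝ} (hM : M.PosDef) :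
    ∃ c > 0, ∀ x, c * ∑ i, x i ^ 2 ≤ bil M x x := by
  rcases isEmpty_or_nonempty m with hm | hm
  · exact ⟨1, one_pos, fun x => by simp [bil]⟩
  let q : EuclideanSpace ℝ m → ℝ := fun x => bil M x.ofLp x.ofLp
  have hq : Continuous q := by
    simp only [q, bil_eq_sum]
    fun_prop
  have hne : (Metric.sphere (0 : EuclideanSpace ℝ m) 1).Nonempty :=
    NormedSpace.sphere_nonempty.2 zero_le_one
  obtain ⟨x₀, hx₀, hmin⟩ := (isCompact_sphere (0 : EuclideanSpace ℝ m) 1).exists_isMinOn hne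
    hq.continuousOn
  have hx₀' : x₀.ofLp ≠ 0 := by
    intro h0
    have : x₀ = 0 := by ext i; simpa using congrFun h0 i
    simp [this] at hx₀
  have hpos : 0 < q x₀ := by simpa [q, bil] using hM.dotProduct_mulVec_pos hx₀'
  refine ⟨q x₀, hpos, fun x => ?_⟩
  set y : EuclideanSpace ℝ m := WithLp.toLp 2 x with hy
  have hsq : ∑ i, x i ^ 2 = ‖y‖ ^ 2 := by rw [EuclideanSpace.real_norm_sq_eq]
  rw [hsq]
  by_cases hy0 : y = 0
  · have : x = 0 := by
      ext i
      have := congrArg (fun z : EuclideanSpace ℝ m => z i) hy0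
      simpa [hy] using this
    simp [hy0, this, bil]
  have hn : ‖y‖ ≠ 0 := norm_ne_zero_iff.2 hy0
  have h1 := hmin (a := ‖y‖⁻¹ • y) (by simp [norm_smul, hn])
  have h2 : q (‖y‖⁻¹ • y) = (‖y‖⁻¹) ^ 2 * bil M x x := by
    simp only [q, bil, hy, WithLp.ofLp_smul, mulVec_smul, smul_dotProduct, dotProduct_smul,
      smul_eq_mul]
    ring
  rw [Set.mem_ofPred_eq, h2] at h1
  have h3 : (‖y‖⁻¹) ^ 2 * ‖y‖ ^ 2 = 1 := by rw [← mul_pow, inv_mul_cancel₀ hn, one_pow]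
  calc q x₀ * ‖y‖ ^ 2 ≤ (‖y‖⁻¹) ^ 2 * bil M x x * ‖y‖ ^ 2 :=
        mul_le_mul_of_nonneg_right h1 (by positivity)
    _ = bil M x x := by linear_combination bil M x x * h3

lemma exists_bil_le (M : Matrix m m ℝ) : ∃ C, 0 ≤ C ∧ ∀ (x : m → ℝ) (B : ℝ),
    (∀ i, x i ^ 2 ≤ B) → bil M x x ≤ C * B := by
  refine ⟨∑ i, ∑ j, |M i j|, by positivity, fun x B hB => ?_⟩
  rw [bil_eq_sum, Finset.sum_mul]
  refine Finset.sum_le_sum fun i _ => ?_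
  rw [Finset.sum_mul]
  refine Finset.sum_le_sum fun j _ => ?_
  refine (le_abs_self _).trans ?_
  rw [abs_mul]
  refine mul_le_mul_of_nonneg_left ?_ (abs_nonneg _)
  rw [abs_mul]
  have h1 := hB i
  have h2 := hB j
  nlinarith [sq_nonneg (|x i| - |x j|), sq_abs (x i), sq_abs (x j)]

/-- `2 xᵀ Z y + xᵀ Q x` is bounded below by a multiple of the largest `(y i)²`. -/
lemma exists_neg_mul_le_bil_add {Q : Matrix m m ℝ} (hQ : Q.PosDef) (Z : Matrix m m ℝ) :
    ∃ C, 0 ≤ C ∧ ∀ (x y : m → ℝ) (B : ℝ), (∀ i, y i ^ 2 ≤ B) →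
      -(C * B) ≤ bil Q x x + 2 * bil Z x y := by
  classical
  obtain ⟨C, hC0, hC⟩ := exists_bil_le (Zᵀ * Q⁻¹ * Z)
  refine ⟨C, hC0, fun x y B hB => ?_⟩
  have hu : IsUnit Q.det := (isUnit_iff_isUnit_det Q).1 hQ.isUnit
  -- Complete the square: −e minimizes the expression in x, and the minimum is −yᵀZᵀQ⁻¹Zy.
  set e := Q⁻¹ *ᵥ (Z *ᵥ y) with he
  have hQe : Q *ᵥ e = Z *ᵥ y := by rw [he, mulVec_mulVec, mul_nonsing_inv _ hu, one_mulVec]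
  have h1 := bil_nonneg hQ.posSemidef (x + e)
  rw [bil_add_left, bil_add_right, bil_add_right, bil_comm_of_isSymm (isSymm_of_posDef hQ) e x]
    at h1
  have h2 : bil Q x e = bil Z x y := by rw [bil, bil, hQe]
  have h3 : bil Q e e = bil (Zᵀ * Q⁻¹ * Z) y y := by
    rw [bil_transpose_mul_mul, bil, hQe, dotProduct_comm, bil]
  have h4 := hC y B hB
  rw [h2, h3] at h1
  linarith

end Bil

/-! ### Evaluation of the LMI matrices -/

section Eval

variable {ν : Type*} [Fintype ν] [DecidableEq ν]

/-- The vector `(a, b, z, c)` with block heights `n, n, nN, n`. -/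
def xiVec {N : ℕ} (a b : ν → ℝ) (z : ν × Fin N → ℝ) (c : ν → ℝ) : XiIdx ν N → ℝ :=
  Sum.elim a (Sum.elim b (Sum.elim z c))

lemma rowBlocks_mulVec {m : Type*} {N : ℕ} (A B : Matrix m ν ℝ) (C : Matrix m (ν × Fin N) ℝ)
    (D : Matrix m ν ℝ) (a b : ν → ℝ) (z : ν × Fin N → ℝ) (c : ν → ℝ) :
    rowBlocks A B C D *ᵥ xiVec a b z c = A *ᵥ a + B *ᵥ b + C *ᵥ z + D *ᵥ c := by
  simp only [rowBlocks, xiVec, fromCols_mulVec_sumElim, add_assoc]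

lemma N2_mulVec {N : ℕ} (a b : ν → ℝ) (z : ν × Fin N → ℝ) (c : ν → ℝ) :
    N2 ν N *ᵥ xiVec a b z c = c := by
  simp [N2, rowBlocks_mulVec]

lemma N12_mulVec {N : ℕ} (a b : ν → ℝ) (z : ν × Fin N → ℝ) (c : ν → ℝ) :
    N12 ν N *ᵥ xiVec a b z c = a - c := by
  rw [N12, sub_mulVec, N2_mulVec, N1, rowBlocks_mulVec]
  simp

lemma matF_mulVec (Λ Λd K : Matrix ν ν ℝ) {N : ℕ} (a b : ν → ℝ) (z : ν × Fin N → ℝ)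
    (c : ν → ℝ) : matF Λ Λd K N *ᵥ xiVec a b z c = Λ *ᵥ a + Λd *ᵥ b + (Λ * K) *ᵥ c := by
  simp [matF, rowBlocks_mulVec]

lemma matG_mulVec {N : ℕ} (h : ℝ) (a b : ν → ℝ) (z : ν × Fin N → ℝ) (c : ν → ℝ) :
    matG ν N h *ᵥ xiVec a b z c = Sum.elim a (h • z) := by
  rw [matG, fromRows_mulVec, rowBlocks_mulVec, rowBlocks_mulVec]
  simp [smul_mulVec]

lemma Gam_mulVec {N : ℕ} (k : ℕ) (a b : ν → ℝ) (z : ν × Fin N → ℝ) (c : ν → ℝ) (j : ν) :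
    (Gam ν N k *ᵥ xiVec a b z c) j =
      a j + (-1) ^ (k + 1) * b j + ∑ i : Fin N, gammaCoeff k i * z (j, i) := by
  rw [Gam, rowBlocks_mulVec]
  simp only [Pi.add_apply, one_mulVec, smul_mulVec, Pi.smul_apply, smul_eq_mul, zero_mulVec,
    Pi.zero_apply, add_zero]
  congr 1
  simp only [mulVec, dotProduct, of_apply, ite_mul, zero_mul, Fintype.sum_prod_type]
  rw [Finset.sum_eq_single j]
  · simp
  · intro i _ hi; simp [Ne.symm hi]
  · simp

lemma bil_oddDiag (A : Matrix ν ν ℝ) (m : ℕ) (u : ν × Fin m → ℝ) :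
    bil (oddDiag A m) u u =
      ∑ k : Fin m, (2 * (k : ℝ) + 1) * bil A (fun j => u (j, k)) (fun j => u (j, k)) := by
  simp only [bil_eq_sum, oddDiag, blockDiagonal_apply, Fintype.sum_prod_type, Finset.mul_sum,
    ite_mul, zero_mul, Finset.sum_ite_eq, Finset.mem_univ, if_true, Matrix.smul_apply, smul_eq_mul]
  rw [Finset.sum_comm]
  exact Finset.sum_congr rfl fun k _ => Finset.sum_congr rfl fun i _ =>
    Finset.sum_congr rfl fun j _ => by ring

lemma bil_matSigma (S : Matrix ν ν ℝ) (N : ℕ) (α h : ℝ) (a b : ν → ℝ) (z : ν × Fin N → ℝ)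
    (c : ν → ℝ) : bil (matSigma S N α h) (xiVec a b z c) (xiVec a b z c) =
      bil S a a - Real.exp (-2 * α * h) * bil S b b := by
  rw [matSigma, xiVec, bil_fromBlocks, bil_fromBlocks, bil_neg, bil_smul]
  simp [bil]; ring

lemma bil_Pi1 (Λ Λd K : Matrix ν ν ℝ) (N : ℕ) (α h : ℝ)
    (P : Matrix (AugIdx ν N) (AugIdx ν N) ℝ) (S R Q Z : Matrix ν ν ℝ)
    (Y : Matrix (XiIdx ν N) ν ℝ) (a b : ν → ℝ) (z : ν × Fin N → ℝ) (c : ν → ℝ) :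
    bil (Pi1 Λ Λd K N α h P S R Q Z Y) (xiVec a b z c) (xiVec a b z c) =
      2 * bil P (matG ν N h *ᵥ xiVec a b z c) (matH Λ Λd K N *ᵥ xiVec a b z c)
      + 2 * α * bil P (matG ν N h *ᵥ xiVec a b z c) (matG ν N h *ᵥ xiVec a b z c)
      + (bil S a a - Real.exp (-2 * α * h) * bil S b b)
      + h ^ 2 * bil R (matF Λ Λd K N *ᵥ xiVec a b z c) (matF Λ Λd K N *ᵥ xiVec a b z c)
      - Real.exp (-2 * α * h) * ∑ k ∈ Finset.range (N + 1), (2 * (k : ℝ) + 1) *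
          bil R (Gam ν N k *ᵥ xiVec a b z c) (Gam ν N k *ᵥ xiVec a b z c)
      - bil Q (a - c) (a - c) - 2 * bil Z (a - c) c + 2 * bil Y (xiVec a b z c) (a - c) := by
  rw [Pi1, bil_add, bil_sub, bil_sub, bil_sub, bil_add, bil_add, bil_add, bil_He, bil_He, bil_He,
    bil_smul, bil_smul, bil_matSigma, bil_transpose_mul_mul, bil_transpose_mul_mul,
    bil_transpose_mul_mul, bil_transpose_mul_mul, bil_transpose_mul_mul, bil_transpose_mul_mul,
    bil_mul, matRN, bil_smul, bil_oddDiag, N12_mulVec, N2_mulVec,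
    ← Fin.sum_univ_eq_sum_range (fun k => (2 * (k : ℝ) + 1) *
      bil R (Gam ν N k *ᵥ xiVec a b z c) (Gam ν N k *ᵥ xiVec a b z c)) (N + 1)]
  rfl

lemma bil_Pi2 (Λ Λd K : Matrix ν ν ℝ) (N : ℕ) (Q U Z : Matrix ν ν ℝ) (a b : ν → ℝ)
    (z : ν × Fin N → ℝ) (c : ν → ℝ) :
    bil (Pi2 Λ Λd K N Q U Z) (xiVec a b z c) (xiVec a b z c) =
      bil U (matF Λ Λd K N *ᵥ xiVec a b z c) (matF Λ Λd K N *ᵥ xiVec a b z c)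
      + 2 * bil Q (matF Λ Λd K N *ᵥ xiVec a b z c) (a - c)
      + 2 * bil Z (matF Λ Λd K N *ᵥ xiVec a b z c) c := by
  rw [Pi2, bil_add, bil_add, bil_He, bil_He, bil_transpose_mul_mul, bil_transpose_mul_mul,
    bil_transpose_mul_mul, N12_mulVec, N2_mulVec]

end Eval

/-! ### Trajectories and the Lyapunov functional -/

section Trajectory

variable {ν : Type*} [Fintype ν] [DecidableEq ν]

/-- `X` is absolutely continuous with locally square integrable derivative `v`, and solves the
sampled-data system on the intervals `(t_k, t_{k+1})`. -/
structure IsTrajectory (Λ Λd K : Matrix ν ν ℝ) (h : ℝ) (t : ℕ → ℝ) (X v : ℝ → ν → ℝ) : Prop where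
  hasL2Deriv : ∀ j, HasL2Deriv (fun s => X s j) (fun s => v s j)
  flow : ∀ k, ∀ s ∈ Set.Ioo (t k) (t (k + 1)),
    v s = Λ *ᵥ X s + Λd *ᵥ X (s - h) + (Λ * K) *ᵥ X (t k)

/-- The vector of Legendre moments of order `k`. -/
def momentVec (h : ℝ) (k : ℕ) (X : ℝ → ν → ℝ) (t : ℝ) : ν → ℝ :=
  fun j => moment h k (fun s => X s j) t

lemma intervalIntegrable_fun_sum {ι : Type*} (s : Finset ι) {f : ι → ℝ → ℝ} {a b : ℝ}
    (hf : ∀ i ∈ s, IntervalIntegrable (f i) volume a b) :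
    IntervalIntegrable (fun x => ∑ i ∈ s, f i x) volume a b := by
  have := IntervalIntegrable.sum s hf
  rwa [Finset.sum_fn] at this

lemma intervalIntegrable_bil {X v : ℝ → ν → ℝ}
    (H : ∀ j, HasL2Deriv (fun s => X s j) (fun s => v s j)) (M : Matrix ν ν ℝ) (a b : ℝ) :
    IntervalIntegrable (fun s => bil M (v s) (v s)) volume a b := by
  simp only [bil_eq_sum]
  refine intervalIntegrable_fun_sum _ fun i _ => intervalIntegrable_fun_sum _ fun j _ => ?_
  exact ((H i).intervalIntegrable_mul (H j) a b).const_mul _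

/-- Bessel's inequality for a positive semidefinite form. -/
lemma sum_bil_momentVec_le {h : ℝ} (hh : 0 < h) (m : ℕ) {M : Matrix ν ν ℝ} (hM : M.PosSemidef)
    (g : ℝ → ν → ℝ) (t : ℝ)
    (hg : ∀ j, MemLp (fun θ => g (t + θ) j) 2 (volume.restrict (Set.uIoc (-h) 0))) :
    ∑ k ∈ Finset.range m, (2 * (k : ℝ) + 1) * bil M (momentVec h k g t) (momentVec h k g t) ≤
      h * ∫ θ in (-h)..0, bil M (g (t + θ)) (g (t + θ)) := by
  obtain ⟨B, hB⟩ := exists_bil_eq_sum_sq hM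
  have hg1 : ∀ j, IntervalIntegrable (fun θ => g (t + θ) j) volume (-h) 0 := fun j => by
    rw [intervalIntegrable_iff]; exact (hg j).integrable (by norm_num)
  have hBg : ∀ i, MemLp (fun θ => (B *ᵥ g (t + θ)) i) 2 (volume.restrict (Set.uIoc (-h) 0)) := by
    intro i
    simp only [mulVec, dotProduct]
    exact memLp_finsetSum _ fun j _ => (hg j).const_mul (B i j)
  have hmom : ∀ i k, (B *ᵥ momentVec h k g t) i = moment h k (fun s => (B *ᵥ g s) i) t := by
    intro i k
    simp only [mulVec, dotProduct, momentVec, moment, Finset.mul_sum]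
    simp_rw [← intervalIntegral.integral_const_mul]
    rw [← intervalIntegral.integral_finsetSum]
    · congr 1; ext θ
      exact Finset.sum_congr rfl fun j _ => by ring
    · intro j _
      exact ((hg1 j).continuousOn_mul (legendreDelay h k).continuous.continuousOn).const_mul _
  simp only [hB, hmom]
  rw [intervalIntegral.integral_finsetSum, Finset.mul_sum]
  · simp_rw [Finset.mul_sum]
    rw [Finset.sum_comm]
    exact Finset.sum_le_sum fun i _ => sum_moment_sq_le hh m (fun s => (B *ᵥ g s) i) t (hBg i)
  · intro i _
    rw [intervalIntegrable_iff]; exact (hBg i).integrable_sq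

lemma integral_comp_shift (f : ℝ → ℝ) (h t : ℝ) :
    ∫ θ in (-h)..0, f (t + θ) = ∫ s in (t - h)..t, f s := by
  rw [intervalIntegral.integral_comp_add_left, add_zero, sub_eq_add_neg]

/-- `e^{2αs}` times a nonnegative function, integrated over a delay interval. -/
lemma exp_mul_integral_le {α h : ℝ} (hα : 0 < α) (hh : 0 < h) {f : ℝ → ℝ} (t : ℝ)
    (hf : ∀ s, 0 ≤ f s) (hi : ∀ a b, IntervalIntegrable f volume a b) :
    Real.exp (2 * α * (t - h)) * ∫ θ in (-h)..0, f (t + θ) ≤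
      ∫ s in (t - h)..t, Real.exp (2 * α * s) * f s := by
  rw [integral_comp_shift, ← intervalIntegral.integral_const_mul]
  refine intervalIntegral.integral_mono_on (by linarith) ((hi _ _).const_mul _)
    ((hi _ _).continuousOn_mul (by fun_prop)) fun s hs => ?_
  refine mul_le_mul_of_nonneg_right (Real.exp_le_exp.2 ?_) (hf s)
  nlinarith [hs.1]

/-- The augmented state `(X(t), ∫ L₀ X, …, ∫ L_{N-1} X)`. -/
def augState (h : ℝ) (N : ℕ) (X : ℝ → ν → ℝ) (t : ℝ) : AugIdx ν N → ℝ :=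
  Sum.elim (X t) fun p => momentVec h p.2 X t p.1

/-- The vector `(X(t), X(t-h), h⁻¹ ∫ L_i X, c)`. -/
def xiState (h : ℝ) (N : ℕ) (X : ℝ → ν → ℝ) (c : ν → ℝ) (t : ℝ) : XiIdx ν N → ℝ :=
  xiVec (X t) (X (t - h)) (fun p => momentVec h p.2 X t p.1 / h) c

lemma matG_mulVec_xiState {h : ℝ} (hh : h ≠ 0) (N : ℕ) (X : ℝ → ν → ℝ) (c : ν → ℝ) (t : ℝ) :
    matG ν N h *ᵥ xiState h N X c t = augState h N X t := by
  rw [xiState, matG_mulVec, augState]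
  congr 1; ext p; simp; field_simp

/-- The third block of ξ holds moments divided by h, which accounts for the quotients γ/h. The N
columns reduce to those with i < k because γ_k^i vanishes for i ≥ k, including i = k by parity. -/
lemma Gam_mulVec_xiState (h : ℝ) {N k : ℕ} (hk : k ≤ N) (X : ℝ → ν → ℝ) (c : ν → ℝ)
    (t : ℝ) (j : ν) : (Gam ν N k *ᵥ xiState h N X c t) j =
      X t j + (-1) ^ (k + 1) * X (t - h) j
        + ∑ i ∈ Finset.range k, gammaCoeff k i / h * moment h i (fun s => X s j) t := by
  rw [xiState, Gam_mulVec]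
  congr 1
  rw [Fin.sum_univ_eq_sum_range (fun i => gammaCoeff k i * (momentVec h i X t j / h)) N,
    ← Finset.sum_subset (Finset.range_mono hk)]
  · exact Finset.sum_congr rfl fun i _ => by simp only [momentVec]; ring
  · intro i _ hi
    have hi' : k ≤ i := by simpa using hi
    rcases hi'.eq_or_lt with rfl | hlt
    · rw [gammaCoeff_self, zero_mul]
    · simp [gammaCoeff, hlt.not_ge]

lemma Gam_mulVec_eq_momentVec {h : ℝ} (hh : h ≠ 0) {N k : ℕ} (hk : k ≤ N) {X v : ℝ → ν → ℝ}
    (H : ∀ j, HasL2Deriv (fun s => X s j) (fun s => v s j)) (c : ν → ℝ) (t : ℝ) :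
    Gam ν N k *ᵥ xiState h N X c t = momentVec h k v t := by
  ext j
  rw [Gam_mulVec_xiState h hk, momentVec, moment_deriv hh k (H j)]

lemma matH_mulVec_xiState (Λ Λd K : Matrix ν ν ℝ) (h : ℝ) (N : ℕ) (X : ℝ → ν → ℝ) (c : ν → ℝ)
    (t : ℝ) : matH Λ Λd K N *ᵥ xiState h N X c t =
      Sum.elim (matF Λ Λd K N *ᵥ xiState h N X c t)
        fun p => (Gam ν N p.2 *ᵥ xiState h N X c t) p.1 := by
  rw [matH, fromRows_mulVec]; rfl

lemma hasDerivAt_augState {h : ℝ} (hh : h ≠ 0) {N : ℕ} {X : ℝ → ν → ℝ} {f : ν → ℝ} {t : ℝ}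
    (hc : Continuous X) (c : ν → ℝ) (hX : ∀ j, HasDerivAt (fun s => X s j) (f j) t)
    (p : AugIdx ν N) :
    HasDerivAt (fun s => augState h N X s p)
      (Sum.elim f (fun p => (Gam ν N p.2 *ᵥ xiState h N X c t) p.1) p) t := by
  rcases p with j | ⟨j, k⟩
  · exact hX j
  · simp only [Sum.elim_inr]
    rw [Gam_mulVec_xiState h k.2.le]
    exact hasDerivAt_moment hh k ((continuous_apply j).comp hc) t

lemma hasDerivAt_bil {m n : Type*} [Fintype m] [Fintype n] (M : Matrix m n ℝ) {x : ℝ → m → ℝ}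
    {y : ℝ → n → ℝ} {x' : m → ℝ} {y' : n → ℝ} {t : ℝ}
    (hx : ∀ i, HasDerivAt (fun s => x s i) (x' i) t)
    (hy : ∀ i, HasDerivAt (fun s => y s i) (y' i) t) :
    HasDerivAt (fun s => bil M (x s) (y s)) (bil M x' (y t) + bil M (x t) y') t := by
  simp only [bil_eq_sum, ← Finset.sum_add_distrib]
  refine HasDerivAt.fun_sum fun i _ => HasDerivAt.fun_sum fun j _ => ?_
  exact (((hx i).mul (hy j)).const_mul (M i j)).congr_deriv (by ring)

lemma continuous_bil {T m n : Type*} [TopologicalSpace T] [Fintype m] [Fintype n]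
    (M : Matrix m n ℝ) {x : T → m → ℝ} {y : T → n → ℝ} (hx : Continuous x) (hy : Continuous y) :
    Continuous fun s => bil M (x s) (y s) := by
  simp only [bil_eq_sum]
  fun_prop

/-- The primitive of `e^{2αs} v(s)ᵀ R v(s)` that vanishes at `0`. -/
def energy (α : ℝ) (R : Matrix ν ν ℝ) (v : ℝ → ν → ℝ) (t : ℝ) : ℝ :=
  ∫ s in (0 : ℝ)..t, Real.exp (2 * α * s) * bil R (v s) (v s)

/-- The Lyapunov functional, multiplied by `e^{2αt}`. -/
def lyap (N : ℕ) (α h : ℝ) (P : Matrix (AugIdx ν N) (AugIdx ν N) ℝ) (S R : Matrix ν ν ℝ)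
    (X v : ℝ → ν → ℝ) (t : ℝ) : ℝ :=
  Real.exp (2 * α * t) * bil P (augState h N X t) (augState h N X t)
    + (∫ s in (t - h)..t, Real.exp (2 * α * s) * bil S (X s) (X s))
    + h * (h * energy α R v t - ∫ s in (t - h)..t, energy α R v s)

lemma hasDerivAt_integral_delay {f : ℝ → ℝ} (hf : Continuous f) (h t : ℝ) :
    HasDerivAt (fun t => ∫ s in (t - h)..t, f s) (f t - f (t - h)) t := by
  have prim : ∀ t, HasDerivAt (fun t => ∫ s in (0 : ℝ)..t, f s) (f t) t :=
    fun t => intervalIntegral.integral_hasDerivAt_right (hf.intervalIntegrable _ _)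
      (hf.stronglyMeasurableAtFilter _ _) hf.continuousAt
  have e : (fun t => ∫ s in (t - h)..t, f s) =
      fun t => (∫ s in (0 : ℝ)..t, f s) - ∫ s in (0 : ℝ)..(t - h), f s := by
    ext t
    rw [intervalIntegral.integral_interval_sub_left] <;> exact hf.intervalIntegrable _ _
  rw [e]
  exact (prim t).sub ((prim (t - h)).comp_sub_const t h)

end Trajectory

/-! ### Bounds, continuity and dissipation of the Lyapunov functional -/

section Lyapunov

variable {ν : Type*} [Fintype ν] [DecidableEq ν]

lemma continuous_of_hasL2Deriv {X v : ℝ → ν → ℝ}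
    (H : ∀ j, HasL2Deriv (fun s => X s j) (fun s => v s j)) : Continuous X :=
  continuous_pi fun j => (H j).continuous

lemma intervalIntegrable_exp_mul_bil {X v : ℝ → ν → ℝ}
    (H : ∀ j, HasL2Deriv (fun s => X s j) (fun s => v s j)) (α : ℝ) (M : Matrix ν ν ℝ) (a b : ℝ) :
    IntervalIntegrable (fun s => Real.exp (2 * α * s) * bil M (v s) (v s)) volume a b :=
  (intervalIntegrable_bil H M a b).continuousOn_mul (by fun_prop)

lemma continuous_energy {X v : ℝ → ν → ℝ}
    (H : ∀ j, HasL2Deriv (fun s => X s j) (fun s => v s j)) (α : ℝ) (M : Matrix ν ν ℝ) :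
    Continuous (energy α M v) :=
  intervalIntegral.continuous_primitive (intervalIntegrable_exp_mul_bil H α M) 0

lemma energy_sub {X v : ℝ → ν → ℝ}
    (H : ∀ j, HasL2Deriv (fun s => X s j) (fun s => v s j)) (α : ℝ) (M : Matrix ν ν ℝ) (a b : ℝ) :
    energy α M v b - energy α M v a = ∫ s in a..b, Real.exp (2 * α * s) * bil M (v s) (v s) :=
  intervalIntegral.integral_interval_sub_left (intervalIntegrable_exp_mul_bil H α M _ _)
    (intervalIntegrable_exp_mul_bil H α M _ _)

lemma monotone_energy {X v : ℝ → ν → ℝ}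
    (H : ∀ j, HasL2Deriv (fun s => X s j) (fun s => v s j)) (α : ℝ) {M : Matrix ν ν ℝ}
    (hM : M.PosSemidef) : Monotone (energy α M v) := by
  intro a b hab
  rw [← sub_nonneg, energy_sub H]
  exact intervalIntegral.integral_nonneg hab fun s _ =>
    mul_nonneg (Real.exp_pos _).le (bil_nonneg hM _)

/-- A nondecreasing function has mean at most its final value. This makes the R-term of `lyap`
nonnegative. -/
lemma integral_delay_energy_le {X v : ℝ → ν → ℝ}
    (H : ∀ j, HasL2Deriv (fun s => X s j) (fun s => v s j)) {α h : ℝ} (hh : 0 < h)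
    {M : Matrix ν ν ℝ} (hM : M.PosSemidef) (t : ℝ) :
    ∫ s in (t - h)..t, energy α M v s ≤ h * energy α M v t := by
  have := intervalIntegral.integral_mono_on (a := t - h) (b := t) (by linarith)
    ((continuous_energy H α M).intervalIntegrable _ _)
    (intervalIntegrable_const (μ := volume) (c := energy α M v t))
    (fun s hs => monotone_energy H α hM hs.2)
  simpa using this

lemma le_integral_delay_energy {X v : ℝ → ν → ℝ}
    (H : ∀ j, HasL2Deriv (fun s => X s j) (fun s => v s j)) {α h : ℝ} (hh : 0 < h)
    {M : Matrix ν ν ℝ} (hM : M.PosSemidef) (t : ℝ) :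
    h * energy α M v (t - h) ≤ ∫ s in (t - h)..t, energy α M v s := by
  have := intervalIntegral.integral_mono_on (a := t - h) (b := t) (by linarith)
    (intervalIntegrable_const (μ := volume) (c := energy α M v (t - h)))
    ((continuous_energy H α M).intervalIntegrable _ _)
    (fun s hs => monotone_energy H α hM hs.1)
  simpa using this

lemma memLp_of_continuous {f : ℝ → ℝ} (hf : Continuous f) (a b : ℝ) :
    MemLp f 2 (volume.restrict (Set.uIoc a b)) := by
  obtain ⟨C, hC⟩ := isCompact_uIcc.exists_bound_of_continuousOn (s := Set.uIcc a b)
    hf.continuousOn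
  refine MemLp.of_bound hf.aestronglyMeasurable C ?_
  rw [ae_restrict_iff' measurableSet_uIoc]
  exact Eventually.of_forall fun s hs => hC s (Set.uIoc_subset_uIcc hs)

/-- Positivity of the Lyapunov functional. -/
lemma exists_mul_sum_sq_le_lyap {N : ℕ} {α h : ℝ} (hα : 0 < α) (hh : 0 < h)
    {P : Matrix (AugIdx ν N) (AugIdx ν N) ℝ} {S R : Matrix ν ν ℝ} (hS : S.PosSemidef)
    (hR : R.PosSemidef)
    (hP : (P + (Real.exp (-2 * α * h) / h) • Matrix.fromBlocks 0 0 0 (oddDiag S N)).PosDef) :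
    ∃ c > 0, ∀ (X v : ℝ → ν → ℝ), (∀ j, HasL2Deriv (fun s => X s j) (fun s => v s j)) → ∀ t,
      c * Real.exp (2 * α * t) * ∑ j, X t j ^ 2 ≤ lyap N α h P S R X v t := by
  obtain ⟨c, hc, hcP⟩ := exists_pos_mul_sum_sq_le hP
  refine ⟨c, hc, fun X v H t => ?_⟩
  have hX := continuous_of_hasL2Deriv H
  have h1 := hcP (augState h N X t)
  rw [bil_add, bil_smul] at h1
  have e1 : bil (Matrix.fromBlocks 0 0 0 (oddDiag S N)) (augState h N X t) (augState h N X t) =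
      _ := bil_fromBlocks 0 0 0 (oddDiag S N) (X t) fun p => momentVec h p.2 X t p.1
  rw [e1, bil_oddDiag,
    Fin.sum_univ_eq_sum_range (fun k => (2 * (k : ℝ) + 1) *
      bil S (momentVec h k X t) (momentVec h k X t)) N] at h1
  -- Bessel's inequality bounds the S-integral from below by the moment block of the positivity LMI,
  -- so P need not be positive by itself.
  have h2 := sum_bil_momentVec_le hh N hS X t fun j =>
    memLp_of_continuous (((continuous_apply j).comp hX).comp
      (continuous_const.add continuous_id)) _ _
  have h3 := exp_mul_integral_le hα hh t (fun s => bil_nonneg hS (X s))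
    fun a b => (continuous_bil S hX hX).intervalIntegrable a b
  have h4 := integral_delay_energy_le H (α := α) hh hR t
  have h5 : ∑ j, X t j ^ 2 ≤ ∑ p, augState h N X t p ^ 2 := by
    rw [Fintype.sum_sum_type]
    exact le_add_of_nonneg_right (Finset.sum_nonneg fun p _ => sq_nonneg _)
  have hexp : Real.exp (2 * α * (t - h)) = Real.exp (2 * α * t) * Real.exp (-2 * α * h) := by
    rw [← Real.exp_add]; ring_nf
  have h6 : Real.exp (-2 * α * h) / h * ∑ k ∈ Finset.range N, (2 * (k : ℝ) + 1) *
      bil S (momentVec h k X t) (momentVec h k X t) ≤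
      Real.exp (-2 * α * h) * ∫ θ in (-h)..0, bil S (X (t + θ)) (X (t + θ)) := by
    rw [div_mul_eq_mul_div, mul_div_assoc]
    refine mul_le_mul_of_nonneg_left ?_ (Real.exp_pos _).le
    rw [div_le_iff₀ hh, mul_comm _ h]; exact h2
  have z : ∀ (m n : Type _) [Fintype m] [Fintype n] (x : m → ℝ) (y : n → ℝ),
      bil (0 : Matrix m n ℝ) x y = 0 := by intro m n _ _ x y; simp [bil]
  rw [z, z, z] at h1
  have hE := Real.exp_pos (2 * α * t)
  have h7 : c * ∑ j, X t j ^ 2 ≤ bil P (augState h N X t) (augState h N X t) +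
      Real.exp (-2 * α * h) * ∫ θ in (-h)..0, bil S (X (t + θ)) (X (t + θ)) := by
    have := mul_le_mul_of_nonneg_left h5 hc.le
    linarith
  have h8 := mul_le_mul_of_nonneg_left h7 hE.le
  rw [hexp] at h3
  have h9 : 0 ≤ h * (h * energy α R v t - ∫ s in (t - h)..t, energy α R v s) :=
    mul_nonneg hh.le (by linarith)
  rw [lyap]
  linarith

/-- The Lyapunov functional at `0` in terms of the initial data. -/
lemma exists_lyap_zero_le (N : ℕ) {α h : ℝ} (hα : 0 < α) (hh : 0 < h)
    (P : Matrix (AugIdx ν N) (AugIdx ν N) ℝ) (S : Matrix ν ν ℝ) {R : Matrix ν ν ℝ}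
    (hS : S.PosSemidef) (hR : R.PosSemidef) :
    ∃ C, 0 ≤ C ∧ ∀ (X v : ℝ → ν → ℝ), (∀ j, HasL2Deriv (fun s => X s j) (fun s => v s j)) →
      ∀ B, (∀ θ ∈ Set.Icc (-h) 0, ∀ j, X θ j ^ 2 ≤ B) →
        (∀ j, ∫ θ in (-h)..0, v θ j ^ 2 ≤ B) → 0 ≤ B → lyap N α h P S R X v 0 ≤ C * B := by
  choose Cm hCm0 hCm using fun k => abs_moment_le hh k
  obtain ⟨C1, hC10, hC1⟩ := exists_bil_le P
  obtain ⟨C2, hC20, hC2⟩ := exists_bil_le S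
  obtain ⟨C3, hC30, hC3⟩ := exists_bil_le R
  -- A common factor for all squared coordinates of the augmented state at 0: 1 covers X(0), and the
  -- sum covers the moments.
  set K : ℝ := 1 + ∑ k ∈ Finset.range N, Cm k ^ 2 with hK
  have hK1 : 1 ≤ K := le_add_of_nonneg_right (Finset.sum_nonneg fun _ _ => sq_nonneg _)
  refine ⟨C1 * K + h * C2 + h * (h * (C3 * Fintype.card ν)), by positivity,
    fun X v H B hX hv hB => ?_⟩
  have hXc := continuous_of_hasL2Deriv H
  have hexp1 : ∀ s ∈ Set.Icc (-h) (0 : ℝ), Real.exp (2 * α * s) ≤ 1 := fun s hs =>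
    Real.exp_le_one_iff.2 (by nlinarith [hs.2])
  have t1 : bil P (augState h N X 0) (augState h N X 0) ≤ C1 * (K * B) := by
    refine hC1 _ _ ?_
    rintro (j | ⟨j, k⟩)
    · have := hX 0 ⟨by linarith, le_rfl⟩ j
      simp only [augState, Sum.elim_inl]
      nlinarith
    · simp only [augState, Sum.elim_inr, momentVec]
      have := hCm k (fun s => X s j) 0 (Real.sqrt B) fun θ hθ => by
        rw [zero_add]; exact Real.abs_le_sqrt (hX θ hθ j)
      have h2 : moment h k (fun s => X s j) 0 ^ 2 ≤ (Cm k * Real.sqrt B) ^ 2 := by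
        rw [← sq_abs]; exact pow_le_pow_left₀ (abs_nonneg _) this 2
      rw [mul_pow, Real.sq_sqrt hB] at h2
      have h3 : Cm k ^ 2 ≤ K := by
        have := Finset.single_le_sum (f := fun k => Cm k ^ 2) (fun _ _ => sq_nonneg _)
          (Finset.mem_range.2 k.2)
        linarith
      exact h2.trans (mul_le_mul_of_nonneg_right h3 hB)
  have t2 : ∫ s in ((0 : ℝ) - h)..0, Real.exp (2 * α * s) * bil S (X s) (X s) ≤ h * (C2 * B) := by
    have := intervalIntegral.integral_mono_on (a := 0 - h) (b := 0)
      (f := fun s => Real.exp (2 * α * s) * bil S (X s) (X s)) (g := fun _ => C2 * B)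
      (by linarith)
      (((by fun_prop : Continuous fun s : ℝ => Real.exp (2 * α * s)).mul
        (continuous_bil S hXc hXc)).intervalIntegrable _ _) (intervalIntegrable_const (μ := volume)) ?_
    · simpa [mul_left_comm] using this
    · intro s hs
      rw [zero_sub] at hs
      have h1 := hC2 (X s) B (hX s hs)
      have h2 := mul_le_mul_of_nonneg_right (hexp1 s hs) (bil_nonneg hS (X s))
      linarith
  -- The energy is normalized to vanish at 0, so it is nonpositive on [−h,0]; the negative of its
  -- value at −h is the energy spent by the initial function.
  have t3 : -energy α R v (0 - h) ≤ C3 * (Fintype.card ν * B) := by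
    have e0 : energy α R v 0 = 0 := by simp [energy]
    have e1 := energy_sub H α R (0 - h) 0
    rw [e0, zero_sub] at e1
    rw [e1]
    have hsq : ∀ j, IntervalIntegrable (fun s => v s j ^ 2) volume (0 - h) 0 := fun j => by
      simpa [sq] using (H j).intervalIntegrable_mul (H j) (0 - h) 0
    have := intervalIntegral.integral_mono_on (a := 0 - h) (b := 0)
      (f := fun s => Real.exp (2 * α * s) * bil R (v s) (v s))
      (g := fun s => C3 * ∑ j, v s j ^ 2) (by linarith)
      (intervalIntegrable_exp_mul_bil H α R _ _)
      ((intervalIntegrable_fun_sum _ fun j _ => hsq j).const_mul _) ?_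
    · refine this.trans ?_
      rw [intervalIntegral.integral_const_mul,
        intervalIntegral.integral_finsetSum fun j _ => hsq j]
      refine mul_le_mul_of_nonneg_left ?_ hC30
      rw [zero_sub]
      refine (Finset.sum_le_sum fun j _ => hv j).trans ?_
      simp
    · intro s hs
      rw [zero_sub] at hs
      have h1 := hC3 (v s) (∑ j, v s j ^ 2) fun j =>
        Finset.single_le_sum (f := fun j => v s j ^ 2) (fun _ _ => sq_nonneg _) (Finset.mem_univ j)
      have h2 := mul_le_mul_of_nonneg_right (hexp1 s hs) (bil_nonneg hR (v s))
      linarith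
  have t4 := le_integral_delay_energy H (α := α) hh hR 0
  have e0 : energy α R v 0 = 0 := by simp [energy]
  rw [lyap, e0]
  simp only [mul_zero, Real.exp_zero, one_mul]
  have t5 : h * (0 - ∫ s in ((0 : ℝ) - h)..0, energy α R v s) ≤
      h * (h * (C3 * (Fintype.card ν * B))) := by
    refine mul_le_mul_of_nonneg_left ?_ hh.le
    have := mul_le_mul_of_nonneg_left t3 hh.le
    linarith
  nlinarith

lemma continuous_augState {h : ℝ} (hh : h ≠ 0) {N : ℕ} {X : ℝ → ν → ℝ} (hX : Continuous X) :
    Continuous (augState h N X) := by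
  refine continuous_pi fun p => ?_
  rcases p with j | ⟨j, k⟩
  · exact (continuous_apply j).comp hX
  · exact continuous_moment hh k ((continuous_apply j).comp hX)

lemma continuous_integral_delay {f : ℝ → ℝ} (hf : Continuous f) (h : ℝ) :
    Continuous fun t => ∫ s in (t - h)..t, f s :=
  continuous_iff_continuousAt.2 fun t => (hasDerivAt_integral_delay hf h t).continuousAt

lemma continuous_exp_mul_bil (α : ℝ) (S : Matrix ν ν ℝ) {X : ℝ → ν → ℝ} (hX : Continuous X) :
    Continuous fun s => Real.exp (2 * α * s) * bil S (X s) (X s) :=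
  (by fun_prop : Continuous fun s : ℝ => Real.exp (2 * α * s)).mul (continuous_bil S hX hX)

lemma continuous_lyap {N : ℕ} {α h : ℝ} (hh : h ≠ 0) (P : Matrix (AugIdx ν N) (AugIdx ν N) ℝ)
    (S R : Matrix ν ν ℝ) {X v : ℝ → ν → ℝ}
    (H : ∀ j, HasL2Deriv (fun s => X s j) (fun s => v s j)) :
    Continuous (lyap N α h P S R X v) := by
  have hX := continuous_of_hasL2Deriv H
  have ha := continuous_augState (N := N) hh hX
  have he := continuous_energy H α R
  exact (((by fun_prop : Continuous fun s : ℝ => Real.exp (2 * α * s)).mul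
    (continuous_bil P ha ha)).add
      (continuous_integral_delay (continuous_exp_mul_bil α S hX) h)).add
    (continuous_const.mul ((continuous_const.mul he).sub (continuous_integral_delay he h)))

namespace IsTrajectory

variable {Λ Λd K : Matrix ν ν ℝ} {h : ℝ} {t : ℕ → ℝ} {X v : ℝ → ν → ℝ}

lemma continuous (H : IsTrajectory Λ Λd K h t X v) : Continuous X :=
  continuous_of_hasL2Deriv H.hasL2Deriv

lemma continuousOn_deriv (H : IsTrajectory Λ Λd K h t X v) (k : ℕ) :
    ContinuousOn v (Set.Ioo (t k) (t (k + 1))) := by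
  have hX := H.continuous
  refine ContinuousOn.congr (Continuous.continuousOn ?_) (H.flow k)
  exact ((continuous_const.matrix_mulVec hX).add (continuous_const.matrix_mulVec
    (hX.comp (continuous_id.sub continuous_const)))).add continuous_const

lemma hasDerivAt_primitive {f : ℝ → ℝ} (a : ℝ) {b c s : ℝ}
    (hi : ∀ a b, IntervalIntegrable f volume a b)
    (hf : ContinuousOn f (Set.Ioo b c)) (hs : s ∈ Set.Ioo b c) :
    HasDerivAt (fun t => ∫ r in a..t, f r) (f s) s :=
  intervalIntegral.integral_hasDerivAt_right (hi _ _)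
    (hf.stronglyMeasurableAtFilter isOpen_Ioo s hs) (hf.continuousAt (isOpen_Ioo.mem_nhds hs))

lemma hasDerivAt (H : IsTrajectory Λ Λd K h t X v) {k : ℕ} {s : ℝ}
    (hs : s ∈ Set.Ioo (t k) (t (k + 1))) (j : ν) : HasDerivAt (fun s => X s j) (v s j) s := by
  have e : (fun s => X s j) = fun s => X 0 j + ∫ r in (0 : ℝ)..s, v r j :=
    funext fun s => (H.hasL2Deriv j).eq_add_integral 0 s
  rw [e]
  simpa using (hasDerivAt_primitive 0 (H.hasL2Deriv j).intervalIntegrable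
    ((continuous_apply j).comp_continuousOn (H.continuousOn_deriv k)) hs).const_add (X 0 j)

lemma continuousOn_bil (H : IsTrajectory Λ Λd K h t X v) (M : Matrix ν ν ℝ) (k : ℕ) :
    ContinuousOn (fun s => bil M (v s) (v s)) (Set.Ioo (t k) (t (k + 1))) := by
  have := H.continuousOn_deriv k
  simp only [bil_eq_sum]
  fun_prop

/-- Decay of the Lyapunov functional along trajectories. -/
lemma exists_hasDerivAt_lyap (H : IsTrajectory Λ Λd K h t X v) (hh : 0 < h) {α : ℝ} (hα : 0 < α)
    {N : ℕ} {P : Matrix (AugIdx ν N) (AugIdx ν N) ℝ} (hP : P.IsSymm) (S : Matrix ν ν ℝ)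
    {R : Matrix ν ν ℝ} (hR : R.PosSemidef) {k : ℕ} {s : ℝ}
    (hs : s ∈ Set.Ioo (t k) (t (k + 1))) (Q Z : Matrix ν ν ℝ) (Y : Matrix (XiIdx ν N) ν ℝ) :
    ∃ D, HasDerivAt (lyap N α h P S R X v) D s ∧
      D ≤ Real.exp (2 * α * s) *
        (bil (Pi1 Λ Λd K N α h P S R Q Z Y) (xiState h N X (X (t k)) s)
            (xiState h N X (X (t k)) s)
          + bil Q (X s - X (t k)) (X s - X (t k)) + 2 * bil Z (X s - X (t k)) (X (t k))
          - 2 * bil Y (xiState h N X (X (t k)) s) (X s - X (t k))) := by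
  set ξ := xiState h N X (X (t k)) s with hξ
  have hX := H.continuous
  have hF : matF Λ Λd K N *ᵥ ξ = v s := by rw [hξ, xiState, matF_mulVec, H.flow k s hs]
  have hG := matG_mulVec_xiState hh.ne' N X (X (t k)) s
  have hH := matH_mulVec_xiState Λ Λd K h N X (X (t k)) s
  rw [← hξ] at hG hH
  have daug := hasDerivAt_augState (N := N) hh.ne' hX (X (t k)) (H.hasDerivAt hs)
  have dbil := hasDerivAt_bil P daug daug
  have dexp : HasDerivAt (fun s : ℝ => Real.exp (2 * α * s)) (Real.exp (2 * α * s) * (2 * α)) s := by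
    simpa using ((hasDerivAt_id s).const_mul (2 * α)).exp
  have dS := hasDerivAt_integral_delay (continuous_exp_mul_bil α S hX) h s
  have den : HasDerivAt (energy α R v) (Real.exp (2 * α * s) * bil R (v s) (v s)) s :=
    hasDerivAt_primitive 0 (intervalIntegrable_exp_mul_bil H.hasL2Deriv α R)
      (ContinuousOn.mul (by fun_prop) (H.continuousOn_bil R k)) hs
  have dE := hasDerivAt_integral_delay (continuous_energy H.hasL2Deriv α R) h s
  refine ⟨_, ((dexp.mul dbil).add dS).add (((den.const_mul h).sub dE).const_mul h), ?_⟩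
  -- Differentiating the R-term leaves −h times the weighted energy over the delay interval. The
  -- weight is bounded below by its value at s−h, and Bessel's inequality for X' then produces
  -- −Γ_NᵀR_NΓ_N, since Γ(k)ξ is the k-th moment of X'.
  have hB := sum_bil_momentVec_le hh (N + 1) hR v s fun j =>
    ((H.hasL2Deriv j).comp_add_left s).memLp _ _
  have hB2 := exp_mul_integral_le hα hh s (fun s => bil_nonneg hR (v s))
    (intervalIntegrable_bil H.hasL2Deriv R)
  have hexp : Real.exp (2 * α * (s - h)) = Real.exp (2 * α * s) * Real.exp (-2 * α * h) := by
    rw [← Real.exp_add]; ring_nf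
  have hsum : ∑ k' ∈ Finset.range (N + 1), (2 * (k' : ℝ) + 1) *
      bil R (Gam ν N k' *ᵥ ξ) (Gam ν N k' *ᵥ ξ) = ∑ k' ∈ Finset.range (N + 1),
        (2 * (k' : ℝ) + 1) * bil R (momentVec h k' v s) (momentVec h k' v s) :=
    Finset.sum_congr rfl fun k' hk' => by
      rw [hξ, Gam_mulVec_eq_momentVec hh.ne' (by have := Finset.mem_range.1 hk'; omega)
        H.hasL2Deriv]
  have hPi := bil_Pi1 Λ Λd K N α h P S R Q Z Y (X s) (X (s - h))
    (fun p => momentVec h p.2 X s p.1 / h) (X (t k))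
  change bil _ ξ ξ = _ at hPi
  change bil _ ξ ξ = 2 * bil P (matG ν N h *ᵥ ξ) (matH Λ Λd K N *ᵥ ξ) +
    2 * α * bil P (matG ν N h *ᵥ ξ) (matG ν N h *ᵥ ξ) + _ + h ^ 2 * bil R (matF Λ Λd K N *ᵥ ξ)
    (matF Λ Λd K N *ᵥ ξ) - _ * ∑ k' ∈ Finset.range (N + 1), (2 * (k' : ℝ) + 1) *
      bil R (Gam ν N k' *ᵥ ξ) (Gam ν N k' *ᵥ ξ) - _ - _ + 2 * bil Y ξ _ at hPi
  rw [hsum, hG, hH, hF] at hPi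
  rw [energy_sub H.hasL2Deriv, hexp, hPi, ← hξ,
    bil_comm_of_isSymm hP (Sum.elim (v s) fun p => (Gam ν N p.2 *ᵥ ξ) p.1) (augState h N X s)]
  rw [hexp] at hB2
  have hE := Real.exp_pos (2 * α * s)
  have hE' := Real.exp_pos (-2 * α * h)
  have h1 := mul_le_mul_of_nonneg_left hB (mul_pos hE hE').le
  have h2 := mul_le_mul_of_nonneg_left hB2 hh.le
  linarith [h1, h2]

end IsTrajectory

end Lyapunov

/-! ### Scalar weights -/

/-- An affine function of `z` that is nonpositive at both ends of an interval is so inside. -/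
lemma affine_nonpos {a b z₀ z₁ z : ℝ} (h0 : a + b * z₀ ≤ 0) (h1 : a + b * z₁ ≤ 0)
    (hz : z ∈ Set.Icc z₀ z₁) : a + b * z ≤ 0 := by
  rcases le_total 0 b with hb | hb
  · nlinarith [hz.2]
  · nlinarith [hz.1]

/-- The LMIs at the vertices imply the inequality at every `τ ∈ [0,T]`, `T ∈ [T₀,T₁]`. -/
lemma weighted_sum_nonpos {α : ℝ} (hα : 0 < α) {T₀ T₁ T τ p q x u : ℝ}
    (hT : T ∈ Set.Icc T₀ T₁) (hτ : τ ∈ Set.Icc 0 T)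
    (A0 : h1 α 0 * p + h2 α 0 T₀ * q + h4 α 0 T₁ * x ≤ 0)
    (A1 : h1 α 0 * p + h2 α 0 T₁ * q + h4 α 0 T₁ * x ≤ 0)
    (B0 : h1 α T₀ * p + h4 α T₀ T₁ * x + h3 α T₀ T₁ * u ≤ 0)
    (B1 : h1 α T₁ * p + h4 α T₁ T₁ * x + h3 α T₁ T₁ * u ≤ 0) :
    h1 α τ * p + h2 α τ T * q + h4 α τ T₁ * x + h3 α τ T₁ * u ≤ 0 := by
  have hexp : ∀ a b : ℝ, a ≤ b → Real.exp (2 * α * a) ≤ Real.exp (2 * α * b) := fun a b hab =>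
    Real.exp_le_exp.2 (by nlinarith)
  have hz : Real.exp (2 * α * T) ∈ Set.Icc (Real.exp (2 * α * T₀)) (Real.exp (2 * α * T₁)) :=
    ⟨hexp _ _ hT.1, hexp _ _ hT.2⟩
  have hw : Real.exp (2 * α * τ) ∈ Set.Icc (Real.exp (2 * α * 0)) (Real.exp (2 * α * T)) :=
    ⟨hexp _ _ hτ.1, hexp _ _ hτ.2⟩
  -- At τ = 0 the weight `h3` vanishes, and the rest is affine in e^{2αT}. At τ = T, treated in `B`,
  -- it is `h2` that vanishes, and affinity holds because `h3` and `h4` have their second argument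
  -- frozen at T₁.
  have A : h1 α 0 * p + h2 α 0 T * q + h4 α 0 T₁ * x ≤ 0 := by
    have := affine_nonpos (z₀ := Real.exp (2 * α * T₀)) (z₁ := Real.exp (2 * α * T₁))
      (z := Real.exp (2 * α * T)) (a := h1 α 0 * p + h4 α 0 T₁ * x - q / (2 * α) * h1 α 0)
      (b := q / (2 * α)) ?_ ?_ hz
    · refine le_trans (le_of_eq ?_) this
      simp only [h1, h2]; ring
    · refine le_trans (le_of_eq ?_) A0
      simp only [h1, h2]; ring
    · refine le_trans (le_of_eq ?_) A1
      simp only [h1, h2]; ring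
  have B : h1 α T * p + h4 α T T₁ * x + h3 α T T₁ * u ≤ 0 := by
    have := affine_nonpos (z₀ := Real.exp (2 * α * T₀)) (z₁ := Real.exp (2 * α * T₁))
      (z := Real.exp (2 * α * T))
      (a := 2 * Real.exp (2 * α * T₁) * x - Real.exp (2 * α * T₁) / (2 * α) * u)
      (b := p + ((Real.exp (α * T₁) - 4) * Real.exp (α * T₁) + 1) * x
        + Real.exp (2 * α * T₁) / (2 * α) * u) ?_ ?_ hz
    · refine le_trans (le_of_eq ?_) this
      simp only [h1, h3, h4]; ring
    · refine le_trans (le_of_eq ?_) B0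
      simp only [h1, h3, h4]; ring
    · refine le_trans (le_of_eq ?_) B1
      simp only [h1, h3, h4]; ring
  -- With T fixed, all four weights are affine in e^{2ατ}, so the two ends τ = 0 and τ = T suffice.
  have := affine_nonpos (z₀ := Real.exp (2 * α * 0)) (z₁ := Real.exp (2 * α * T))
    (z := Real.exp (2 * α * τ))
    (a := Real.exp (2 * α * T) / (2 * α) * q + 2 * Real.exp (2 * α * T₁) * x
      - Real.exp (2 * α * T₁) / (2 * α) * u)
    (b := p - q / (2 * α) + ((Real.exp (α * T₁) - 4) * Real.exp (α * T₁) + 1) * x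
      + Real.exp (2 * α * T₁) / (2 * α) * u) ?_ ?_ hw
  · refine le_trans (le_of_eq ?_) this
    simp only [h1, h2, h3, h4]; ring
  · refine le_trans (le_of_eq ?_) A
    simp only [h1, h2, h4, mul_zero, Real.exp_zero]; ring
  · refine le_trans (le_of_eq ?_) B
    simp only [h1, h3, h4]; ring

/-- The primitive of `h4 α · T₁` that vanishes at `0`. -/
def h4Prim (α T₁ τ : ℝ) : ℝ :=
  ((Real.exp (α * T₁) - 4) * Real.exp (α * T₁) + 1) * ((Real.exp (2 * α * τ) - 1) / (2 * α))
    + 2 * Real.exp (2 * α * T₁) * τ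

lemma hasDerivAt_exp_two_mul (α τ : ℝ) :
    HasDerivAt (fun s : ℝ => Real.exp (2 * α * s)) (Real.exp (2 * α * τ) * (2 * α)) τ := by
  simpa using ((hasDerivAt_id τ).const_mul (2 * α)).exp

lemma hasDerivAt_h4Prim {α : ℝ} (hα : 0 < α) (T₁ τ : ℝ) :
    HasDerivAt (h4Prim α T₁) (h4 α τ T₁) τ := by
  have h := ((((hasDerivAt_exp_two_mul α τ).sub_const 1).div_const (2 * α)).const_mul
    ((Real.exp (α * T₁) - 4) * Real.exp (α * T₁) + 1)).add
    ((hasDerivAt_id τ).const_mul (2 * Real.exp (2 * α * T₁)))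
  refine h.congr_deriv ?_
  rw [h4]; field_simp

lemma hasDerivAt_h2 {α : ℝ} (hα : 0 < α) (T τ : ℝ) :
    HasDerivAt (fun τ => h2 α τ T) (-h1 α τ) τ := by
  have h := ((hasDerivAt_const τ (Real.exp (2 * α * T))).sub
    (hasDerivAt_exp_two_mul α τ)).div_const (2 * α)
  refine h.congr_deriv ?_
  rw [h1]; field_simp; ring

/-- The function vanishes at 1 and has derivative 2(b−1)²(b²+1)/b³. With b = e^{αT₁} it is, up to
the positive factor b²/(2α), the value of `h4Prim` at τ = T₁. -/
lemma log_weight_nonneg {b : ℝ} (hb : 1 ≤ b) :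
    0 ≤ b ^ 2 - 4 * b + 4 / b - 1 / b ^ 2 + 4 * Real.log b := by
  have hm : MonotoneOn (fun b : ℝ => b ^ 2 - 4 * b + 4 * b⁻¹ - (b ^ 2)⁻¹ + 4 * Real.log b)
      (Set.Ici 1) := by
    have hd : ∀ x : ℝ, 0 < x → HasDerivAt
        (fun b : ℝ => b ^ 2 - 4 * b + 4 * b⁻¹ - (b ^ 2)⁻¹ + 4 * Real.log b)
        (2 * (x - 1) ^ 2 * (x ^ 2 + 1) / x ^ 3) x := by
      intro x hx
      have h := (((((hasDerivAt_id x).pow 2).sub ((hasDerivAt_id x).const_mul 4)).add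
        ((hasDerivAt_inv hx.ne').const_mul 4)).sub
          (((hasDerivAt_id x).pow 2).inv (by simpa using hx.ne'))).add
            ((Real.hasDerivAt_log hx.ne').const_mul 4)
      refine h.congr_deriv ?_
      simp
      field_simp
      ring
    refine monotoneOn_of_deriv_nonneg (convex_Ici 1) (fun x hx => ?_) (fun x hx => ?_)
      fun x hx => ?_
    · exact (hd x (lt_of_lt_of_le one_pos hx)).continuousAt.continuousWithinAt
    · rw [interior_Ici] at hx
      exact (hd x (one_pos.trans hx)).differentiableAt.differentiableWithinAt
    · rw [interior_Ici] at hx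
      have hx0 : 0 < x := one_pos.trans hx
      rw [(hd x hx0).deriv]
      positivity
  have := hm (Set.mem_Ici.2 le_rfl) (Set.mem_Ici.2 hb) hb
  simp only [Real.log_one] at this
  norm_num at this
  simpa [div_eq_mul_inv] using this

/-- In the variable u = e^{2ατ} the function is affine plus a positive multiple of log u, hence
concave. It vanishes at u = 1 and is nonnegative at u = e^{2αT₁}, so it lies above a nonnegative
chord. -/
lemma h4Prim_nonneg {α : ℝ} (hα : 0 < α) {T₁ τ : ℝ} (hτ : τ ∈ Set.Icc 0 T₁) :
    0 ≤ h4Prim α T₁ τ := by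
  rcases hτ.1.eq_or_lt with h0 | h0
  · subst h0; simp [h4Prim]
  set b := Real.exp (α * T₁) with hb
  set u := Real.exp (2 * α * τ) with hu
  have hb0 : 0 < b := Real.exp_pos _
  have hbT : 0 < T₁ := h0.trans_le hτ.2
  have hb1 : 1 < b := Real.one_lt_exp_iff.2 (by positivity)
  have hu1 : 1 < u := Real.one_lt_exp_iff.2 (by positivity)
  have hbb : Real.exp (2 * α * T₁) = b ^ 2 := by
    rw [hb, ← Real.exp_nat_mul]; ring_nf
  have hub : u ≤ b ^ 2 := by
    rw [← hbb]; exact Real.exp_le_exp.2 (by nlinarith [hτ.2])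
  have hτu : τ = Real.log u / (2 * α) := by rw [hu, Real.log_exp]; field_simp
  have key : 0 ≤ ((b - 4) * b + 1) * (u - 1) + 2 * b ^ 2 * Real.log u := by
    have hend := log_weight_nonneg hb1.le
    have h2 : 0 ≤ ((b - 4) * b + 1) * (b ^ 2 - 1) + 2 * b ^ 2 * Real.log (b ^ 2) := by
      have := mul_nonneg hend (sq_nonneg b)
      rw [Real.log_pow]
      push_cast
      have e : (b ^ 2 - 4 * b + 4 / b - 1 / b ^ 2 + 4 * Real.log b) * b ^ 2 =
        ((b - 4) * b + 1) * (b ^ 2 - 1) + 2 * b ^ 2 * (2 * Real.log b) := by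
        field_simp; ring
      linarith
    have hcb : 0 < b ^ 2 - 1 := by nlinarith
    set l := (u - 1) / (b ^ 2 - 1) with hl
    have hl0 : 0 ≤ l := div_nonneg (by linarith) hcb.le
    have hl1 : l ≤ 1 := (div_le_one hcb).2 (by linarith)
    have hul : u = (1 - l) * 1 + l * b ^ 2 := by rw [hl]; field_simp; ring
    have hconc := strictConcaveOn_log_Ioi.concaveOn.2 (Set.mem_Ioi.2 one_pos)
      (Set.mem_Ioi.2 (pow_pos hb0 2)) (by linarith : 0 ≤ 1 - l) hl0 (by ring)
    simp only [smul_eq_mul, Real.log_one, mul_zero, zero_add] at hconc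
    rw [← hul] at hconc
    have e1 : u - 1 = l * (b ^ 2 - 1) := by rw [hl]; field_simp
    rw [e1]
    have h3 := mul_nonneg hl0 h2
    have h4 := mul_le_mul_of_nonneg_left hconc (by positivity : 0 ≤ 2 * b ^ 2)
    nlinarith
  rw [h4Prim, ← hb, ← hu, hbb]
  have : ((b - 4) * b + 1) * ((u - 1) / (2 * α)) + 2 * b ^ 2 * τ =
      (((b - 4) * b + 1) * (u - 1) + 2 * b ^ 2 * Real.log u) / (2 * α) := by
    rw [hτu]; field_simp
  rw [this]
  exact div_nonneg key (by positivity)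

lemma h2_nonneg {α : ℝ} (hα : 0 < α) {τ T : ℝ} (h : τ ≤ T) : 0 ≤ h2 α τ T :=
  div_nonneg (sub_nonneg.2 (Real.exp_le_exp.2 (by nlinarith))) (by positivity)

lemma h2_le {α : ℝ} (hα : 0 < α) (τ : ℝ) {T TM : ℝ} (h : T ≤ TM) :
    h2 α τ T ≤ Real.exp (2 * α * TM) / (2 * α) := by
  refine div_le_div_of_nonneg_right ?_ (by positivity)
  have := Real.exp_pos (2 * α * τ)
  have : Real.exp (2 * α * T) ≤ Real.exp (2 * α * TM) := Real.exp_le_exp.2 (by nlinarith)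
  linarith

/-- Completing the square in the U-integral costs the elapsed time τ. The inequality 1 + x ≤ eˣ
replaces it by an expression affine in e^{2ατ}, as the vertex argument requires. -/
lemma mul_h1_le_h3 {α : ℝ} (hα : 0 < α) {τ T : ℝ} (hτ : τ ∈ Set.Icc 0 T) :
    h1 α τ * τ ≤ h3 α τ T := by
  have h1' : h1 α τ ≤ Real.exp (2 * α * T) := Real.exp_le_exp.2 (by nlinarith [hτ.2])
  have h2' : τ ≤ (Real.exp (2 * α * τ) - 1) / (2 * α) := by
    rw [le_div_iff₀ (by positivity)]
    have := Real.add_one_le_exp (2 * α * τ)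
    linarith
  exact mul_le_mul h1' h2' hτ.1 (Real.exp_pos _).le

/-- If no cell contained T, then 𝒯 i ≤ T would propagate from each node to the next, and the last
cell would contain T after all. -/
lemma exists_subinterval {M : ℕ} (𝒯 : Fin (M + 1) → ℝ) (hM : 1 ≤ M) {T : ℝ}
    (h0 : 𝒯 0 ≤ T) (h1 : T ≤ 𝒯 (Fin.last M)) :
    ∃ i : Fin M, T ∈ Set.Icc (𝒯 i.castSucc) (𝒯 i.succ) := by
  by_contra hcon
  push Not at hcon
  have key : ∀ i : Fin (M + 1), 𝒯 i ≤ T := by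
    intro i
    induction i using Fin.induction with
    | zero => exact h0
    | succ i ih =>
      by_contra hlt
      exact hcon i ⟨ih, (not_le.1 hlt).le⟩
  obtain ⟨m, rfl⟩ : ∃ m, M = m + 1 := ⟨M - 1, by omega⟩
  refine hcon (Fin.last m) ⟨key _, ?_⟩
  simpa using h1

/-! ### The looped functional and exponential decay of trajectories -/

section Decay

variable {ν : Type*} [Fintype ν] [DecidableEq ν]

/-- The looped functional on the sampling interval starting at `a`, of length `T`. -/
def looped (α T T₁ a : ℝ) (Q Z U Xm : Matrix ν ν ℝ) (X v : ℝ → ν → ℝ) (s : ℝ) : ℝ :=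
  h2 α (s - a) T * (bil Q (X s - X a) (X s - X a) + 2 * bil Z (X s - X a) (X a)
      + ∫ r in a..s, bil U (v r) (v r))
    + h4Prim α T₁ (s - a) * bil Xm (X a) (X a)

/-- The integral of `vᵀ U v` is bounded below through a free vector `η`. -/
lemma neg_integral_bil_le {X v : ℝ → ν → ℝ}
    (H : ∀ j, HasL2Deriv (fun s => X s j) (fun s => v s j)) {U : Matrix ν ν ℝ} (hU : U.PosDef)
    (η : ν → ℝ) {a s : ℝ} (has : a ≤ s) :
    -∫ r in a..s, bil U (v r) (v r) ≤ 2 * bil U (X s - X a) η + (s - a) * bil U η η := by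
  -- Expand the square with a constant vector η; the cross term integrates to the increment of X.
  have pos : 0 ≤ ∫ r in a..s, bil U (v r + η) (v r + η) :=
    intervalIntegral.integral_nonneg has fun r _ => bil_nonneg hU.posSemidef _
  have e : ∀ r, bil U (v r + η) (v r + η) =
      bil U (v r) (v r) + 2 * ∑ j, v r j * (U *ᵥ η) j + bil U η η := by
    intro r
    rw [bil_add_left, bil_add_right, bil_add_right,
      bil_comm_of_isSymm (isSymm_of_posDef hU) η (v r)]
    have : bil U (v r) η = ∑ j, v r j * (U *ᵥ η) j := rfl
    rw [this]; ring
  have i1 := intervalIntegrable_bil H U a s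
  have i2 : ∀ j, IntervalIntegrable (fun r => v r j * (U *ᵥ η) j) volume a s := fun j =>
    ((H j).intervalIntegrable a s).mul_const _
  have i3 := intervalIntegrable_fun_sum Finset.univ fun j _ => i2 j
  simp_rw [e] at pos
  rw [intervalIntegral.integral_add (i1.add (i3.const_mul 2)) intervalIntegrable_const,
    intervalIntegral.integral_add i1 (i3.const_mul 2), intervalIntegral.integral_const_mul,
    intervalIntegral.integral_finsetSum fun j _ => i2 j] at pos
  simp_rw [intervalIntegral.integral_mul_const, ← (H _).ftc] at pos
  rw [intervalIntegral.integral_const, smul_eq_mul] at pos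
  have : bil U (X s - X a) η = ∑ j, (X s j - X a j) * (U *ᵥ η) j := rfl
  rw [this]
  linarith

variable {Λ Λd K : Matrix ν ν ℝ} {h : ℝ} {t : ℕ → ℝ} {X v : ℝ → ν → ℝ}

lemma IsTrajectory.hasDerivAt_looped (H : IsTrajectory Λ Λd K h t X v) {α : ℝ} (hα : 0 < α)
    (T T₁ : ℝ) {Q : Matrix ν ν ℝ} (hQ : Q.PosDef) (Z U Xm : Matrix ν ν ℝ) {k : ℕ} {s : ℝ}
    (hs : s ∈ Set.Ioo (t k) (t (k + 1))) :
    HasDerivAt (looped α T T₁ (t k) Q Z U Xm X v)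
      (-h1 α (s - t k) * (bil Q (X s - X (t k)) (X s - X (t k))
          + 2 * bil Z (X s - X (t k)) (X (t k)) + ∫ r in (t k)..s, bil U (v r) (v r))
        + h2 α (s - t k) T * (2 * bil Q (v s) (X s - X (t k)) + 2 * bil Z (v s) (X (t k))
          + bil U (v s) (v s))
        + h4 α (s - t k) T₁ * bil Xm (X (t k)) (X (t k))) s := by
  have dd : ∀ j, HasDerivAt (fun r => (X r - X (t k)) j) (v s j) s := fun j => by
    simpa using (H.hasDerivAt hs j).sub_const (X (t k) j)
  have dQ := hasDerivAt_bil Q dd dd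
  have dZ := hasDerivAt_bil Z (y := fun _ => X (t k)) (y' := 0) dd
    fun j => hasDerivAt_const s (X (t k) j)
  have dU := IsTrajectory.hasDerivAt_primitive (t k) (intervalIntegrable_bil H.hasL2Deriv U)
    (H.continuousOn_bil U k) hs
  have d2 := (hasDerivAt_h2 hα T (s - t k)).comp_sub_const s (t k)
  have d4 := (hasDerivAt_h4Prim hα T₁ (s - t k)).comp_sub_const s (t k)
  have := (d2.mul ((dQ.add (dZ.const_mul 2)).add dU)).add
    (d4.mul_const (bil Xm (X (t k)) (X (t k))))
  refine this.congr_deriv ?_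
  rw [bil_comm_of_isSymm (isSymm_of_posDef hQ) (X s - X (t k)) (v s)]
  have z : bil Z (X s - X (t k)) 0 = 0 := by simp [bil]
  simp only [Pi.add_apply]
  rw [z]
  ring

lemma continuous_looped (H : IsTrajectory Λ Λd K h t X v) {α : ℝ} (hα : 0 < α)
    (T T₁ a : ℝ) (Q Z U Xm : Matrix ν ν ℝ) : Continuous (looped α T T₁ a Q Z U Xm X v) := by
  have hX := H.continuous
  have hd : Continuous fun s => X s - X a := hX.sub continuous_const
  have c2 : Continuous fun τ => h2 α τ T :=
    continuous_iff_continuousAt.2 fun τ => (hasDerivAt_h2 hα T τ).continuousAt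
  have c4 : Continuous (h4Prim α T₁) :=
    continuous_iff_continuousAt.2 fun τ => (hasDerivAt_h4Prim hα T₁ τ).continuousAt
  have hs : Continuous fun s : ℝ => s - a := continuous_id.sub continuous_const
  exact ((c2.comp hs).mul (((continuous_bil Q hd hd).add
    (continuous_const.mul (continuous_bil Z hd continuous_const))).add
      (intervalIntegral.continuous_primitive (intervalIntegrable_bil H.hasL2Deriv U) a))).add
    ((c4.comp hs).mul continuous_const)

/-- At the start the increment, the integral and `h4Prim` are all zero. At the other end `h2`
vanishes instead, leaving only the X_i-term. -/
lemma looped_self (α T T₁ a : ℝ) (Q Z U Xm : Matrix ν ν ℝ) (X v : ℝ → ν → ℝ) :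
    looped α T T₁ a Q Z U Xm X v a = 0 := by
  simp [looped, bil, h4Prim]

/-- With η = U⁻¹Yᵀξ the block form becomes the Schur complement A + c·YU⁻¹Yᵀ evaluated at ξ. The
same η serves both vertices, since it does not depend on c. -/
lemma bil_schur_block {N : ℕ} (A : Matrix (XiIdx ν N) (XiIdx ν N) ℝ)
    (Y : Matrix (XiIdx ν N) ν ℝ) (U : Matrix ν ν ℝ) (c : ℝ) (ξ : XiIdx ν N → ℝ) (η : ν → ℝ)
    (hη : U *ᵥ η = Yᵀ *ᵥ ξ) :
    bil (fromBlocks A (c • Y) (c • Y)ᵀ (-(c • U))) (Sum.elim ξ η) (Sum.elim ξ η) =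
      bil A ξ ξ + c * bil U η η := by
  have h1 : bil Y ξ η = bil U η η := by
    rw [← bil_transpose, bil, ← hη, bil]
  rw [bil_fromBlocks, bil_transpose, bil_smul, bil_neg, bil_smul, h1]
  ring

/-- The Lyapunov functional plus the looped functional decreases on a sampling interval. -/
lemma IsTrajectory.lyap_add_looped_le (H : IsTrajectory Λ Λd K h t X v) (hh : 0 < h)
    {α : ℝ} (hα : 0 < α) {N : ℕ} {P : Matrix (AugIdx ν N) (AugIdx ν N) ℝ} (hP : P.IsSymm)
    (S : Matrix ν ν ℝ) {R : Matrix ν ν ℝ} (hR : R.PosSemidef) {Q Z U Xm : Matrix ν ν ℝ}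
    (hQ : Q.PosDef) (hU : U.PosDef) (Y : Matrix (XiIdx ν N) ν ℝ) {T₀ T₁ : ℝ} {k : ℕ}
    (hT : t (k + 1) - t k ∈ Set.Icc T₀ T₁)
    (A0 : NegDef (h1 α 0 • Pi1 Λ Λd K N α h P S R Q Z Y + h2 α 0 T₀ • Pi2 Λ Λd K N Q U Z
      + h4 α 0 T₁ • ((N2 ν N)ᵀ * Xm * N2 ν N)))
    (A1 : NegDef (h1 α 0 • Pi1 Λ Λd K N α h P S R Q Z Y + h2 α 0 T₁ • Pi2 Λ Λd K N Q U Z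
      + h4 α 0 T₁ • ((N2 ν N)ᵀ * Xm * N2 ν N)))
    (B0 : NegDef (Matrix.fromBlocks
      (h1 α T₀ • Pi1 Λ Λd K N α h P S R Q Z Y + h4 α T₀ T₁ • ((N2 ν N)ᵀ * Xm * N2 ν N))
      (h3 α T₀ T₁ • Y) (h3 α T₀ T₁ • Y)ᵀ (-(h3 α T₀ T₁ • U))))
    (B1 : NegDef (Matrix.fromBlocks
      (h1 α T₁ • Pi1 Λ Λd K N α h P S R Q Z Y + h4 α T₁ T₁ • ((N2 ν N)ᵀ * Xm * N2 ν N))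
      (h3 α T₁ T₁ • Y) (h3 α T₁ T₁ • Y)ᵀ (-(h3 α T₁ T₁ • U))))
    {s : ℝ} (hs : s ∈ Set.Icc (t k) (t (k + 1))) :
    lyap N α h P S R X v s + Real.exp (2 * α * t k) *
      looped α (t (k + 1) - t k) T₁ (t k) Q Z U Xm X v s ≤ lyap N α h P S R X v (t k) := by
  set T := t (k + 1) - t k with hTdef
  have hderiv : ∀ s ∈ Set.Ioo (t k) (t (k + 1)), ∃ D, HasDerivAt
      (fun s => lyap N α h P S R X v s + Real.exp (2 * α * t k) *
        looped α T T₁ (t k) Q Z U Xm X v s) D s ∧ D ≤ 0 := by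
    intro s hs
    obtain ⟨D, hD, hDle⟩ := H.exists_hasDerivAt_lyap hh hα hP S hR hs Q Z Y
    have hL := H.hasDerivAt_looped hα T T₁ hQ Z U Xm hs
    refine ⟨_, hD.add (hL.const_mul (Real.exp (2 * α * t k))), ?_⟩
    set ξ := xiState h N X (X (t k)) s with hξ
    have hF : matF Λ Λd K N *ᵥ ξ = v s := by rw [hξ, xiState, matF_mulVec, H.flow k s hs]
    have hu : IsUnit U.det := (isUnit_iff_isUnit_det U).1 hU.isUnit
    -- This vector links the free matrix Y to the U-integral: it is used both in the block LMIs and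
    -- in completing the square, where ηᵀU(X(s)−X(t_k)) becomes ξᵀY(X(s)−X(t_k)).
    set η := U⁻¹ *ᵥ (Yᵀ *ᵥ ξ) with hηdef
    have hη : U *ᵥ η = Yᵀ *ᵥ ξ := by
      rw [hηdef, mulVec_mulVec, mul_nonsing_inv _ hu, one_mulVec]
    have hτ : s - t k ∈ Set.Icc 0 T := ⟨by linarith [hs.1], by linarith [hs.2]⟩
    have hτ1 : s - t k ∈ Set.Icc 0 T₁ := ⟨hτ.1, hτ.2.trans hT.2⟩
    have hN2 : N2 ν N *ᵥ ξ = X (t k) := by rw [hξ, xiState, N2_mulVec]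
    have hP2 : bil (Pi2 Λ Λd K N Q U Z) ξ ξ = bil U (v s) (v s)
        + 2 * bil Q (v s) (X s - X (t k)) + 2 * bil Z (v s) (X (t k)) := by
      rw [← hF, hξ, xiState, bil_Pi2]
    have A0' := A0.bil_nonpos ξ
    have A1' := A1.bil_nonpos ξ
    have B0' := B0.bil_nonpos (Sum.elim ξ η)
    have B1' := B1.bil_nonpos (Sum.elim ξ η)
    rw [bil_schur_block _ _ _ _ _ _ hη, bil_add, bil_smul, bil_smul, bil_transpose_mul_mul,
      hN2] at B0' B1'
    rw [bil_add, bil_add, bil_smul, bil_smul, bil_smul, bil_transpose_mul_mul, hN2] at A0' A1'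
    have hW := weighted_sum_nonpos hα hT hτ A0' A1' B0' B1'
    have hI := neg_integral_bil_le H.hasL2Deriv hU η hs.1.le
    have hYd : bil U (X s - X (t k)) η = bil Y ξ (X s - X (t k)) := by
      rw [bil, hη, ← bil_transpose Y, bil]
    rw [hYd] at hI
    have h13 := mul_le_mul_of_nonneg_right (mul_h1_le_h3 hα hτ1) (bil_nonneg hU.posSemidef η)
    have hexp : Real.exp (2 * α * s) = Real.exp (2 * α * t k) * h1 α (s - t k) := by
      rw [h1, ← Real.exp_add]; ring_nf
    have h1pos : 0 < h1 α (s - t k) := Real.exp_pos _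
    have hI' := mul_le_mul_of_nonneg_left hI h1pos.le
    rw [hexp] at hDle
    rw [hP2] at hW
    -- The Q- and Z-terms weighted by `h1` cancel between the two derivatives. The estimate of the
    -- U-integral supplies 2ξᵀY(X(s)−X(t_k)), cancelling the Y-term, and a multiple of ηᵀUη that is
    -- enlarged to `h3`. What remains is `hW`.
    have hfin : h1 α (s - t k) * (bil (Pi1 Λ Λd K N α h P S R Q Z Y) ξ ξ
          + bil Q (X s - X (t k)) (X s - X (t k)) + 2 * bil Z (X s - X (t k)) (X (t k))
          - 2 * bil Y ξ (X s - X (t k)))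
        + (-h1 α (s - t k) * (bil Q (X s - X (t k)) (X s - X (t k))
          + 2 * bil Z (X s - X (t k)) (X (t k)) + ∫ r in (t k)..s, bil U (v r) (v r))
        + h2 α (s - t k) T * (2 * bil Q (v s) (X s - X (t k)) + 2 * bil Z (v s) (X (t k))
          + bil U (v s) (v s))
        + h4 α (s - t k) T₁ * bil Xm (X (t k)) (X (t k))) ≤ 0 := by
      linarith
    have := mul_le_mul_of_nonneg_left hfin (Real.exp_pos (2 * α * t k)).le
    rw [mul_zero] at this
    linarith
  have hanti : AntitoneOn (fun s => lyap N α h P S R X v s + Real.exp (2 * α * t k) *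
      looped α T T₁ (t k) Q Z U Xm X v s) (Set.Icc (t k) (t (k + 1))) := by
    refine antitoneOn_of_deriv_nonpos (convex_Icc _ _) ?_ ?_ ?_
    · exact ((continuous_lyap hh.ne' P S R H.hasL2Deriv).add
        (continuous_const.mul (continuous_looped H hα T T₁ (t k) Q Z U Xm))).continuousOn
    · intro s hs
      rw [interior_Icc] at hs
      obtain ⟨D, hD, -⟩ := hderiv s hs
      exact hD.differentiableAt.differentiableWithinAt
    · intro s hs
      rw [interior_Icc] at hs
      obtain ⟨D, hD, hD0⟩ := hderiv s hs
      rw [hD.deriv]; exact hD0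
  have := hanti ⟨le_rfl, hs.1.trans hs.2⟩ hs hs.1
  simpa [looped_self] using this

lemma IsResetSequence.exists_mem_Icc {Tm TM : ℝ} {t : ℕ → ℝ} (ht : IsResetSequence Tm TM t)
    {s : ℝ} (hs : 0 ≤ s) : ∃ k, s ∈ Set.Icc (t k) (t (k + 1)) := by
  obtain ⟨n, hn⟩ := (ht.tendsto.eventually (eventually_ge_atTop s)).exists
  induction n with
  | zero =>
    rw [ht.zero] at hn
    obtain rfl : s = 0 := le_antisymm hn hs
    exact ⟨0, ht.zero.le, ht.zero ▸ (ht.strictMono (Nat.lt_succ_self 0)).le⟩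
  | succ n ih =>
    rcases le_total s (t n) with h | h
    · exact ih h
    · exact ⟨n, h, hn⟩

/-- Feasibility of the LMIs implies uniform exponential decay of trajectories. -/
theorem exists_decay {Tm TM α : ℝ} {N M : ℕ} (hh : 0 < h) (hα : 0 < α) (hM : 1 ≤ M)
    {𝒯 : Fin (M + 1) → ℝ} (h𝒯0 : 𝒯 0 = Tm) (h𝒯M : 𝒯 (Fin.last M) = TM)
    (hLMI : LMIFeasible Λ Λd K N M α h 𝒯) :
    ∃ C, 0 ≤ C ∧ ∀ (t : ℕ → ℝ) (X v : ℝ → ν → ℝ), IsResetSequence Tm TM t →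
      IsTrajectory Λ Λd K h t X v → ∀ B, 0 ≤ B →
      (∀ θ ∈ Set.Icc (-h) 0, ∀ j, X θ j ^ 2 ≤ B) → (∀ j, ∫ θ in (-h)..0, v θ j ^ 2 ≤ B) →
      ∀ s, 0 ≤ s → ∀ j, X s j ^ 2 ≤ C * B * Real.exp (-2 * α * s) := by
  obtain ⟨P, S, R, Q, Xm, U, Z, Y, hP, hS, hR, hQXU, hPS, hlmi⟩ := hLMI
  obtain ⟨c, hc, hcV⟩ := exists_mul_sum_sq_le_lyap hα hh hS.posSemidef hR.posSemidef hPS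
  obtain ⟨C₀, hC₀, hC₀V⟩ := exists_lyap_zero_le N hα hh P S hS.posSemidef hR.posSemidef
  choose Cq hCq0 hCq using fun i => exists_neg_mul_le_bil_add (hQXU i).1 (Z i)
  set Cs := ∑ i, Cq i with hCs
  have hCs0 : 0 ≤ Cs := Finset.sum_nonneg fun i _ => hCq0 i
  -- An upper bound for `h2` times a constant valid for every cell: it limits how negative the
  -- looped functional can be, relative to |X(t_k)|².
  set D := Real.exp (2 * α * TM) / (2 * α) * Cs with hD
  have hD0 : 0 ≤ D := by positivity
  refine ⟨(1 + D / c) * C₀ / c, by positivity, fun t X v ht H B hB hX hv => ?_⟩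
  have hstep : ∀ k, ∃ i : Fin M, t (k + 1) - t k ≤ 𝒯 i.succ ∧
      ∀ s ∈ Set.Icc (t k) (t (k + 1)), lyap N α h P S R X v s + Real.exp (2 * α * t k) *
        looped α (t (k + 1) - t k) (𝒯 i.succ) (t k) (Q i) (Z i) (U i) (Xm i) X v s ≤
          lyap N α h P S R X v (t k) := by
    intro k
    have hd := ht.dwell k
    obtain ⟨i, hi⟩ := exists_subinterval 𝒯 hM (h𝒯0.trans_le hd.1) (hd.2.trans_eq h𝒯M.symm)
    obtain ⟨A0, A1, B0, B1⟩ := hlmi i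
    exact ⟨i, hi.2, fun s hs => H.lyap_add_looped_le hh hα hP S hR.posSemidef (hQXU i).1
      (hQXU i).2.2 (Y i) hi A0 A1 B0 B1 hs⟩
  have hkmono : ∀ k, t k ≤ t (k + 1) := fun k => (ht.strictMono (Nat.lt_succ_self k)).le
  have hmono : ∀ k, lyap N α h P S R X v (t (k + 1)) ≤ lyap N α h P S R X v (t k) := by
    intro k
    obtain ⟨i, hi, hst⟩ := hstep k
    have h1 := hst (t (k + 1)) ⟨hkmono k, le_rfl⟩
    -- At the end of the interval the factor `h2` is zero and the X_i-term is nonnegative, so the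
    -- looped functional can be dropped.
    have h2 : 0 ≤ looped α (t (k + 1) - t k) (𝒯 i.succ) (t k) (Q i) (Z i) (U i) (Xm i) X v
        (t (k + 1)) := by
      rw [looped, h2, sub_self, zero_div, zero_mul, zero_add]
      exact mul_nonneg (h4Prim_nonneg hα ⟨by linarith [hkmono k], hi⟩)
        (bil_nonneg (hQXU i).2.1.posSemidef _)
    have := mul_nonneg (Real.exp_pos (2 * α * t k)).le h2
    linarith
  have hV0 : ∀ k, lyap N α h P S R X v (t k) ≤ C₀ * B := by
    intro k
    induction k with
    | zero => rw [ht.zero]; exact hC₀V X v H.hasL2Deriv B hX hv hB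
    | succ k ih => exact (hmono k).trans ih
  intro s hs j
  obtain ⟨k, hk⟩ := ht.exists_mem_Icc hs
  obtain ⟨i, hi, hst⟩ := hstep k
  have h1 := hst s hk
  have hE := Real.exp_pos (2 * α * t k)
  set Bk := ∑ j, X (t k) j ^ 2 with hBk
  have hBk0 : 0 ≤ Bk := Finset.sum_nonneg fun _ _ => sq_nonneg _
  -- Between sampling instants the looped functional has no sign because of Z; its negative part is
  -- controlled by |X(t_k)|², hence below by `lyap` at t_k.
  have hloop : -(D * Bk) ≤
      looped α (t (k + 1) - t k) (𝒯 i.succ) (t k) (Q i) (Z i) (U i) (Xm i) X v s := by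
    have e1 := hCq i (X s - X (t k)) (X (t k)) Bk fun j =>
      Finset.single_le_sum (f := fun j => X (t k) j ^ 2) (fun _ _ => sq_nonneg _)
        (Finset.mem_univ j)
    have e2 : 0 ≤ ∫ r in (t k)..s, bil (U i) (v r) (v r) :=
      intervalIntegral.integral_nonneg hk.1 fun r _ => bil_nonneg (hQXU i).2.2.posSemidef _
    have e3 : 0 ≤ h4Prim α (𝒯 i.succ) (s - t k) * bil (Xm i) (X (t k)) (X (t k)) :=
      mul_nonneg (h4Prim_nonneg hα ⟨by linarith [hk.1], by linarith [hk.2]⟩)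
        (bil_nonneg (hQXU i).2.1.posSemidef _)
    have e4 : 0 ≤ h2 α (s - t k) (t (k + 1) - t k) := h2_nonneg hα (by linarith [hk.2])
    have e5 : h2 α (s - t k) (t (k + 1) - t k) ≤ _ := h2_le hα (s - t k) (ht.dwell k).2
    have e6 : Cq i ≤ Cs := Finset.single_le_sum (fun i _ => hCq0 i) (Finset.mem_univ i)
    have e7 : -(Cq i * Bk) ≤ bil (Q i) (X s - X (t k)) (X s - X (t k))
        + 2 * bil (Z i) (X s - X (t k)) (X (t k)) + ∫ r in (t k)..s, bil (U i) (v r) (v r) := by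
      linarith
    have e8 := mul_le_mul_of_nonneg_left e7 e4
    have e9 : h2 α (s - t k) (t (k + 1) - t k) * (Cq i * Bk) ≤ D * Bk := by
      rw [hD, mul_assoc]
      exact mul_le_mul e5 (mul_le_mul_of_nonneg_right e6 hBk0)
        (mul_nonneg (hCq0 i) hBk0) (by positivity)
    rw [looped]
    linarith
  have hk1 := hcV X v H.hasL2Deriv (t k)
  have hs1 := hcV X v H.hasL2Deriv s
  rw [← hBk] at hk1
  have h2 : Real.exp (2 * α * t k) * (D * Bk) ≤ D / c * lyap N α h P S R X v (t k) := by
    have := mul_le_mul_of_nonneg_left hk1 (div_nonneg hD0 hc.le)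
    refine le_trans (le_of_eq ?_) this
    field_simp
  have h3 := mul_le_mul_of_nonneg_left hloop hE.le
  have h4 : lyap N α h P S R X v s ≤ (1 + D / c) * (C₀ * B) := by
    have := mul_le_mul_of_nonneg_left (hV0 k) (by positivity : 0 ≤ 1 + D / c)
    linarith
  have h5 : X s j ^ 2 ≤ ∑ j, X s j ^ 2 :=
    Finset.single_le_sum (f := fun j => X s j ^ 2) (fun _ _ => sq_nonneg _) (Finset.mem_univ j)
  have h6 : ∑ j, X s j ^ 2 = (c * Real.exp (2 * α * s) * ∑ j, X s j ^ 2) / c *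
      Real.exp (-2 * α * s) := by
    have : Real.exp (2 * α * s) * Real.exp (-2 * α * s) = 1 := by
      rw [← Real.exp_add]; simp
    rw [mul_assoc c, mul_div_cancel_left₀ _ hc.ne']
    linear_combination (-(∑ j, X s j ^ 2)) * this
  rw [h6] at h5
  refine h5.trans (mul_le_mul_of_nonneg_right ?_ (Real.exp_pos _).le)
  rw [div_mul_eq_mul_div]
  refine div_le_div_of_nonneg_right ?_ hc.le
  linarith

end Decay

/-! ### From solutions with initial data in `W` to trajectories -/

/-- Transfers absolute continuity from a vector-valued function to its coordinates, and to functions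
agreeing with them on the interval only. -/
lemma absolutelyContinuousOnInterval_of_dist_le {E F : Type*} [PseudoMetricSpace E]
    [PseudoMetricSpace F] {f : ℝ → F} {φ : ℝ → E} {a b : ℝ}
    (hφ : AbsolutelyContinuousOnInterval φ a b)
    (hd : ∀ x ∈ Set.uIcc a b, ∀ y ∈ Set.uIcc a b, dist (f x) (f y) ≤ dist (φ x) (φ y)) :
    AbsolutelyContinuousOnInterval f a b := by
  rw [absolutelyContinuousOnInterval_iff] at hφ ⊢
  intro ε hε
  obtain ⟨δ, hδ, H⟩ := hφ ε hε
  refine ⟨δ, hδ, fun E hE hlt => lt_of_le_of_lt (Finset.sum_le_sum fun i hi => ?_) (H E hE hlt)⟩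
  have := hE.1 i hi
  exact hd _ this.1 _ this.2

section InitialData

variable {ι : Type*} [Fintype ι]

lemma hasDerivAt_coord {φ : ℝ → EuclideanSpace ℝ ι} {φ' : EuclideanSpace ℝ ι} {s : ℝ}
    (hφ : HasDerivAt φ φ' s) (j : ι) : HasDerivAt (fun s => φ s j) (φ' j) s :=
  (EuclideanSpace.proj (𝕜 := ℝ) j).hasFDerivAt.comp_hasDerivAt s hφ

lemma MemW.absolutelyContinuous_coord {h : ℝ} (hh : 0 < h) {φ : ℝ → EuclideanSpace ℝ ι}
    (hφ : MemW h φ) {f : ℝ → ℝ} (j : ι) (hf : ∀ s ∈ Set.Icc (-h) 0, f s = φ s j) :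
    AbsolutelyContinuousOnInterval f (-h) 0 := by
  refine absolutelyContinuousOnInterval_of_dist_le hφ.1 fun x hx y hy => ?_
  rw [Set.uIcc_of_le (by linarith)] at hx hy
  rw [hf x hx, hf y hy, dist_eq_norm, dist_eq_norm]
  exact PiLp.norm_apply_le (φ x - φ y) j

/-- Absolutely continuous coordinates are differentiable almost everywhere, and finitely many of
them simultaneously, so the vector function is too. The open interval is needed because f is tied to
φ only on [−h,0]. -/
lemma MemW.deriv_coord {h : ℝ} (hh : 0 < h) {φ : ℝ → EuclideanSpace ℝ ι}
    (hφ : MemW h φ) {f : ℝ → ℝ} (j : ι) (hf : ∀ s ∈ Set.Icc (-h) 0, f s = φ s j) :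
    ∀ᵐ s ∂(volume.restrict (Set.Icc (-h) 0)), deriv f s = deriv φ s j := by
  have hd : ∀ i, ∀ᵐ s, s ∈ Set.uIcc (-h) 0 → DifferentiableAt ℝ (fun s => φ s i) s := fun i =>
    (hφ.absolutelyContinuous_coord hh i fun s _ => rfl).ae_differentiableAt
  rw [← Measure.restrict_congr_set Ioo_ae_eq_Icc, ae_restrict_iff' measurableSet_Ioo]
  filter_upwards [ae_all_iff.2 hd] with s hs hsI
  have hsI' : s ∈ Set.uIcc (-h) 0 := by
    rw [Set.uIcc_of_le (by linarith)]; exact Set.Ioo_subset_Icc_self hsI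
  have hdiff : DifferentiableAt ℝ φ s := by
    rw [differentiableAt_euclidean]
    exact fun i => hs i hsI'
  have h1 : HasDerivAt (fun s => φ s j) (deriv φ s j) s :=
    hasDerivAt_coord hdiff.hasDerivAt j
  have h2 : f =ᶠ[𝓝 s] fun s => φ s j := by
    filter_upwards [isOpen_Ioo.mem_nhds hsI] with r hr
    exact hf r (Set.Ioo_subset_Icc_self hr)
  exact (h1.congr_of_eventuallyEq h2).deriv

lemma MemW.memLp_deriv_coord {h : ℝ} (hh : 0 < h) {φ : ℝ → EuclideanSpace ℝ ι}
    (hφ : MemW h φ) {f : ℝ → ℝ} (j : ι) (hf : ∀ s ∈ Set.Icc (-h) 0, f s = φ s j) :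
    MemLp (deriv f) 2 (volume.restrict (Set.Icc (-h) 0)) := by
  refine MemLp.of_le hφ.2 (measurable_deriv f).aestronglyMeasurable ?_
  filter_upwards [hφ.deriv_coord hh j hf] with s hs
  rw [hs]; exact PiLp.norm_apply_le _ _

lemma normW_nonneg (h : ℝ) (φ : ℝ → EuclideanSpace ℝ ι) : 0 ≤ normW h φ :=
  add_nonneg (Real.iSup_nonneg fun _ => norm_nonneg _) (Real.sqrt_nonneg _)

lemma MemW.abs_coord_le {h : ℝ} (hh : 0 < h) {φ : ℝ → EuclideanSpace ℝ ι} (hφ : MemW h φ)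
    (j : ι) {s : ℝ} (hs : s ∈ Set.Icc (-h) 0) : |φ s j| ≤ normW h φ := by
  have hc := hφ.1.continuousOn
  rw [Set.uIcc_of_le (by linarith)] at hc
  obtain ⟨C, hC⟩ := isCompact_Icc.exists_bound_of_continuousOn hc
  have hb : BddAbove (Set.range fun θ : Set.Icc (-h) (0 : ℝ) => ‖φ θ‖) :=
    ⟨C, by rintro _ ⟨θ, rfl⟩; exact hC θ θ.2⟩
  have h1 : ‖φ s‖ ≤ ⨆ θ : Set.Icc (-h) (0 : ℝ), ‖φ θ‖ := le_ciSup hb ⟨s, hs⟩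
  have h2 : |φ s j| ≤ ‖φ s‖ := PiLp.norm_apply_le (φ s) j
  have h3 := Real.sqrt_nonneg (∫ θ in (-h)..0, ‖deriv φ θ‖ ^ 2)
  rw [normW]; linarith

lemma MemW.integral_deriv_coord_sq_le {h : ℝ} (hh : 0 < h) {φ : ℝ → EuclideanSpace ℝ ι}
    (hφ : MemW h φ) {f : ℝ → ℝ} (j : ι) (hf : ∀ s ∈ Set.Icc (-h) 0, f s = φ s j) :
    ∫ θ in (-h)..0, deriv f θ ^ 2 ≤ normW h φ ^ 2 := by
  have h0 : (0 : ℝ) ≤ ∫ θ in (-h)..0, ‖deriv φ θ‖ ^ 2 :=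
    intervalIntegral.integral_nonneg (by linarith) fun _ _ => sq_nonneg _
  have h1 : ∫ θ in (-h)..0, deriv f θ ^ 2 ≤ ∫ θ in (-h)..0, ‖deriv φ θ‖ ^ 2 := by
    rw [intervalIntegral.integral_of_le (by linarith), intervalIntegral.integral_of_le (by linarith),
      ← integral_Icc_eq_integral_Ioc, ← integral_Icc_eq_integral_Ioc]
    refine integral_mono_ae (hφ.memLp_deriv_coord hh j hf).integrable_sq
      (hφ.2.integrable_norm_pow (by norm_num)) ?_
    filter_upwards [hφ.deriv_coord hh j hf] with s hs
    rw [hs, ← sq_abs]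
    exact pow_le_pow_left₀ (abs_nonneg _) (PiLp.norm_apply_le (deriv φ s) j) 2
  have h2 : Real.sqrt (∫ θ in (-h)..0, ‖deriv φ θ‖ ^ 2) ≤ normW h φ :=
    le_add_of_nonneg_left (Real.iSup_nonneg fun _ => norm_nonneg _)
  calc _ ≤ _ := h1
    _ = Real.sqrt (∫ θ in (-h)..0, ‖deriv φ θ‖ ^ 2) ^ 2 := (Real.sq_sqrt h0).symm
    _ ≤ _ := pow_le_pow_left₀ (Real.sqrt_nonneg _) h2 2

end InitialData

/-- A function that is absolutely continuous on `[-h,0]` and differentiable with locally bounded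
derivative off a countable subset of `(0,∞)`, extended by a constant to the left of `-h`. -/
lemma hasL2Deriv_extend {f w : ℝ → ℝ} {h : ℝ} (hh : 0 < h) (hc : ContinuousOn f (Set.Ici (-h)))
    (hac : AbsolutelyContinuousOnInterval f (-h) 0)
    (hL : MemLp (deriv f) 2 (volume.restrict (Set.Icc (-h) 0)))
    {D : Set ℝ} (hD : D.Countable) (hw : ∀ s, 0 < s → s ∉ D → HasDerivAt f (w s) s)
    (hb : ∀ T, ∃ C, ∀ s, 0 < s → s ≤ T → s ∉ D → |w s| ≤ C) :
    HasL2Deriv (fun s => f (max s (-h))) ((Set.Ici (-h)).indicator (deriv f)) := by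
  have hmem : ∀ a b, MemLp ((Set.Ici (-h)).indicator (deriv f)) 2
      (volume.restrict (Set.uIoc a b)) := by
    intro a b
    have e : Set.Ici (-h) = Set.Icc (-h) 0 ∪ Set.Ioi 0 :=
      (Set.Icc_union_Ioi_eq_Ici (by linarith)).symm
    have hdis : Disjoint (Set.Icc (-h) 0) (Set.Ioi (0 : ℝ)) :=
      Set.disjoint_left.2 fun s hs hs' => absurd hs.2 (not_le.2 hs')
    rw [e, Set.indicator_union_of_disjoint hdis]
    have m1 : MemLp ((Set.Icc (-h) 0).indicator (deriv f)) 2 (volume.restrict (Set.uIoc a b)) :=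
      ((memLp_indicator_iff_restrict measurableSet_Icc).2 hL).restrict _
    obtain ⟨C, hC⟩ := hb (max a b)
    have m2 : MemLp ((Set.Ioi 0).indicator (deriv f)) 2 (volume.restrict (Set.uIoc a b)) := by
      refine MemLp.of_bound
        ((measurable_deriv f).indicator measurableSet_Ioi).aestronglyMeasurable (max C 0) ?_
      rw [ae_restrict_iff' measurableSet_uIoc]
      filter_upwards [hD.ae_notMem volume] with s hsD hs
      by_cases hs0 : 0 < s
      · rw [Set.indicator_of_mem (Set.mem_Ioi.2 hs0), (hw s hs0 hsD).deriv]
        exact (hC s hs0 hs.2 hsD).trans (le_max_left _ _)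
      · rw [Set.indicator_of_notMem (by simpa using hs0)]
        simp
    exact m1.add m2
  have hint : ∀ a b, IntervalIntegrable ((Set.Ici (-h)).indicator (deriv f)) volume a b := by
    intro a b
    rw [intervalIntegrable_iff]
    exact (hmem a b).integrable (by norm_num)
  have hg : ∀ s, -h ≤ s → (Set.Ici (-h)).indicator (deriv f) s = deriv f s := fun s hs =>
    Set.indicator_of_mem hs _
  -- To the right of 0 the fundamental theorem holds with a countable exceptional set; to the left,
  -- in `hneg`, it is the one for absolutely continuous functions.
  have hpos : ∀ b, 0 ≤ b → ∫ s in (0 : ℝ)..b, (Set.Ici (-h)).indicator (deriv f) s = f b - f 0 := by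
    intro b hb0
    refine MeasureTheory.integral_eq_of_hasDerivAt_off_countable_of_le f _ hb0 hD
      (hc.mono fun s hs => ?_) (fun s hs => ?_) (hint 0 b)
    · exact Set.mem_Ici.2 (by linarith [hs.1])
    · rw [hg s (by linarith [hs.1.1])]
      have := hw s hs.1.1 hs.2
      rwa [this.deriv]
  have hneg : ∀ b, -h ≤ b → b ≤ 0 →
      ∫ s in (0 : ℝ)..b, (Set.Ici (-h)).indicator (deriv f) s = f b - f 0 := by
    intro b hb1 hb0
    have h1 : AbsolutelyContinuousOnInterval f 0 b := (hac.mono (by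
      rw [Set.uIcc_of_le hb0, Set.uIcc_of_le (by linarith)]
      exact Set.Icc_subset_Icc_left hb1)).symm
    rw [← h1.integral_deriv_eq_sub]
    refine intervalIntegral.integral_congr fun s hs => hg s ?_
    rw [Set.uIcc_of_ge hb0] at hs
    linarith [hs.1]
  have h0 : ∀ b, f (max b (-h)) - f (max 0 (-h)) =
      ∫ s in (0 : ℝ)..b, (Set.Ici (-h)).indicator (deriv f) s := by
    intro b
    rw [max_eq_left (by linarith : -h ≤ 0)]
    rcases le_total 0 b with hb0 | hb0
    · rw [max_eq_left (by linarith), hpos b hb0]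
    · rcases le_total (-h) b with hb1 | hb1
      · rw [max_eq_left hb1, hneg b hb1 hb0]
      · rw [max_eq_right hb1, ← intervalIntegral.integral_add_adjacent_intervals (hint 0 (-h))
          (hint (-h) b), hneg (-h) le_rfl (by linarith)]
        have : ∫ s in (-h)..b, (Set.Ici (-h)).indicator (deriv f) s = 0 := by
          rw [intervalIntegral.integral_symm, intervalIntegral.integral_of_le hb1,
            integral_Ioc_eq_integral_Ioo, neg_eq_zero]
          refine setIntegral_eq_zero_of_forall_eq_zero fun s hs => ?_
          exact Set.indicator_of_notMem (by simpa using hs.2) _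
        rw [this, add_zero]
  refine ⟨hmem, fun a b => ?_⟩
  have := intervalIntegral.integral_interval_sub_left (hint 0 b) (hint 0 a)
  rw [← this, ← h0 b, ← h0 a]
  ring

/-! ### Systems with an input that is constant on each sampling interval -/

section Affine

variable {ν : Type*} [Fintype ν] [DecidableEq ν]

lemma abs_mulVec_le (A : Matrix ν ν ℝ) {x : ν → ℝ} {B : ℝ} (hx : ∀ j, |x j| ≤ B) (i : ν) :
    |(A *ᵥ x) i| ≤ (∑ i, ∑ j, |A i j|) * B := by
  have hB : 0 ≤ B := (abs_nonneg _).trans (hx i)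
  calc |(A *ᵥ x) i| ≤ ∑ j, |A i j * x j| := Finset.abs_sum_le_sum_abs _ _
    _ ≤ ∑ j, |A i j| * B := Finset.sum_le_sum fun j _ => by
        rw [abs_mul]; exact mul_le_mul_of_nonneg_left (hx j) (abs_nonneg _)
    _ = (∑ j, |A i j|) * B := (Finset.sum_mul _ _ _).symm
    _ ≤ _ := mul_le_mul_of_nonneg_right (Finset.single_le_sum (f := fun i => ∑ j, |A i j|)
        (fun _ _ => Finset.sum_nonneg fun _ _ => abs_nonneg _) (Finset.mem_univ i)) hB

/-- `Y` solves `Y'(s) = Λ Y(s) + Λd Y(s-h) + u_k` on the intervals `(t_k, t_{k+1})`. -/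
structure IsAffineSolution (Λ Λd : Matrix ν ν ℝ) (h : ℝ) (t : ℕ → ℝ) (u : ℕ → ν → ℝ)
    (Y : ℝ → ν → ℝ) : Prop where
  continuousOn : ContinuousOn Y (Set.Ici (-h))
  flow : ∀ k, ∀ s ∈ Set.Ioo (t k) (t (k + 1)), ∀ j,
    HasDerivAt (fun s => Y s j) ((Λ *ᵥ Y s + Λd *ᵥ Y (s - h) + u k) j) s

variable {Λ Λd : Matrix ν ν ℝ} {h : ℝ} {t : ℕ → ℝ} {u : ℕ → ν → ℝ} {Y : ℝ → ν → ℝ}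

lemma IsResetSequence.exists_mem_Ioo {Tm TM : ℝ} (ht : IsResetSequence Tm TM t) {s : ℝ}
    (hs : 0 ≤ s) (hsD : s ∉ Set.range t) : ∃ k, s ∈ Set.Ioo (t k) (t (k + 1)) := by
  obtain ⟨k, hk⟩ := ht.exists_mem_Icc hs
  exact ⟨k, lt_of_le_of_ne hk.1 fun e => hsD ⟨k, e⟩,
    lt_of_le_of_ne hk.2 fun e => hsD ⟨k + 1, e.symm⟩⟩

/-- On (0,T] the derivative is bounded off the reset instants, as Y is bounded on [−h,T] and only
finitely many inputs act before T. The map e matches coordinates of Y with those of φ, which has one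
more in the reset system. -/
lemma IsAffineSolution.hasL2Deriv {ι : Type*} [Fintype ι] {Tm TM : ℝ} (hh : 0 < h)
    (ht : IsResetSequence Tm TM t) (H : IsAffineSolution Λ Λd h t u Y)
    {φ : ℝ → EuclideanSpace ℝ ι} (hφ : MemW h φ) (e : ν → ι)
    (hhist : ∀ s ∈ Set.Icc (-h) 0, ∀ j, Y s j = φ s (e j)) (j : ν) :
    HasL2Deriv (fun s => Y (max s (-h)) j) ((Set.Ici (-h)).indicator (deriv fun s => Y s j)) := by
  have hcj : ∀ j, ContinuousOn (fun s => Y s j) (Set.Ici (-h)) := fun j =>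
    (continuous_apply j).comp_continuousOn H.continuousOn
  refine hasL2Deriv_extend (w := deriv fun s => Y s j) hh (hcj j)
    (hφ.absolutelyContinuous_coord hh (e j) fun s hs => hhist s hs j)
    (hφ.memLp_deriv_coord hh (e j) fun s hs => hhist s hs j) (Set.countable_range t) ?_ ?_
  · intro s hs hsD
    obtain ⟨k, hk⟩ := ht.exists_mem_Ioo hs.le hsD
    exact (H.flow k s hk j).differentiableAt.hasDerivAt
  · intro T
    obtain ⟨n, hn⟩ := (ht.tendsto.eventually (eventually_ge_atTop T)).exists
    obtain ⟨C, hC⟩ := isCompact_Icc.exists_bound_of_continuousOn (s := Set.Icc (-h) T)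
      (H.continuousOn.mono fun s hs => hs.1)
    refine ⟨(∑ i, ∑ j, |Λ i j|) * C + (∑ i, ∑ j, |Λd i j|) * C
      + ∑ k ∈ Finset.range n, |u k j|, fun s hs hsT hsD => ?_⟩
    obtain ⟨k, hk⟩ := ht.exists_mem_Ioo hs.le hsD
    have hkn : k < n := ht.strictMono.lt_iff_lt.1 (hk.1.trans_le (hsT.trans hn))
    have hY : ∀ r ∈ Set.Icc (-h) T, ∀ i, |Y r i| ≤ C := fun r hr i =>
      (norm_le_pi_norm (Y r) i).trans (hC r hr)
    rw [(H.flow k s hk j).deriv]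
    refine (abs_add_le _ _).trans (add_le_add ((abs_add_le _ _).trans (add_le_add ?_ ?_)) ?_)
    · exact abs_mulVec_le Λ (hY s ⟨by linarith, hsT⟩) j
    · exact abs_mulVec_le Λd (hY (s - h) ⟨by linarith, by linarith⟩) j
    · exact Finset.single_le_sum (f := fun k => |u k j|) (fun _ _ => abs_nonneg _)
        (Finset.mem_range.2 hkn)

/-- Bound on the first sampling interval. -/
lemma exists_first_interval_bound (Λ Λd : Matrix ν ν ℝ) {h : ℝ} (hh : 0 < h) (TM : ℝ) :
    ∃ C, 1 ≤ C ∧ ∀ (T : ℝ) (w : ν → ℝ) (Y : ℝ → ν → ℝ) (B : ℝ), 0 ≤ T → T ≤ TM → 0 ≤ B →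
      ContinuousOn Y (Set.Icc (-h) T) →
      (∀ s ∈ Set.Ioo 0 T, ∀ j, HasDerivAt (fun s => Y s j)
        ((Λ *ᵥ Y s + Λd *ᵥ Y (s - h) + w) j) s) →
      (∀ s ∈ Set.Icc (-h) 0, ∀ j, |Y s j| ≤ B) → (∀ j, |w j| ≤ B) →
      ∀ s ∈ Set.Icc (-h) T, ∀ j, |Y s j| ≤ C * B := by
  set a := ∑ i, ∑ j, |Λ i j| with ha
  set b := ∑ i, ∑ j, |Λd i j| with hb
  have ha0 : 0 ≤ a := Finset.sum_nonneg fun _ _ => Finset.sum_nonneg fun _ _ => abs_nonneg _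
  have hb0 : 0 ≤ b := Finset.sum_nonneg fun _ _ => Finset.sum_nonneg fun _ _ => abs_nonneg _
  -- The rate of an exponentially weighted norm, chosen so large that integrating the vector field
  -- returns at most half of the weighted maximum `S`.
  set l := 2 * (a + b + 1) with hl
  have hl0 : 0 < l := by positivity
  refine ⟨3 * Real.exp (l * max TM 0), ?_, fun T w Y B hT hTM hB hc hd hi hw => ?_⟩
  · have := Real.one_le_exp (by positivity : 0 ≤ l * max TM 0)
    linarith
  rcases isEmpty_or_nonempty ν with hν | hν
  · exact fun s _ j => (hν.false j).elim
  obtain ⟨s₀, hs₀, hmax⟩ := isCompact_Icc.exists_isMaxOn (Set.nonempty_Icc.2 hT)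
    (f := fun s => Real.exp (-l * s) * ‖Y s‖)
    ((by fun_prop : Continuous fun s : ℝ => Real.exp (-l * s)).continuousOn.mul
      (hc.mono (Set.Icc_subset_Icc_left (by linarith))).norm)
  set S := Real.exp (-l * s₀) * ‖Y s₀‖ with hS
  have hS0 : 0 ≤ S := by positivity
  have hYS : ∀ s ∈ Set.Icc 0 T, ‖Y s‖ ≤ S * Real.exp (l * s) := by
    intro s hs
    have h1 : Real.exp (-l * s) * ‖Y s‖ ≤ S := hmax hs
    have h2 : Real.exp (-l * s) * Real.exp (l * s) = 1 := by rw [← Real.exp_add]; simp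
    calc ‖Y s‖ = Real.exp (-l * s) * ‖Y s‖ * Real.exp (l * s) := by
          linear_combination (-‖Y s‖) * h2
      _ ≤ _ := mul_le_mul_of_nonneg_right h1 (Real.exp_pos _).le
  have hdel : ∀ s ∈ Set.Icc 0 T, ∀ j, |Y (s - h) j| ≤ (S + B) * Real.exp (l * s) := by
    intro s hs j
    have e1 : 1 ≤ Real.exp (l * s) := Real.one_le_exp (mul_nonneg hl0.le hs.1)
    rcases le_total 0 (s - h) with h0 | h0
    · have h1 := (norm_le_pi_norm (Y (s - h)) j).trans (hYS (s - h) ⟨h0, by linarith [hs.2]⟩)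
      have h2 : Real.exp (l * (s - h)) ≤ Real.exp (l * s) := Real.exp_le_exp.2 (by nlinarith)
      have h3 := mul_le_mul_of_nonneg_left h2 hS0
      have h4 : 0 ≤ B * Real.exp (l * s) := by positivity
      have h5 : |Y (s - h) j| ≤ S * Real.exp (l * (s - h)) := h1
      linarith
    · have h1 := hi (s - h) ⟨by linarith [hs.1], h0⟩ j
      nlinarith
  have hder : ∀ s ∈ Set.Icc 0 T, ∀ j, |(Λ *ᵥ Y s + Λd *ᵥ Y (s - h) + w) j| ≤
      l / 2 * (S + B) * Real.exp (l * s) := by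
    intro s hs j
    have e1 : 1 ≤ Real.exp (l * s) := Real.one_le_exp (mul_nonneg hl0.le hs.1)
    have h1 := abs_mulVec_le Λ (fun i => (norm_le_pi_norm (Y s) i).trans (hYS s hs)) j
    have h2 := abs_mulVec_le Λd (hdel s hs) j
    have h3 := hw j
    have h4 : |(Λ *ᵥ Y s + Λd *ᵥ Y (s - h) + w) j| ≤
        |(Λ *ᵥ Y s) j| + |(Λd *ᵥ Y (s - h)) j| + |w j| :=
      (abs_add_le _ _).trans (add_le_add_left (abs_add_le _ _) _)
    have h5 : B ≤ (S + B) * Real.exp (l * s) := by nlinarith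
    have h6 : a * (S * Real.exp (l * s)) ≤ a * ((S + B) * Real.exp (l * s)) := by
      refine mul_le_mul_of_nonneg_left (mul_le_mul_of_nonneg_right ?_ (Real.exp_pos _).le) ha0
      linarith
    have h7 : l / 2 * (S + B) * Real.exp (l * s) =
        a * ((S + B) * Real.exp (l * s)) + b * ((S + B) * Real.exp (l * s))
          + (S + B) * Real.exp (l * s) := by
      have : l / 2 = a + b + 1 := by rw [hl]; ring
      rw [this]; ring
    linarith
  have hgrow : ∀ s ∈ Set.Icc 0 T, ∀ j, |Y s j| ≤ B + (S + B) / 2 * Real.exp (l * s) := by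
    intro s hs j
    have key : ∀ σ : ℝ, |σ| = 1 → σ * Y s j ≤ B + (S + B) / 2 * Real.exp (l * s) := by
      intro σ hσ
      have hm : MonotoneOn (fun r => (S + B) / 2 * Real.exp (l * r) - σ * Y r j)
          (Set.Icc 0 T) := by
        have hdd : ∀ r ∈ Set.Ioo 0 T, HasDerivAt
            (fun r => (S + B) / 2 * Real.exp (l * r) - σ * Y r j)
            ((S + B) / 2 * (Real.exp (l * r) * l)
              - σ * (Λ *ᵥ Y r + Λd *ᵥ Y (r - h) + w) j) r := by
          intro r hr
          have d1 : HasDerivAt (fun r : ℝ => Real.exp (l * r)) (Real.exp (l * r) * l) r := by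
            simpa using ((hasDerivAt_id r).const_mul l).exp
          exact (d1.const_mul _).sub ((hd r hr j).const_mul σ)
        refine monotoneOn_of_deriv_nonneg (convex_Icc _ _) ?_ ?_ ?_
        · refine ContinuousOn.sub (by fun_prop) (continuousOn_const.mul ?_)
          exact (continuous_apply j).comp_continuousOn
            (hc.mono (Set.Icc_subset_Icc_left (by linarith)))
        · intro r hr
          rw [interior_Icc] at hr
          exact (hdd r hr).differentiableAt.differentiableWithinAt
        · intro r hr
          rw [interior_Icc] at hr
          rw [(hdd r hr).deriv]
          have h1 := hder r (Set.Ioo_subset_Icc_self hr) j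
          have h2 : σ * (Λ *ᵥ Y r + Λd *ᵥ Y (r - h) + w) j ≤
              |(Λ *ᵥ Y r + Λd *ᵥ Y (r - h) + w) j| := by
            refine (le_abs_self _).trans ?_
            rw [abs_mul, hσ, one_mul]
          linarith
      have h1 := hm ⟨le_rfl, hT⟩ hs hs.1
      simp only [mul_zero, Real.exp_zero, mul_one] at h1
      have h2 := hi 0 ⟨by linarith, le_rfl⟩ j
      have h3 : σ * Y 0 j ≤ B := by
        refine (le_abs_self _).trans ?_
        rw [abs_mul, hσ, one_mul]; exact h2
      linarith
    rw [abs_le']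
    have k1 := key 1 (by simp)
    have k2 := key (-1) (by simp)
    exact ⟨by linarith, by linarith⟩
  -- Evaluating the growth estimate at the maximizer gives S ≤ B + (S+B)/2, and the half is
  -- absorbed.
  have hSB : S ≤ 3 * B := by
    have h1 : ‖Y s₀‖ ≤ B + (S + B) / 2 * Real.exp (l * s₀) :=
      (pi_norm_le_iff_of_nonneg (by positivity)).2 fun j => hgrow s₀ hs₀ j
    have h2 : Real.exp (-l * s₀) * Real.exp (l * s₀) = 1 := by rw [← Real.exp_add]; simp
    have h3 : Real.exp (-l * s₀) ≤ 1 :=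
      Real.exp_le_one_iff.2 (by nlinarith [hs₀.1])
    have h4 := mul_le_mul_of_nonneg_left h1 (Real.exp_pos (-l * s₀)).le
    have h5 : Real.exp (-l * s₀) * B ≤ B := by nlinarith
    have h6 : Real.exp (-l * s₀) * (B + (S + B) / 2 * Real.exp (l * s₀)) =
        Real.exp (-l * s₀) * B + (S + B) / 2 := by linear_combination (S + B) / 2 * h2
    rw [h6] at h4
    linarith
  intro s hs j
  rcases le_total 0 s with h0 | h0
  · have h1 := (norm_le_pi_norm (Y s) j).trans (hYS s ⟨h0, hs.2⟩)
    have h2 : Real.exp (l * s) ≤ Real.exp (l * max TM 0) :=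
      Real.exp_le_exp.2 (mul_le_mul_of_nonneg_left (hs.2.trans (hTM.trans (le_max_left _ _))) hl0.le)
    calc |Y s j| ≤ S * Real.exp (l * s) := h1
      _ ≤ 3 * B * Real.exp (l * max TM 0) := mul_le_mul hSB h2 (Real.exp_pos _).le (by positivity)
      _ = _ := by ring
  · have h1 := hi s ⟨hs.1, h0⟩ j
    have h2 := Real.one_le_exp (by positivity : 0 ≤ l * max TM 0)
    nlinarith

end Affine

/-! ### From decay estimates to stability, and restarting after the first interval -/

section Stability

variable {ν : Type*} [Fintype ν] [DecidableEq ν]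

/-- A coordinatewise exponential bound yields the `ε`-`δ` estimate. -/
lemma exists_delta_of_coord_bound {G ε : ℝ} (hG : 0 ≤ G) (hε : 0 < ε) :
    ∃ δ > 0, ∀ (α W s : ℝ) (x : EuclideanSpace ℝ ν), 0 ≤ W → W < δ →
      (∀ j, |x j| ≤ G * W * Real.exp (-α * s)) → ‖x‖ < ε * Real.exp (-α * s) := by
  -- Dominates the square root of the dimension and stays positive in dimension zero.
  set c : ℝ := (Fintype.card ν : ℝ) + 1 with hc
  have hc0 : 0 < c := by positivity
  refine ⟨ε / (c * (G + 1)), by positivity, fun α W s x hW hWd hx => ?_⟩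
  have hE := Real.exp_pos (-α * s)
  have h1 : ‖x‖ ≤ c * (G * W * Real.exp (-α * s)) := by
    refine abs_le_of_sq_le_sq' ?_ (by positivity) |>.2
    rw [EuclideanSpace.real_norm_sq_eq]
    calc ∑ j, x j ^ 2 ≤ ∑ _j : ν, (G * W * Real.exp (-α * s)) ^ 2 :=
          Finset.sum_le_sum fun j _ => by
            rw [← sq_abs]; exact pow_le_pow_left₀ (abs_nonneg _) (hx j) 2
      _ = (Fintype.card ν : ℝ) * (G * W * Real.exp (-α * s)) ^ 2 := by simp
      _ ≤ c ^ 2 * (G * W * Real.exp (-α * s)) ^ 2 := by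
          refine mul_le_mul_of_nonneg_right ?_ (sq_nonneg _)
          have : (0 : ℝ) ≤ Fintype.card ν := by positivity
          nlinarith
      _ = _ := by ring
  have h2 : c * (G * W) < ε := by
    rw [lt_div_iff₀ (by positivity)] at hWd
    have : c * (G * W) ≤ W * (c * (G + 1)) := by nlinarith
    linarith
  calc ‖x‖ ≤ c * (G * W) * Real.exp (-α * s) := by linarith
    _ < _ := mul_lt_mul_of_pos_right h2 hE

lemma abs_le_of_sq_le_exp {C B α s y : ℝ} (hC : 0 ≤ C) (hB : 0 ≤ B)
    (h : y ^ 2 ≤ C * B ^ 2 * Real.exp (-2 * α * s)) :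
    |y| ≤ Real.sqrt C * B * Real.exp (-α * s) := by
  refine abs_le_of_sq_le_sq ?_ (by positivity)
  refine h.trans (le_of_eq ?_)
  rw [mul_pow, mul_pow, Real.sq_sqrt hC, ← Real.exp_nat_mul]
  ring_nf

variable {Λ Λd K : Matrix ν ν ℝ} {h : ℝ} {t : ℕ → ℝ}

lemma indicator_deriv_eq {f : ℝ → ℝ} {f' s : ℝ} (hs : -h ≤ s) (hf : HasDerivAt f f' s) :
    (Set.Ici (-h)).indicator (deriv f) s = f' := by
  rw [Set.indicator_of_mem (Set.mem_Ici.2 hs), hf.deriv]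

lemma IsResetSequence.nonneg {Tm TM : ℝ} (ht : IsResetSequence Tm TM t) (k : ℕ) : 0 ≤ t k :=
  ht.zero ▸ ht.strictMono.monotone (Nat.zero_le k)

lemma IsSampledSolution.isAffineSolution {φ X : ℝ → EuclideanSpace ℝ ν}
    (H : IsSampledSolution Λ Λd K h t φ X) :
    IsAffineSolution Λ Λd h t (fun k => (Λ * K) *ᵥ (X (t k)).ofLp) (fun s => (X s).ofLp) where
  continuousOn := (PiLp.continuous_ofLp 2 _).comp_continuousOn H.continuousOn
  flow k s hs j := by
    have h1 := (H.flow k s (Set.Ioo_subset_Ioc_self hs)).hasDerivAt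
      (mem_of_superset (isOpen_Ioo.mem_nhds hs) Set.Ioo_subset_Ioc_self)
    have h2 := hasDerivAt_coord h1 j
    refine h2.congr_deriv ?_
    simp [mulVec_mulVec]

/-- The sampled-data system is exponentially stable if the LMIs are feasible. -/
theorem sampledExpStable_of_LMIFeasible {Tm TM α : ℝ} {N M : ℕ} (hh : 0 < h) (hα : 0 < α)
    (hM : 1 ≤ M) {𝒯 : Fin (M + 1) → ℝ} (h𝒯0 : 𝒯 0 = Tm) (h𝒯M : 𝒯 (Fin.last M) = TM)
    (hLMI : LMIFeasible Λ Λd K N M α h 𝒯) : SampledExpStable Λ Λd K h Tm TM α := by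
  obtain ⟨C, hC0, hC⟩ := exists_decay hh hα hM h𝒯0 h𝒯M hLMI
  intro ε hε
  obtain ⟨δ, hδ, hδb⟩ := exists_delta_of_coord_bound (ν := ν) (Real.sqrt_nonneg C) hε
  refine ⟨δ, hδ, fun t φ X ht hφ hX hlt s hs => hδb α _ s (X s) (normW_nonneg h φ) hlt ?_⟩
  have haff := hX.isAffineSolution
  have hhist : ∀ s ∈ Set.Icc (-h) 0, ∀ j, (X s).ofLp j = φ s j := fun s hs j => by
    rw [hX.init s hs]
  have hL := haff.hasL2Deriv hh ht hφ id hhist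
  -- The constant extension to the left of −h makes the trajectory absolutely continuous on the
  -- whole line, with derivative zero there.
  set Y : ℝ → ν → ℝ := fun s j => X (max s (-h)) j with hY
  set v : ℝ → ν → ℝ := fun s j => (Set.Ici (-h)).indicator (deriv fun s => X s j) s with hv
  have hYeq : ∀ s, -h ≤ s → Y s = (X s).ofLp := fun s hs => by
    simp only [hY, max_eq_left hs]
  have htraj : IsTrajectory Λ Λd K h t Y v := by
    refine ⟨hL, fun k s hs => ?_⟩
    have hs0 : 0 ≤ s := (ht.nonneg k).trans hs.1.le
    rw [hYeq s (by linarith), hYeq (s - h) (by linarith), hYeq (t k) (by linarith [ht.nonneg k])]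
    ext j
    exact indicator_deriv_eq (by linarith) (haff.flow k s hs j)
  have hdec := hC t Y v ht htraj (normW h φ ^ 2) (sq_nonneg _) (fun θ hθ j => ?_) (fun j => ?_)
    s hs
  · intro j
    have := hdec j
    rw [hYeq s (by linarith)] at this
    exact abs_le_of_sq_le_exp hC0 (normW_nonneg h φ) this
  · rw [hYeq θ hθ.1, hhist θ hθ j, ← sq_abs]
    exact pow_le_pow_left₀ (abs_nonneg _) (hφ.abs_coord_le hh j hθ) 2
  · refine le_trans (le_of_eq ?_) (hφ.integral_deriv_coord_sq_le hh (f := fun s => X s j) j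
      fun s hs => hhist s hs j)
    refine intervalIntegral.integral_congr fun θ hθ => ?_
    rw [Set.uIcc_of_le (by linarith)] at hθ
    simp only [hv, Set.indicator_of_mem (Set.mem_Ici.2 hθ.1)]

/-- Decay of solutions whose input on the first sampling interval is arbitrary. -/
theorem exists_decay_after_first {ι : Type*} [Fintype ι] {Tm TM α : ℝ} {N M : ℕ} (hh : 0 < h)
    (hα : 0 < α) (hM : 1 ≤ M) {𝒯 : Fin (M + 1) → ℝ} (h𝒯0 : 𝒯 0 = Tm)
    (h𝒯M : 𝒯 (Fin.last M) = TM) (hLMI : LMIFeasible Λ Λd K N M α h 𝒯) (e : ν → ι) {c₀ : ℝ}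
    (hc₀ : 1 ≤ c₀) :
    ∃ G, 0 ≤ G ∧ ∀ (t : ℕ → ℝ) (φ : ℝ → EuclideanSpace ℝ ι) (u : ℕ → ν → ℝ) (Y : ℝ → ν → ℝ),
      IsResetSequence Tm TM t → MemW h φ → IsAffineSolution Λ Λd h t u Y →
      (∀ s ∈ Set.Icc (-h) 0, ∀ j, Y s j = φ s (e j)) →
      (∀ k, u (k + 1) = (Λ * K) *ᵥ Y (t (k + 1))) → (∀ j, |u 0 j| ≤ c₀ * normW h φ) →
      ∀ s, 0 ≤ s → ∀ j, |Y s j| ≤ G * normW h φ * Real.exp (-α * s) := by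
  obtain ⟨C, hC0, hC⟩ := exists_decay hh hα hM h𝒯0 h𝒯M hLMI
  obtain ⟨C₁, hC₁, hC₁b⟩ := exists_first_interval_bound Λ Λd hh TM
  set a := ∑ i, ∑ j, |Λ i j| with ha
  set b := ∑ i, ∑ j, |Λd i j| with hb
  have ha0 : 0 ≤ a := Finset.sum_nonneg fun _ _ => Finset.sum_nonneg fun _ _ => abs_nonneg _
  have hb0 : 0 ≤ b := Finset.sum_nonneg fun _ _ => Finset.sum_nonneg fun _ _ => abs_nonneg _
  have hTM : 0 ≤ max TM 0 := le_max_right _ _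
  -- `C₂` bounds the derivative on (0,t_1). In `C₃` the summands cover the energy of φ', the sup
  -- norm on [−h,t_1], and the energy on (0,t_1).
  set C₂ := (a + b + 1) * (C₁ * c₀) with hC₂
  set C₃ := 1 + (C₁ * c₀) ^ 2 + max TM 0 * C₂ ^ 2 with hC₃
  have hC₃0 : 0 ≤ C₃ := by positivity
  -- The exponential factor pays for the first interval, whose length is at most `TM`, during which
  -- no decay is claimed.
  refine ⟨(Real.sqrt C * Real.sqrt C₃ + C₁ * c₀) * Real.exp (α * max TM 0), by positivity,
    fun t φ u Y ht hφ H hhist hu hu0 => ?_⟩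
  set W := normW h φ with hW
  have hW0 : 0 ≤ W := normW_nonneg h φ
  have ht1 : 0 < t 1 := by
    have := ht.strictMono (Nat.zero_lt_one); rwa [ht.zero] at this
  have ht1M : t 1 ≤ max TM 0 := by
    have := (ht.dwell 0).2
    rw [zero_add, ht.zero, sub_zero] at this
    exact this.trans (le_max_left _ _)
  have ht1TM : t 1 ≤ TM := by
    have := (ht.dwell 0).2
    rwa [zero_add, ht.zero, sub_zero] at this
  have hflow0 : ∀ s ∈ Set.Ioo 0 (t 1), ∀ j, HasDerivAt (fun s => Y s j)
      ((Λ *ᵥ Y s + Λd *ᵥ Y (s - h) + u 0) j) s := by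
    intro s hs
    have := H.flow 0 s
    rw [ht.zero, zero_add] at this
    exact this hs
  have hcW : 0 ≤ c₀ * W := by positivity
  have hWcW : W ≤ c₀ * W := by nlinarith
  have hfirst : ∀ s ∈ Set.Icc (-h) (t 1), ∀ j, |Y s j| ≤ C₁ * (c₀ * W) := by
    refine hC₁b (t 1) (u 0) Y (c₀ * W) ht1.le ht1TM hcW (H.continuousOn.mono fun s hs => hs.1)
      hflow0 (fun s hs j => ?_) hu0
    rw [hhist s hs j]
    exact (hφ.abs_coord_le hh (e j) hs).trans hWcW
  have hL := H.hasL2Deriv hh ht hφ e hhist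
  set Y' : ℝ → ν → ℝ := fun s j => Y (max s (-h)) j with hY'
  set v : ℝ → ν → ℝ := fun s j => (Set.Ici (-h)).indicator (deriv fun s => Y s j) s with hv
  have hYeq : ∀ s, -h ≤ s → Y' s = Y s := fun s hs => by simp only [hY', max_eq_left hs]
  -- Time is shifted to t_1: from there on every input is a sampled state, so the restarted solution
  -- is a genuine trajectory with the solution on [t_1−h, t_1] as history.
  have htraj : IsTrajectory Λ Λd K h (fun k => t (k + 1) - t 1) (fun s => Y' (t 1 + s))
      (fun s => v (t 1 + s)) := by
    refine ⟨fun j => (hL j).comp_add_left (t 1), fun k s hs => ?_⟩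
    have hs' : t 1 + s ∈ Set.Ioo (t (k + 1)) (t (k + 1 + 1)) :=
      ⟨by linarith [hs.1], by linarith [hs.2]⟩
    have hk0 := ht.nonneg (k + 1)
    have hs0 : 0 < t 1 + s := hk0.trans_lt hs'.1
    simp only [add_sub_cancel]
    rw [← add_sub_assoc, hYeq (t 1 + s) (by linarith), hYeq (t 1 + s - h) (by linarith),
      hYeq (t (k + 1)) (by linarith)]
    ext j
    have := H.flow (k + 1) (t 1 + s) hs' j
    rw [hu k] at this
    exact indicator_deriv_eq (by linarith) this
  have htseq : IsResetSequence Tm TM (fun k => t (k + 1) - t 1) := by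
    refine ⟨by simp, fun i j hij => ?_, fun k => ?_, ?_⟩
    · have := ht.strictMono (Nat.succ_lt_succ hij)
      simp only [Nat.succ_eq_add_one] at this
      linarith
    · have := ht.dwell (k + 1)
      simpa using this
    · exact tendsto_atTop_add_const_right _ _ ((tendsto_add_atTop_iff_nat 1).2 ht.tendsto)
  have hvsq : ∀ j p q, IntervalIntegrable (fun s => v s j ^ 2) volume p q := fun j p q => by
    simpa [sq] using (hL j).intervalIntegrable_mul (hL j) p q
  have hv1 : ∀ j, ∫ s in (-h)..0, v s j ^ 2 ≤ W ^ 2 := by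
    intro j
    refine le_trans (le_of_eq ?_) (hφ.integral_deriv_coord_sq_le hh (f := fun s => Y s j) (e j)
      fun s hs => hhist s hs j)
    refine intervalIntegral.integral_congr fun θ hθ => ?_
    rw [Set.uIcc_of_le (by linarith)] at hθ
    simp only [hv, Set.indicator_of_mem (Set.mem_Ici.2 hθ.1)]
  have hv2 : ∀ j, ∫ s in (0 : ℝ)..(t 1), v s j ^ 2 ≤ max TM 0 * (C₂ * W) ^ 2 := by
    intro j
    have hmono := intervalIntegral.integral_mono_on_of_le_Ioo ht1.le (hvsq j 0 (t 1))
      (intervalIntegrable_const (μ := volume) (c := (C₂ * W) ^ 2)) fun s hs => ?_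
    · refine hmono.trans ?_
      rw [intervalIntegral.integral_const, smul_eq_mul, sub_zero]
      exact mul_le_mul_of_nonneg_right ht1M (sq_nonneg _)
    · have e1 : v s j = (Λ *ᵥ Y s + Λd *ᵥ Y (s - h) + u 0) j :=
        indicator_deriv_eq (by linarith [hs.1]) (hflow0 s hs j)
      have e2 := abs_mulVec_le Λ (hfirst s ⟨by linarith [hs.1], hs.2.le⟩) j
      have e3 := abs_mulVec_le Λd (hfirst (s - h) ⟨by linarith [hs.1], by linarith [hs.2]⟩) j
      have e4 : |v s j| ≤ C₂ * W := by
        rw [e1]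
        have e5 : |(Λ *ᵥ Y s + Λd *ᵥ Y (s - h) + u 0) j| ≤
            |(Λ *ᵥ Y s) j| + |(Λd *ᵥ Y (s - h)) j| + |u 0 j| :=
          (abs_add_le _ _).trans (add_le_add_left (abs_add_le _ _) _)
        have e6 := hu0 j
        have e7 : c₀ * W ≤ C₁ * (c₀ * W) := by nlinarith
        have e8 : C₂ * W = a * (C₁ * (c₀ * W)) + b * (C₁ * (c₀ * W)) + C₁ * (c₀ * W) := by
          rw [hC₂]; ring
        rw [e8]
        linarith
      rw [← sq_abs]
      exact pow_le_pow_left₀ (abs_nonneg _) e4 2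
  have hdec := hC _ _ _ htseq htraj (C₃ * W ^ 2) (by positivity) (fun θ hθ j => ?_) (fun j => ?_)
  · intro s hs j
    have hexpM : ∀ r, r ≤ max TM 0 → 1 ≤ Real.exp (α * max TM 0) * Real.exp (-α * r) := by
      intro r hr
      rw [← Real.exp_add]
      exact Real.one_le_exp (by nlinarith)
    have hX0 : 0 ≤ Real.sqrt C * Real.sqrt C₃ := by positivity
    have hX1 : 0 ≤ C₁ * c₀ := by positivity
    rcases le_total s (t 1) with hst | hst
    · have h1 := hfirst s ⟨by linarith, hst⟩ j
      have h2 := hexpM s (hst.trans ht1M)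
      calc |Y s j| ≤ (C₁ * c₀) * W * 1 := by linarith
        _ ≤ (Real.sqrt C * Real.sqrt C₃ + C₁ * c₀) * W *
            (Real.exp (α * max TM 0) * Real.exp (-α * s)) := by
            refine mul_le_mul (mul_le_mul_of_nonneg_right (by linarith) hW0) h2 zero_le_one
              (by positivity)
        _ = _ := by ring
    · have h1 := hdec (s - t 1) (by linarith) j
      simp only [add_sub_cancel] at h1
      rw [hYeq s (by linarith), ← Real.sq_sqrt hC₃0, ← mul_pow] at h1
      have h2 := abs_le_of_sq_le_exp hC0 (by positivity) h1
      have h3 : Real.exp (-α * (s - t 1)) ≤ Real.exp (α * max TM 0) * Real.exp (-α * s) := by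
        rw [← Real.exp_add]
        exact Real.exp_le_exp.2 (by nlinarith)
      calc |Y s j| ≤ Real.sqrt C * Real.sqrt C₃ * W * Real.exp (-α * (s - t 1)) := by linarith
        _ ≤ (Real.sqrt C * Real.sqrt C₃ + C₁ * c₀) * W *
            (Real.exp (α * max TM 0) * Real.exp (-α * s)) := by
            refine mul_le_mul (mul_le_mul_of_nonneg_right (by linarith) hW0) h3
              (Real.exp_pos _).le (by positivity)
        _ = _ := by ring
  · rw [hYeq _ (by linarith [hθ.1])]
    have h1 := hfirst (t 1 + θ) ⟨by linarith [hθ.1], by linarith [hθ.2]⟩ j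
    have h2 : Y (t 1 + θ) j ^ 2 ≤ (C₁ * (c₀ * W)) ^ 2 := by
      rw [← sq_abs]; exact pow_le_pow_left₀ (abs_nonneg _) h1 2
    have h3 : 0 ≤ max TM 0 * C₂ ^ 2 * W ^ 2 := by positivity
    have h4 : 0 ≤ W ^ 2 := sq_nonneg _
    have h5 : C₃ * W ^ 2 = W ^ 2 + (C₁ * (c₀ * W)) ^ 2 + max TM 0 * C₂ ^ 2 * W ^ 2 := by
      rw [hC₃]; ring
    rw [h5]; linarith
  · have h0 : ∫ θ in (-h)..0, v (t 1 + θ) j ^ 2 = ∫ s in (t 1 - h)..(t 1), v s j ^ 2 :=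
      integral_comp_shift (fun s => v s j ^ 2) h (t 1)
    -- The history window may straddle 0, so it is enlarged to [−h,t_1] and split at 0.
    have h1 : ∫ s in (t 1 - h)..(t 1), v s j ^ 2 ≤ ∫ s in (-h)..(t 1), v s j ^ 2 := by
      rw [← intervalIntegral.integral_add_adjacent_intervals (hvsq j (-h) (t 1 - h))
        (hvsq j (t 1 - h) (t 1))]
      exact le_add_of_nonneg_left
        (intervalIntegral.integral_nonneg (by linarith) fun _ _ => sq_nonneg _)
    rw [← intervalIntegral.integral_add_adjacent_intervals (hvsq j (-h) 0)
        (hvsq j 0 (t 1))] at h1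
    have h2 := hv1 j
    have h3 := hv2 j
    have h4 : 0 ≤ (C₁ * c₀) ^ 2 * W ^ 2 := by positivity
    have h5 : C₃ * W ^ 2 = W ^ 2 + (C₁ * c₀) ^ 2 * W ^ 2 + max TM 0 * (C₂ * W) ^ 2 := by
      rw [hC₃]; ring
    rw [h0, h5]; linarith

end Stability

/-! ### Reduction of the reset system to the sampled-data system -/

lemma eq_of_deriv_eq_zero_of_tendsto {g : ℝ → ℝ} {a b L : ℝ}
    (hd : ∀ s ∈ Set.Ioo a b, HasDerivAt g 0 s) (hL : Tendsto g (𝓝[>] a) (𝓝 L)) {s : ℝ}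
    (hs : s ∈ Set.Ioo a b) : g s = L := by
  have hconst : ∀ r ∈ Set.Ioo a b, g r = g s := fun r hr =>
    isOpen_Ioo.is_const_of_deriv_eq_zero isPreconnected_Ioo
      (fun x hx => (hd x hx).differentiableAt.differentiableWithinAt)
      (fun x hx => (hd x hx).deriv) hr hs
  have h1 : Tendsto g (𝓝[>] a) (𝓝 (g s)) := by
    refine tendsto_const_nhds.congr' ?_
    filter_upwards [Ioo_mem_nhdsGT (hs.1.trans hs.2)] with r hr
    exact (hconst r hr).symm
  exact tendsto_nhds_unique h1 hL

section Reset

variable {np : ℕ} {Ap : Matrix (Fin np) (Fin np) ℝ} {Bp : Matrix (Fin np) (Fin 1) ℝ}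
  {Cp : Matrix (Fin 1) (Fin np) ℝ} {kp ki pr h : ℝ}

/-- The components `(x_p, x_i)` of the state of the reset system. -/
def keepIdx : SIdx np → RIdx np := Sum.map id fun _ => 0

lemma clAR_keepIdx (x : EuclideanSpace ℝ (RIdx np)) (j : SIdx np) :
    (clAR np).toEuclideanLin x (keepIdx j) = x (keepIdx j) := by
  rcases j with p | i
  · simp [clAR, keepIdx, mulVec, dotProduct, Fintype.sum_sum_type, Matrix.one_apply]
  · simp [clAR, keepIdx, mulVec, dotProduct, Fintype.sum_sum_type]

lemma clAR_inr_one (x : EuclideanSpace ℝ (RIdx np)) :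
    (clAR np).toEuclideanLin x (Sum.inr 1) = 0 := by
  simp [clAR, mulVec, dotProduct, Fintype.sum_sum_type]

/-- Both integrators are driven by the same signal, which is why their difference is constant
between resets. -/
lemma closedLoop_inr (x y : EuclideanSpace ℝ (RIdx np)) :
    ((clA Ap Bp pr).toEuclideanLin x + (clAd Bp Cp kp ki).toEuclideanLin y) (Sum.inr 1) =
      ((clA Ap Bp pr).toEuclideanLin x + (clAd Bp Cp kp ki).toEuclideanLin y) (Sum.inr 0) := by
  simp [clA, clAd, Br, mulVec, dotProduct, Fintype.sum_sum_type]

/-- The closed-loop vector field in terms of `(x_p, x_i)` and `r = x_ri - x_i`. -/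
lemma closedLoop_keepIdx (x y : EuclideanSpace ℝ (RIdx np)) {r : ℝ}
    (hr : x (Sum.inr 1) - x (Sum.inr 0) = r) (j : SIdx np) :
    ((clA Ap Bp pr).toEuclideanLin x + (clAd Bp Cp kp ki).toEuclideanLin y) (keepIdx j) =
      (Lam Ap Bp *ᵥ (fun j => x (keepIdx j)) + LamD Bp Cp kp ki *ᵥ (fun j => y (keepIdx j))
        + Lam Ap Bp *ᵥ (Sum.elim 0 fun _ => pr * r)) j := by
  have hr' : x (Sum.inr 1) = x (Sum.inr 0) + r := by linarith
  rcases j with p | i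
  · simp [clA, clAd, Lam, LamD, Cr, keepIdx, mulVec, dotProduct, Fintype.sum_sum_type,
      Matrix.mul_apply, hr']
    ring
  · simp [clA, clAd, Lam, LamD, Br, keepIdx, mulVec, dotProduct, Fintype.sum_sum_type]
    fin_cases i
    simp [vecMul, dotProduct]

/-- Right after a reset x_ri = 0, so the offset x_ri − x_i is −x_i(t_k); the gain K feeds precisely
p_r times this offset. -/
lemma Lam_mul_gainK_mulVec (x : SIdx np → ℝ) :
    (Lam Ap Bp * gainK np pr) *ᵥ x = Lam Ap Bp *ᵥ (Sum.elim 0 fun _ => pr * -x (Sum.inr 0)) := by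
  rw [← mulVec_mulVec]
  congr 1
  ext j
  rcases j with p | i
  · simp [gainK, mulVec, dotProduct, Fintype.sum_sum_type]
  · fin_cases i
    simp [gainK, mulVec, dotProduct, Fintype.sum_sum_type]

variable {S : Set (ℝ × EuclideanSpace ℝ (RIdx np))} {t : ℕ → ℝ}
  {φ x : ℝ → EuclideanSpace ℝ (RIdx np)} {Tm TM : ℝ}

lemma tendsto_coord {l : Filter ℝ} {y : EuclideanSpace ℝ (RIdx np)} (hx : Tendsto x l (𝓝 y))
    (j : RIdx np) : Tendsto (fun s => x s j) l (𝓝 (y j)) :=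
  ((EuclideanSpace.proj (𝕜 := ℝ) j).continuous.tendsto y).comp hx

/-- The state right after time `0`. -/
lemma IsResetSolution.exists_initial_limit
    (H : IsResetSolution (clA Ap Bp pr) (clAd Bp Cp kp ki) (clAR np) h S t φ x) :
    ∃ y : EuclideanSpace ℝ (RIdx np), Tendsto x (𝓝[>] 0) (𝓝 y) ∧
      (∀ j, y (keepIdx j) = x 0 (keepIdx j)) ∧ |y (Sum.inr 1)| ≤ |x 0 (Sum.inr 1)| := by
  by_cases h0 : (0, x 0) ∈ S
  · refine ⟨_, H.jump 0 le_rfl h0, fun j => clAR_keepIdx _ j, ?_⟩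
    rw [clAR_inr_one, abs_zero]; exact abs_nonneg _
  · exact ⟨x 0, (H.start h0).tendsto.mono_left (nhdsWithin_mono _ Set.Ioi_subset_Ici_self),
      fun _ => rfl, le_rfl⟩

/-- A reset alters only x_ri, so the coordinates (x_p, x_i) do not jump; with left continuity this
makes them continuous. -/
lemma IsResetSolution.tendsto_right
    (H : IsResetSolution (clA Ap Bp pr) (clAd Bp Cp kp ki) (clAR np) h S t φ x) {s : ℝ}
    (hs : 0 ≤ s) (j : SIdx np) :
    Tendsto (fun s => x s (keepIdx j)) (𝓝[>] s) (𝓝 (x s (keepIdx j))) := by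
  rcases hs.eq_or_lt with rfl | hs0
  · obtain ⟨y, hy, hyk, -⟩ := H.exists_initial_limit
    rw [← hyk j]; exact tendsto_coord hy _
  · by_cases hS : (s, x s) ∈ S
    · rw [← clAR_keepIdx (x s) j]; exact tendsto_coord (H.jump s hs hS) _
    · exact (tendsto_coord (H.flow s hs0 hS).continuousAt.tendsto _).mono_left nhdsWithin_le_nhds

lemma IsResetSolution.continuousOn_keepIdx (hh : 0 < h) (hφ : MemW h φ)
    (H : IsResetSolution (clA Ap Bp pr) (clAd Bp Cp kp ki) (clAR np) h S t φ x) :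
    ContinuousOn (fun s (j : SIdx np) => x s (keepIdx j)) (Set.Ici (-h)) := by
  rw [continuousOn_pi]
  intro j
  have c1 : ContinuousOn (fun s => x s (keepIdx j)) (Set.Icc (-h) 0) := by
    have hc := hφ.1.continuousOn
    rw [Set.uIcc_of_le (by linarith)] at hc
    exact ((EuclideanSpace.proj (𝕜 := ℝ) (keepIdx j)).continuous.comp_continuousOn hc).congr
      fun s hs => by simp [IsResetSolution.init H s hs]
  have c2 : ContinuousOn (fun s => x s (keepIdx j)) (Set.Ici 0) := by
    intro s hs
    have hright : ContinuousWithinAt (fun s => x s (keepIdx j)) (Set.Ici s) s :=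
      continuousWithinAt_Ioi_iff_Ici.1 (H.tendsto_right hs j)
    rcases (Set.mem_Ici.1 hs).eq_or_lt with rfl | hs0
    · exact hright
    · have hleft : ContinuousWithinAt (fun s => x s (keepIdx j)) (Set.Iic s) s :=
        tendsto_coord (H.left_cont s hs0) _
      exact (continuousAt_iff_continuous_left_right.2 ⟨hleft, hright⟩).continuousWithinAt
  rw [← Set.Icc_union_Ici_eq_Ici (by linarith : -h ≤ 0)]
  exact c1.union_of_isClosed c2 isClosed_Icc isClosed_Ici

lemma IsResetSequence.ne_of_mem_Ioo (ht : IsResetSequence Tm TM t) {k : ℕ} {s : ℝ}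
    (hs : s ∈ Set.Ioo (t k) (t (k + 1))) (m : ℕ) : t m ≠ s := by
  rintro rfl
  have h1 := ht.strictMono.lt_iff_lt.1 hs.1
  have h2 := ht.strictMono.lt_iff_lt.1 hs.2
  omega

lemma IsResetSolution.hasDerivAt (ht : IsResetSequence Tm TM t)
    (H : IsResetSolution (clA Ap Bp pr) (clAd Bp Cp kp ki) (clAR np) h S t φ x) {k : ℕ} {s : ℝ}
    (hs : s ∈ Set.Ioo (t k) (t (k + 1))) :
    HasDerivAt x ((clA Ap Bp pr).toEuclideanLin (x s)
      + (clAd Bp Cp kp ki).toEuclideanLin (x (s - h))) s := by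
  have hs0 : 0 < s := (ht.nonneg k).trans_lt hs.1
  refine H.flow s hs0 fun hS => ?_
  obtain ⟨m, hm⟩ := (H.instants s hs0).1 hS
  exact ht.ne_of_mem_Ioo hs (m + 1) hm

/-- Between resets `x_ri - x_i` is constant. -/
lemma IsResetSolution.exists_offset (ht : IsResetSequence Tm TM t)
    (H : IsResetSolution (clA Ap Bp pr) (clAd Bp Cp kp ki) (clAR np) h S t φ x) :
    ∃ r : ℕ → ℝ, |r 0| ≤ |x 0 (Sum.inr 1)| + |x 0 (Sum.inr 0)| ∧
      (∀ k, r (k + 1) = -x (t (k + 1)) (Sum.inr 0)) ∧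
      ∀ k, ∀ s ∈ Set.Ioc (t k) (t (k + 1)), x s (Sum.inr 1) - x s (Sum.inr 0) = r k := by
  obtain ⟨y, hy, hyk, hy1⟩ := H.exists_initial_limit
  -- At positive reset instants the limit follows from the jump. At 0 a reset may or may not occur,
  -- so the first offset is only known to be bounded by the initial state.
  have hlim : ∀ k, Tendsto (fun s => x s (Sum.inr 1) - x s (Sum.inr 0)) (𝓝[>] (t k))
      (𝓝 (if k = 0 then y (Sum.inr 1) - y (Sum.inr 0) else -x (t k) (Sum.inr 0))) := by
    intro k
    rcases k with _ | k
    · rw [ht.zero, if_pos rfl]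
      exact (tendsto_coord hy _).sub (tendsto_coord hy _)
    · have hpos : 0 < t (k + 1) := by
        have := ht.strictMono (Nat.succ_pos k); rwa [ht.zero] at this
      have hS := (H.instants _ hpos).2 ⟨k, rfl⟩
      have hj := H.jump _ hpos.le hS
      have h1 := (tendsto_coord hj (Sum.inr 1)).sub (tendsto_coord hj (Sum.inr 0))
      rw [clAR_inr_one] at h1
      have h2 := clAR_keepIdx (x (t (k + 1))) (Sum.inr 0)
      simp only [keepIdx, Sum.map_inr] at h2
      rw [h2, zero_sub] at h1
      simpa using h1
  refine ⟨fun k => if k = 0 then y (Sum.inr 1) - y (Sum.inr 0) else -x (t k) (Sum.inr 0), ?_,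
    fun k => by simp, fun k s hs => ?_⟩
  · have h2 := hyk (Sum.inr 0)
    simp only [keepIdx, Sum.map_inr] at h2
    simp only [if_true]
    refine (abs_sub _ _).trans (add_le_add hy1 ?_)
    rw [h2]
  · have hd : ∀ s ∈ Set.Ioo (t k) (t (k + 1)),
        HasDerivAt (fun s => x s (Sum.inr 1) - x s (Sum.inr 0)) 0 s := by
      intro s hs
      have h1 := H.hasDerivAt ht hs
      refine ((hasDerivAt_coord h1 (Sum.inr 1)).sub (hasDerivAt_coord h1 (Sum.inr 0))).congr_deriv
        ?_
      rw [closedLoop_inr, sub_self]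
    have hopen : ∀ s ∈ Set.Ioo (t k) (t (k + 1)), x s (Sum.inr 1) - x s (Sum.inr 0) = _ :=
      fun s hs => eq_of_deriv_eq_zero_of_tendsto hd (hlim k) hs
    -- At t_{k+1} the execution still has its value before the reset, and the identity extends there
    -- by left continuity.
    rcases hs.2.eq_or_lt with he | hlt
    · subst he
      have hpos : 0 < t (k + 1) := (ht.nonneg k).trans_lt hs.1
      have hleft := (H.left_cont _ hpos).tendsto.mono_left
        (nhdsWithin_mono _ (Set.Iio_subset_Iic_self (a := t (k + 1))))
      have h1 := (tendsto_coord hleft (Sum.inr 1)).sub (tendsto_coord hleft (Sum.inr 0))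
      refine tendsto_nhds_unique h1 (tendsto_const_nhds.congr' ?_)
      filter_upwards [Ioo_mem_nhdsLT hs.1] with s hs
      exact (hopen s hs).symm
    · exact hopen s ⟨hs.1, hlt⟩

/-- The reset system is exponentially stable if the LMIs are feasible. -/
theorem resetExpStable_of_LMIFeasible {α : ℝ} {N M : ℕ} (hh : 0 < h) (hα : 0 < α)
    (hM : 1 ≤ M) {𝒯 : Fin (M + 1) → ℝ} (h𝒯0 : 𝒯 0 = Tm) (h𝒯M : 𝒯 (Fin.last M) = TM)
    (hLMI : LMIFeasible (Lam Ap Bp) (LamD Bp Cp kp ki) (gainK np pr) N M α h 𝒯)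
    (S : Set (ℝ × EuclideanSpace ℝ (RIdx np))) :
    ResetExpStable (clA Ap Bp pr) (clAd Bp Cp kp ki) (clAR np) h S Tm TM α := by
  set a := ∑ i, ∑ j, |(Lam Ap Bp) i j| with ha
  have ha0 : 0 ≤ a := Finset.sum_nonneg fun _ _ => Finset.sum_nonneg fun _ _ => abs_nonneg _
  -- The first input is Λ applied to p_r·r_0 with |r_0| ≤ 2‖φ‖_W; the summand 1 only ensures c₀ ≥ 1.
  obtain ⟨G, hG0, hG⟩ := exists_decay_after_first hh hα hM h𝒯0 h𝒯M hLMI (keepIdx (np := np))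
    (c₀ := 1 + a * (|pr| * 2)) (by nlinarith [mul_nonneg ha0 (abs_nonneg pr)])
  set E := Real.exp (α * max TM 0) with hE
  have hE1 : 1 ≤ E := Real.one_le_exp (by positivity)
  intro ε hε
  -- The bound for x_ri = x_i + r_k: G for x_i, and (G+2)E for the offset, where 2 covers k = 0, G
  -- covers later samples, and E the time elapsed since t_k.
  obtain ⟨δ, hδ, hδb⟩ := exists_delta_of_coord_bound (ν := RIdx np)
    (by positivity : 0 ≤ G + (G + 2) * E) hε
  refine ⟨δ, hδ, fun t φ x ht hφ H hlt s hs => hδb α _ s (x s) (normW_nonneg h φ) hlt ?_⟩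
  set W := normW h φ with hW
  have hW0 : 0 ≤ W := normW_nonneg h φ
  obtain ⟨r, hr0, hrk, hr⟩ := H.exists_offset ht
  set Y : ℝ → SIdx np → ℝ := fun s j => x s (keepIdx j) with hY
  have hx0 : ∀ j, |x 0 j| ≤ W := fun j => by
    rw [IsResetSolution.init H 0 ⟨by linarith, le_rfl⟩]
    exact hφ.abs_coord_le hh j ⟨by linarith, le_rfl⟩
  have hr0W : |r 0| ≤ 2 * W := by linarith [hx0 (Sum.inr 1), hx0 (Sum.inr 0)]
  have hYb : ∀ s, 0 ≤ s → ∀ j, |Y s j| ≤ G * W * Real.exp (-α * s) := by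
    refine hG t φ (fun k => Lam Ap Bp *ᵥ (Sum.elim 0 fun _ => pr * r k)) Y ht hφ
      ⟨H.continuousOn_keepIdx hh hφ, fun k s hs j => ?_⟩ (fun s hs j => ?_) (fun k => ?_)
      fun j => ?_
    · exact (hasDerivAt_coord (H.hasDerivAt ht hs) (keepIdx j)).congr_deriv
        (closedLoop_keepIdx _ _ (hr k s (Set.Ioo_subset_Ioc_self hs)) j)
    · simp only [hY, IsResetSolution.init H s hs]
    · rw [Lam_mul_gainK_mulVec]
      simp only [hY, keepIdx, Sum.map_inr, hrk k]
    · refine (abs_mulVec_le (Lam Ap Bp) (B := |pr| * (2 * W)) (fun i => ?_) j).trans ?_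
      · rcases i with p | i
        · simp; positivity
        · simp only [Sum.elim_inr, abs_mul]
          exact mul_le_mul_of_nonneg_left hr0W (abs_nonneg _)
      · rw [← ha]; linarith
  have hGW : 0 ≤ G * W := mul_nonneg hG0 hW0
  have hexp := Real.exp_pos (-α * s)
  have hEexp : ∀ q, s - max TM 0 ≤ q → Real.exp (-α * q) ≤ E * Real.exp (-α * s) := by
    intro q hq
    rw [hE, ← Real.exp_add]
    exact Real.exp_le_exp.2 (by nlinarith)
  have hbig : G * W * Real.exp (-α * s) ≤ (G + (G + 2) * E) * W * Real.exp (-α * s) := by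
    refine mul_le_mul_of_nonneg_right (mul_le_mul_of_nonneg_right ?_ hW0) hexp.le
    nlinarith
  have hi : |x s (Sum.inr 0)| ≤ G * W * Real.exp (-α * s) := hYb s hs (Sum.inr 0)
  have hri : |x s (Sum.inr 1)| ≤ (G + (G + 2) * E) * W * Real.exp (-α * s) := by
    rcases hs.eq_or_lt with h0 | h0
    · subst h0
      have := hx0 (Sum.inr 1)
      simp only [mul_zero, Real.exp_zero, mul_one]
      nlinarith [mul_nonneg hG0 hW0, mul_nonneg (mul_nonneg hG0 (by linarith : 0 ≤ E)) hW0]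
    -- The interval is open on the left: at s = t_k the value is the one before the reset, so the
    -- offset of the preceding interval applies.
    · obtain ⟨k, hk⟩ : ∃ k, s ∈ Set.Ioc (t k) (t (k + 1)) := by
        obtain ⟨k, hk⟩ := ht.exists_mem_Icc hs
        rcases hk.1.eq_or_lt with he | hlt'
        · rcases k with _ | k
          · rw [ht.zero] at he; exact absurd he h0.ne
          · exact ⟨k, by rw [← he]; exact ht.strictMono (Nat.lt_succ_self k), he.ge⟩
        · exact ⟨k, hlt', hk.2⟩
      have hdw : s - max TM 0 ≤ t k := by
        have := (ht.dwell k).2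
        have h2 := le_max_left TM 0
        linarith [hk.2]
      have hrb : |r k| ≤ (G + 2) * W * (E * Real.exp (-α * s)) := by
        rcases k with _ | k
        · have h1 := hEexp 0 (by rw [ht.zero] at hdw; exact hdw)
          rw [mul_zero, Real.exp_zero] at h1
          have h2 : 0 ≤ (G + 2) * W := by positivity
          have h3 : 2 * W ≤ (G + 2) * W * 1 := by linarith
          exact hr0W.trans (h3.trans (mul_le_mul_of_nonneg_left h1 h2))
        · rw [hrk k, abs_neg]
          have h1 := hYb (t (k + 1)) (ht.nonneg _) (Sum.inr 0)
          have h2 := hEexp _ hdw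
          refine (show |x (t (k + 1)) (Sum.inr 0)| ≤ _ from h1).trans ?_
          exact mul_le_mul (by linarith) h2 (Real.exp_pos _).le (by positivity)
      have he : x s (Sum.inr 1) = x s (Sum.inr 0) + r k := by linarith [hr k s hk]
      rw [he]
      refine (abs_add_le _ _).trans ((add_le_add hi hrb).trans (le_of_eq (by ring)))
  rintro (p | i)
  · exact (hYb s hs (Sum.inl p)).trans hbig
  · fin_cases i
    · exact hi.trans hbig
    · exact hri

end Reset

end ResetPIRI

end

theorem proposition3 {np : ℕ}
    (Ap : Matrix (Fin np) (Fin np) ℝ) (Bp : Matrix (Fin np) (Fin 1) ℝ)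
    (Cp : Matrix (Fin 1) (Fin np) ℝ) (kp ki pr h : ℝ) (hh : 0 < h)
    (α Tm TM : ℝ) (hα : 0 < α) (hTm : 0 ≤ Tm) (hTmM : Tm ≤ TM)
    (N M : ℕ) (hM : 1 ≤ M) (𝒯 : Fin (M + 1) → ℝ) (h𝒯 : Monotone 𝒯)
    (h𝒯0 : 𝒯 0 = Tm) (h𝒯M : 𝒯 (Fin.last M) = TM)
    (hLMI : ResetPIRI.LMIFeasible (ResetPIRI.Lam Ap Bp) (ResetPIRI.LamD Bp Cp kp ki)
      (ResetPIRI.gainK np pr) N M α h 𝒯) :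
    ResetPIRI.SampledExpStable (ResetPIRI.Lam Ap Bp) (ResetPIRI.LamD Bp Cp kp ki)
        (ResetPIRI.gainK np pr) h Tm TM α ∧
      ∀ S : Set (ℝ × EuclideanSpace ℝ (ResetPIRI.RIdx np)),
        ResetPIRI.ResetExpStable (ResetPIRI.clA Ap Bp pr) (ResetPIRI.clAd Bp Cp kp ki)
          (ResetPIRI.clAR np) h S Tm TM α :=
  ⟨ResetPIRI.sampledExpStable_of_LMIFeasible hh hα hM h𝒯0 h𝒯M hLMI,
    ResetPIRI.resetExpStable_of_LMIFeasible hh hα hM h𝒯0 h𝒯M hLMI⟩
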